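/- Let $\Bbbk$ be a commutative ring and $R$ an associative $\Bbbk$-algebra. $R$-modules are left $R$-modules, and $R^\circ$-modules are right $R$-modules. Let $\operatorname{sfli} R$ be the supremum of the flat dimensions of all injective $R$-modules. For an $R^\circ$-module $M$ let $\operatorname{Tor}_i(M,-)$, $i\in\mathbb{Z}$, be the homological functor $\operatorname{Tor}^R$ from $R$-modules to $\Bbbk$-modules (zero for $i<0$). For an additive functor $T$ on $R$-modules, the first right satellite is $\operatorname{S}^1T(N)=\operatorname{Coker}(T(I)\to T(\Omega N))$, where $0\to N\to I\to\Omega N\to 0$ is exact with $I$ injective, and $\operatorname{S}^0T=T$, $\operatorname{S}^{n+1}T=\operatorname{S}^n(\operatorname{S}^1T)$ are its iterates. *Complete homology* is the J-completion of $\operatorname{Tor}(M,-)$, $$\widecheck{\operatorname{Tor}}_i(M,N)=\lim_{n\ge 0}\operatorname{S}^n\operatorname{Tor}_{n+i}(M,-)(N),\qquad i\in\mathbb{Z},$$ where the limit is taken along the maps $\operatorname{S}^{n+1}\operatorname{Tor}_{n+1+i}(M,-)\to\operatorname{S}^{n}\operatorname{Tor}_{n+i}(M,-)$ obtained by applying $\operatorname{S}^n$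 to the maps $\operatorname{S}^1\operatorname{Tor}_{n+1+i}(M,-)\to\operatorname{Tor}_{n+i}(M,-)$ induced by the connecting homomorphisms of the sequences $0\to N\to I\to\Omega N\to 0$. *Stable homology* is $\widetilde{\operatorname{Tor}}_i(M,N)=\operatorname{H}_{i+1}(P\mathbin{\widetilde\otimes}_R I)$, $i\in\mathbb{Z}$, where $P$ is a projective resolution of $M$, $I$ is an injective resolution of $N$, and $P\mathbin{\widetilde\otimes}_R I$ is the quotient of the complex with components $\prod_{j}P_{j+n}\otimes_R I^{j}$ in degree $n$ and differential $p\otimes x\mapsto\partial(p)\otimes x+(-1)^{|p|}p\otimes\partial(x)$ by the subcomplex with components $\coprod_{j}P_{j+n}\otimes_R I^{j}$. **Theorem.** If $\operatorname{sfli} R$ is finite, then for every $R^\circ$-module $M$ and all $i\in\mathbb{Z}$ there are isomorphisms $$\widecheck{\operatorname{Tor}}_i(M,-)\;\cong\;\widetilde{\operatorname{Tor}}_i(M,-)$$ of functors from the category of $R$-modules to the category of $\Bbbk$-modules. Moreover, $\operatorname{sfli} R$ is finite if $R$ is von Neumann regular (for every $a\in R$ there is an $x\in R$ with $a=axa$),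 and also if $R$ is Iwanaga–Gorenstein (noetherian on both sides and of finite injective dimension over itself on both sides). -/

import Mathlib

open CategoryTheory CategoryTheory.Limits
open scoped TensorProduct

universe u w

set_option linter.unusedSectionVars false

noncomputable section

namespace CompleteHomology

/-! ### Satellites and the J-completion of a homological functor -/

section Satellites

variable {C : Type*} [Category* C] [Abelian C] [EnoughInjectives C]
  {D : Type*} [Category* D] [Abelian D]

/-- The first cosyzygy `ΩN` of `N`: the cokernel of an embedding of `N` in an injective object. -/
def cosyzygy (N : C) : C := cokernel (Injective.ι N)

/-- The projection `I ⟶ ΩN`. -/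
def cosyzygyπ (N : C) : Injective.under N ⟶ cosyzygy N := cokernel.π (Injective.ι N)

instance (N : C) : Epi (cosyzygyπ N) :=
  inferInstanceAs (Epi (cokernel.π (Injective.ι N)))

/-- The sequence `0 ⟶ N ⟶ I ⟶ ΩN ⟶ 0`. -/
@[simps]
def cosyzygySeq (N : C) : ShortComplex C :=
  ShortComplex.mk (Injective.ι N) (cosyzygyπ N) (cokernel.condition _)

lemma cosyzygySeq_shortExact (N : C) : (cosyzygySeq N).ShortExact where
  exact := ShortComplex.exact_of_g_is_cokernel _ (cokernelIsCokernel (Injective.ι N))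
  mono_f := inferInstanceAs (Mono (Injective.ι N))
  epi_g := inferInstanceAs (Epi (cosyzygyπ N))

/-- An extension of `f : N ⟶ N'` to the injective objects. -/
def underMap {N N' : C} (f : N ⟶ N') : Injective.under N ⟶ Injective.under N' :=
  Injective.factorThru (f ≫ Injective.ι N') (Injective.ι N)

@[simp]
lemma ι_underMap {N N' : C} (f : N ⟶ N') :
    Injective.ι N ≫ underMap f = f ≫ Injective.ι N' :=
  Injective.comp_factorThru _ _

/-- The map on cosyzygies induced by `underMap f`. -/
def cosyzygyMap {N N' : C} (f : N ⟶ N') : cosyzygy N ⟶ cosyzygy N' :=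
  cokernel.map _ _ f (underMap f) (ι_underMap f)

@[simp]
lemma π_cosyzygyMap {N N' : C} (f : N ⟶ N') :
    cosyzygyπ N ≫ cosyzygyMap f = underMap f ≫ cosyzygyπ N' :=
  cokernel.π_desc _ _ _

/-- The morphism of short exact sequences induced by `f`. -/
@[simps]
def cosyzygySeqMap {N N' : C} (f : N ⟶ N') : cosyzygySeq N ⟶ cosyzygySeq N' where
  τ₁ := f
  τ₂ := underMap f
  τ₃ := cosyzygyMap f
  comm₁₂ := (ι_underMap f).symm
  comm₂₃ := (π_cosyzygyMap f).symm

/-- The value `S¹T(N) = Coker (T(I) ⟶ T(ΩN))` of the first right satellite. -/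
def satelliteObj (T : C ⥤ D) (N : C) : D := cokernel (T.map (cosyzygyπ N))

/-- The projection `T(ΩN) ⟶ S¹T(N)`. -/
def satelliteπ (T : C ⥤ D) (N : C) : T.obj (cosyzygy N) ⟶ satelliteObj T N := cokernel.π _

instance (T : C ⥤ D) (N : C) : Epi (satelliteπ T N) :=
  inferInstanceAs (Epi (cokernel.π (T.map (cosyzygyπ N))))

@[simp]
lemma map_π_satelliteπ (T : C ⥤ D) (N : C) : T.map (cosyzygyπ N) ≫ satelliteπ T N = 0 :=
  cokernel.condition _

/-- A map out of `S¹T(N)`. -/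
def satelliteDesc {T : C ⥤ D} {N : C} {X : D} (g : T.obj (cosyzygy N) ⟶ X)
    (hg : T.map (cosyzygyπ N) ≫ g = 0) : satelliteObj T N ⟶ X := cokernel.desc _ g hg

@[simp]
lemma π_satelliteDesc {T : C ⥤ D} {N : C} {X : D} (g : T.obj (cosyzygy N) ⟶ X)
    (hg : T.map (cosyzygyπ N) ≫ g = 0) : satelliteπ T N ≫ satelliteDesc g hg = g :=
  cokernel.π_desc _ _ _

@[simp]
lemma π_satelliteDesc_assoc {T : C ⥤ D} {N : C} {X Y : D} (g : T.obj (cosyzygy N) ⟶ X)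
    (hg : T.map (cosyzygyπ N) ≫ g = 0) (h : X ⟶ Y) :
    satelliteπ T N ≫ satelliteDesc g hg ≫ h = g ≫ h := by
  rw [← Category.assoc, π_satelliteDesc]

/-- The map `S¹T(N) ⟶ S¹T(N')` induced by `f : N ⟶ N'`. -/
def satelliteMap (T : C ⥤ D) {N N' : C} (f : N ⟶ N') : satelliteObj T N ⟶ satelliteObj T N' :=
  satelliteDesc (T.map (cosyzygyMap f) ≫ satelliteπ T N') (by
    rw [← T.map_comp_assoc, π_cosyzygyMap, T.map_comp_assoc, map_π_satelliteπ, comp_zero])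

@[simp]
lemma π_satelliteMap (T : C ⥤ D) {N N' : C} (f : N ⟶ N') :
    satelliteπ T N ≫ satelliteMap T f = T.map (cosyzygyMap f) ≫ satelliteπ T N' :=
  π_satelliteDesc _ _

@[simp]
lemma π_satelliteMap_assoc (T : C ⥤ D) {N N' : C} (f : N ⟶ N') {X : D}
    (h : satelliteObj T N' ⟶ X) :
    satelliteπ T N ≫ satelliteMap T f ≫ h = T.map (cosyzygyMap f) ≫ satelliteπ T N' ≫ h := by
  rw [← Category.assoc, π_satelliteMap, Category.assoc]

/-- For additive `T` the map on satellites does not depend on the chosen extension of `f`. -/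
lemma satelliteMap_unique (T : C ⥤ D) [T.Additive] {N N' : C} (f : N ⟶ N')
    (g : Injective.under N ⟶ Injective.under N') (c : cosyzygy N ⟶ cosyzygy N')
    (hg : Injective.ι N ≫ g = f ≫ Injective.ι N') (hc : cosyzygyπ N ≫ c = g ≫ cosyzygyπ N') :
    T.map c ≫ satelliteπ T N' = T.map (cosyzygyMap f) ≫ satelliteπ T N' := by
  let t : cosyzygy N ⟶ Injective.under N' := cokernel.desc _ (g - underMap f) (by simp [hg])
  have ht : cosyzygyπ N ≫ t = g - underMap f := cokernel.π_desc _ _ _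
  have h : c - cosyzygyMap f = t ≫ cosyzygyπ N' := by
    rw [← cancel_epi (cosyzygyπ N), ← Category.assoc, ht]
    simp [hc]
  rw [← sub_eq_zero, ← Preadditive.sub_comp, ← T.map_sub, h, T.map_comp, Category.assoc,
    map_π_satelliteπ, comp_zero]

/-- The first right satellite `S¹T` of an additive functor `T`. -/
def satelliteFunctor (T : C ⥤ D) [T.Additive] : C ⥤ D where
  obj N := satelliteObj T N
  map f := satelliteMap T f
  map_id N := by
    rw [← cancel_epi (satelliteπ T N), π_satelliteMap,
      ← satelliteMap_unique T (𝟙 N) (𝟙 _) (𝟙 _) (by simp) (by simp)]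
    simp
  map_comp {N N' N''} f f' := by
    rw [← cancel_epi (satelliteπ T N), π_satelliteMap, π_satelliteMap_assoc, π_satelliteMap,
      ← satelliteMap_unique T (f ≫ f') (underMap f ≫ underMap f')
        (cosyzygyMap f ≫ cosyzygyMap f')
        (by rw [← Category.assoc, ι_underMap, Category.assoc, ι_underMap, Category.assoc])
        (by rw [← Category.assoc, π_cosyzygyMap, Category.assoc, π_cosyzygyMap,
          Category.assoc])]
    simp

lemma satelliteMap_add (T : C ⥤ D) [T.Additive] {N N' : C} (f f' : N ⟶ N') :
    satelliteMap T (f + f') = satelliteMap T f + satelliteMap T f' := by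
  rw [← cancel_epi (satelliteπ T N), π_satelliteMap,
    ← satelliteMap_unique T (f + f') (underMap f + underMap f')
      (cosyzygyMap f + cosyzygyMap f') (by simp) (by simp),
    Preadditive.comp_add, π_satelliteMap, π_satelliteMap, T.map_add, Preadditive.add_comp]

instance (T : C ⥤ D) [T.Additive] : (satelliteFunctor T).Additive where
  map_add {_ _ f f'} := satelliteMap_add T f f'

/-- The component `S¹T(N) ⟶ S¹T'(N)` of the map of satellites induced by `α : T ⟶ T'`. -/
def satelliteApp {T T' : C ⥤ D} (α : T ⟶ T') (N : C) : satelliteObj T N ⟶ satelliteObj T' N :=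
  satelliteDesc (α.app _ ≫ satelliteπ T' N) (by
    rw [← Category.assoc, α.naturality, Category.assoc, map_π_satelliteπ, comp_zero])

@[simp]
lemma π_satelliteApp {T T' : C ⥤ D} (α : T ⟶ T') (N : C) :
    satelliteπ T N ≫ satelliteApp α N = α.app _ ≫ satelliteπ T' N :=
  π_satelliteDesc _ _

@[simp]
lemma π_satelliteApp_assoc {T T' : C ⥤ D} (α : T ⟶ T') (N : C) {X : D}
    (h : satelliteObj T' N ⟶ X) :
    satelliteπ T N ≫ satelliteApp α N ≫ h = α.app _ ≫ satelliteπ T' N ≫ h := by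
  rw [← Category.assoc, π_satelliteApp, Category.assoc]

lemma satelliteApp_naturality {T T' : C ⥤ D} (α : T ⟶ T') {N N' : C} (f : N ⟶ N') :
    satelliteMap T f ≫ satelliteApp α N' = satelliteApp α N ≫ satelliteMap T' f := by
  rw [← cancel_epi (satelliteπ T N)]
  simp

lemma satelliteApp_id (T : C ⥤ D) (N : C) : satelliteApp (𝟙 T) N = 𝟙 _ := by
  rw [← cancel_epi (satelliteπ T N)]
  simp

lemma satelliteApp_comp {T T' T'' : C ⥤ D} (α : T ⟶ T') (β : T' ⟶ T'') (N : C) :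
    satelliteApp (α ≫ β) N = satelliteApp α N ≫ satelliteApp β N := by
  rw [← cancel_epi (satelliteπ T N)]
  simp

/-- The map of satellites induced by `α : T ⟶ T'`. -/
def satelliteNatTrans {T T' : C ⥤ D} [T.Additive] [T'.Additive] (α : T ⟶ T') :
    satelliteFunctor T ⟶ satelliteFunctor T' where
  app N := satelliteApp α N
  naturality _ _ f := satelliteApp_naturality α f

/-- `S¹` as an endofunctor of the category of additive functors. -/
def satellite : (C ⥤+ D) ⥤ (C ⥤+ D) where
  obj T := AdditiveFunctor.of (satelliteFunctor T.obj)
  map α := ObjectProperty.homMk (satelliteNatTrans α.hom)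
  map_id T := ObjectProperty.hom_ext _ (NatTrans.ext (funext (satelliteApp_id T.obj)))
  map_comp α β := ObjectProperty.hom_ext _
    (NatTrans.ext (funext (satelliteApp_comp α.hom β.hom)))

/-- The iterated right satellites: `S⁰ = id` and `Sⁿ⁺¹T = Sⁿ(S¹T)`. As `S¹T` vanishes on
injective objects, `Sⁿ⁺¹T(N)` is the cokernel of `T(Iⁿ) ⟶ T(Ωⁿ⁺¹N)`. -/
def iteratedSatellite : ℕ → ((C ⥤+ D) ⥤ (C ⥤+ D))
  | 0 => 𝟭 _
  | n + 1 => satellite ⋙ iteratedSatellite n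

end Satellites

/-- A homological functor: a family of additive functors `T i`, `i ∈ ℤ`, with natural connecting
homomorphisms that turn short exact sequences into long exact sequences. -/
structure HomologicalFunctor (C : Type*) [Category* C] [Abelian C]
    (D : Type*) [Category* D] [Abelian D] where
  T : ℤ → (C ⥤+ D)
  δ : ∀ {S : ShortComplex C} (_ : S.ShortExact) (i j : ℤ) (_ : j + 1 = i),
    (T i).obj.obj S.X₃ ⟶ (T j).obj.obj S.X₁
  δ_naturality : ∀ {S S' : ShortComplex C} (hS : S.ShortExact) (hS' : S'.ShortExact)
    (φ : S ⟶ S') (i j : ℤ) (hij : j + 1 = i),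
    (T i).obj.map φ.τ₃ ≫ δ hS' i j hij = δ hS i j hij ≫ (T j).obj.map φ.τ₁
  map_comp_δ : ∀ {S : ShortComplex C} (hS : S.ShortExact) (i j : ℤ) (hij : j + 1 = i),
    (T i).obj.map S.g ≫ δ hS i j hij = 0
  δ_comp_map : ∀ {S : ShortComplex C} (hS : S.ShortExact) (i j : ℤ) (hij : j + 1 = i),
    δ hS i j hij ≫ (T j).obj.map S.f = 0
  exact₁ : ∀ {S : ShortComplex C} (hS : S.ShortExact) (i j : ℤ) (hij : j + 1 = i),
    (ShortComplex.mk _ _ (δ_comp_map hS i j hij)).Exact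
  exact₂ : ∀ {S : ShortComplex C} (_ : S.ShortExact) (i : ℤ), (S.map (T i).obj).Exact
  exact₃ : ∀ {S : ShortComplex C} (hS : S.ShortExact) (i j : ℤ) (hij : j + 1 = i),
    (ShortComplex.mk _ _ (map_comp_δ hS i j hij)).Exact

namespace HomologicalFunctor

variable {C : Type*} [Category* C] [Abelian C] [EnoughInjectives C]
  {D : Type*} [Category* D] [Abelian D] (H : HomologicalFunctor C D)

/-- The connecting homomorphism `T_{j+1}(ΩN) ⟶ T_j(N)` of `0 ⟶ N ⟶ I ⟶ ΩN ⟶ 0`. -/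
def cosyzygyδ (i j : ℤ) (hij : j + 1 = i) (N : C) :
    (H.T i).obj.obj (cosyzygy N) ⟶ (H.T j).obj.obj N :=
  H.δ (cosyzygySeq_shortExact N) i j hij

lemma map_comp_cosyzygyδ (i j : ℤ) (hij : j + 1 = i) (N : C) :
    (H.T i).obj.map (cosyzygyπ N) ≫ H.cosyzygyδ i j hij N = 0 :=
  H.map_comp_δ (cosyzygySeq_shortExact N) i j hij

lemma cosyzygyδ_naturality (i j : ℤ) (hij : j + 1 = i) {N N' : C} (f : N ⟶ N') :
    (H.T i).obj.map (cosyzygyMap f) ≫ H.cosyzygyδ i j hij N' =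
      H.cosyzygyδ i j hij N ≫ (H.T j).obj.map f :=
  H.δ_naturality (cosyzygySeq_shortExact N) (cosyzygySeq_shortExact N')
    (cosyzygySeqMap f) i j hij

lemma desc_cosyzygyδ_naturality (i j : ℤ) (hij : j + 1 = i) {N N' : C} (f : N ⟶ N') :
    satelliteMap (H.T i).obj f ≫
        satelliteDesc (H.cosyzygyδ i j hij N') (H.map_comp_cosyzygyδ i j hij N') =
      satelliteDesc (H.cosyzygyδ i j hij N) (H.map_comp_cosyzygyδ i j hij N) ≫
        (H.T j).obj.map f := by
  rw [← cancel_epi (satelliteπ _ N), π_satelliteMap_assoc, π_satelliteDesc,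
    π_satelliteDesc_assoc, cosyzygyδ_naturality]

/-- The morphism `S¹T_{j+1} ⟶ T_j` induced by the connecting homomorphisms of the sequences
`0 ⟶ N ⟶ I ⟶ ΩN ⟶ 0`. -/
def satelliteToSelf (i j : ℤ) (hij : j + 1 = i) : satellite.obj (H.T i) ⟶ H.T j :=
  ObjectProperty.homMk
    { app := fun N ↦
        satelliteDesc (H.cosyzygyδ i j hij N) (H.map_comp_cosyzygyδ i j hij N)
      naturality := fun _ _ f ↦ H.desc_cosyzygyδ_naturality i j hij f }

/-- The functor `SⁿT_{n+i}`. -/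
def completionTerm (i : ℤ) (n : ℕ) : C ⥤ D := ((iteratedSatellite n).obj (H.T (n + i))).obj

/-- The transition map `Sⁿ⁺¹T_{n+1+i} ⟶ SⁿT_{n+i}`. -/
def completionStep (i : ℤ) (n : ℕ) :
    H.completionTerm i (n + 1) ⟶ H.completionTerm i n :=
  (AdditiveFunctor.forget C D).map ((iteratedSatellite n).map
    (H.satelliteToSelf ((n + 1 : ℕ) + i) (n + i) (by push_cast; ring)))

/-- The inverse system `⋯ ⟶ S²T_{2+i} ⟶ S¹T_{1+i} ⟶ T_i`. -/
def completionSystem (i : ℤ) : ℕᵒᵖ ⥤ C ⥤ D := Functor.ofOpSequence (H.completionStep i)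

/-- The `J`-completion of a homological functor `T`, in degree `i`: the functor
`lim_{n ≥ 0} SⁿT_{n+i}`, with the projection to `S⁰T_i = T_i`. -/
def completion [HasLimitsOfShape ℕᵒᵖ D] (i : ℤ) : C ⥤ D := limit (H.completionSystem i)

end HomologicalFunctor


/-! ### Tensor products over a noncommutative `k`-algebra -/

section Tensor

variable (k : Type w) [CommRing k] (R : Type u) [Ring R] [Algebra k R]

section Unbundled

variable (M M' M'' : Type u) [AddCommGroup M] [AddCommGroup M'] [AddCommGroup M'']
  [Module k M] [Module k M'] [Module k M'']
  [Module Rᵐᵒᵖ M] [Module Rᵐᵒᵖ M'] [Module Rᵐᵒᵖ M'']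
  (N N' N'' : Type u) [AddCommGroup N] [AddCommGroup N'] [AddCommGroup N'']
  [Module k N] [Module k N'] [Module k N'']
  [Module R N] [Module R N'] [Module R N'']

/-- The `k`-submodule of `M ⊗[k] N` generated by all `m r ⊗ n - m ⊗ r n`. -/
def balancedRel : Submodule k (M ⊗[k] N) :=
  Submodule.span k
    {x | ∃ (m : M) (r : R) (n : N), x = (MulOpposite.op r • m) ⊗ₜ[k] n - m ⊗ₜ[k] (r • n)}

/-- The tensor product `M ⊗_R N` of a right `R`-module (an `Rᵐᵒᵖ`-module) `M` and a left
`R`-module `N`, as a `k`-module. -/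
abbrev BalTensor : Type u := (M ⊗[k] N) ⧸ balancedRel k R M N

namespace BalTensor

variable {M M' M'' N N' N''}

/-- The elementary tensor `m ⊗ n`. -/
def tmul (m : M) (n : N) : BalTensor k R M N := (balancedRel k R M N).mkQ (m ⊗ₜ[k] n)

lemma op_smul_tmul (m : M) (r : R) (n : N) :
    tmul k R (MulOpposite.op r • m) n = tmul k R m (r • n) :=
  (Submodule.Quotient.eq _).2 (Submodule.subset_span ⟨m, r, n, rfl⟩)

variable {k R} in
lemma hom_ext {X : Type*} [AddCommGroup X] [Module k X] {f g : BalTensor k R M N →ₗ[k] X}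
    (h : ∀ m n, f (tmul k R m n) = g (tmul k R m n)) : f = g :=
  Submodule.linearMap_qext _ (TensorProduct.ext' h)

variable [IsScalarTower k Rᵐᵒᵖ M] [IsScalarTower k Rᵐᵒᵖ M'] [IsScalarTower k Rᵐᵒᵖ M'']
  [IsScalarTower k R N] [IsScalarTower k R N'] [IsScalarTower k R N'']

variable {R} in
/-- The map `f ⊗ g` induced by a map `f` of right modules and a map `g` of left modules. -/
def map (f : M →ₗ[Rᵐᵒᵖ] M') (g : N →ₗ[R] N') : BalTensor k R M N →ₗ[k] BalTensor k R M' N' :=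
  (balancedRel k R M N).mapQ (balancedRel k R M' N')
    (TensorProduct.map (f.restrictScalars k) (g.restrictScalars k)) (by
      rw [balancedRel, Submodule.span_le]
      rintro _ ⟨m, r, n, rfl⟩
      refine Submodule.subset_span ⟨f m, r, g n, ?_⟩
      simp)

@[simp]
lemma map_tmul (f : M →ₗ[Rᵐᵒᵖ] M') (g : N →ₗ[R] N') (m : M) (n : N) :
    map k f g (tmul k R m n) = tmul k R (f m) (g n) := rfl

lemma tmul_add (m : M) (n n' : N) : tmul k R m (n + n') = tmul k R m n + tmul k R m n' := by
  simp [tmul, TensorProduct.tmul_add]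

lemma add_tmul (m m' : M) (n : N) : tmul k R (m + m') n = tmul k R m n + tmul k R m' n := by
  simp [tmul, TensorProduct.add_tmul]

lemma map_id : map k (LinearMap.id : M →ₗ[Rᵐᵒᵖ] M) (LinearMap.id : N →ₗ[R] N) =
    LinearMap.id := hom_ext fun _ _ ↦ rfl

lemma map_comp_map (f : M →ₗ[Rᵐᵒᵖ] M') (f' : M' →ₗ[Rᵐᵒᵖ] M'') (g : N →ₗ[R] N')
    (g' : N' →ₗ[R] N'') : map k f' g' ∘ₗ map k f g = map k (f' ∘ₗ f) (g' ∘ₗ g) :=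
  hom_ext fun _ _ ↦ rfl

lemma map_map (f : M →ₗ[Rᵐᵒᵖ] M') (f' : M' →ₗ[Rᵐᵒᵖ] M'') (g : N →ₗ[R] N')
    (g' : N' →ₗ[R] N'') (x : BalTensor k R M N) :
    map k f' g' (map k f g x) = map k (f' ∘ₗ f) (g' ∘ₗ g) x :=
  DFunLike.congr_fun (map_comp_map k R f f' g g') x

lemma map_add_left (f f' : M →ₗ[Rᵐᵒᵖ] M') (g : N →ₗ[R] N') :
    map k (f + f') g = map k f g + map k f' g :=
  hom_ext fun _ _ ↦ add_tmul k R _ _ _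

lemma map_add_right (f : M →ₗ[Rᵐᵒᵖ] M') (g g' : N →ₗ[R] N') :
    map k f (g + g') = map k f g + map k f g' :=
  hom_ext fun _ _ ↦ tmul_add k R _ _ _

lemma map_zero_left (g : N →ₗ[R] N') : map k (0 : M →ₗ[Rᵐᵒᵖ] M') g = 0 := by
  have := map_add_left k R (0 : M →ₗ[Rᵐᵒᵖ] M') 0 g
  simpa using this

lemma map_zero_right (f : M →ₗ[Rᵐᵒᵖ] M') : map k f (0 : N →ₗ[R] N') = 0 := by
  have := map_add_right k R f (0 : N →ₗ[R] N') 0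
  simpa using this

end BalTensor

end Unbundled

/-- Restriction of scalars: a module over a `k`-algebra is a `k`-module. -/
@[reducible]
def restrictModule {A : Type u} [Ring A] [Algebra k A] (M : ModuleCat.{u} A) : Module k M :=
  Module.restrictScalars k A M

attribute [local instance] restrictModule

lemma isScalarTower_restrictModule {A : Type u} [Ring A] [Algebra k A] (M : ModuleCat.{u} A) :
    IsScalarTower k A M :=
  IsScalarTower.restrictScalars k A M

attribute [local instance] isScalarTower_restrictModule

/-- The bifunctor `M, N ↦ M ⊗_R N` with values in `k`-modules. -/
def tensorBifunctor : ModuleCat.{u} Rᵐᵒᵖ ⥤ ModuleCat.{u} R ⥤ ModuleCat.{u} k where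
  obj M :=
    { obj := fun N ↦ ModuleCat.of k (BalTensor k R M N)
      map := fun g ↦ ModuleCat.ofHom (BalTensor.map k LinearMap.id g.hom)
      map_id := fun N ↦ ModuleCat.hom_ext (BalTensor.map_id k R)
      map_comp := fun g g' ↦ ModuleCat.hom_ext (BalTensor.hom_ext fun _ _ ↦ rfl) }
  map f :=
    { app := fun N ↦ ModuleCat.ofHom (BalTensor.map k f.hom LinearMap.id)
      naturality := fun _ _ g ↦ ModuleCat.hom_ext (BalTensor.hom_ext fun _ _ ↦ rfl) }
  map_id M := by
    ext N : 2
    exact ModuleCat.hom_ext (BalTensor.map_id k R)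
  map_comp f f' := by
    ext N : 2
    exact ModuleCat.hom_ext (BalTensor.hom_ext fun _ _ ↦ rfl)

instance (M : ModuleCat.{u} Rᵐᵒᵖ) : ((tensorBifunctor k R).obj M).Additive where
  map_add := ModuleCat.hom_ext (BalTensor.map_add_right k R _ _ _)

instance (N : ModuleCat.{u} R) : ((tensorBifunctor k R).flip.obj N).Additive where
  map_add := ModuleCat.hom_ext (BalTensor.map_add_left k R _ _ _)

/-! Tensoring with a projective right module `P` is exact: `P ⊗_R -` is a natural retract of
the exact functor `N ↦ (P →₀ N)`. -/

section ProjectiveExact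

variable {R} {P : Type u} [AddCommGroup P] [Module k P] [Module Rᵐᵒᵖ P] [IsScalarTower k Rᵐᵒᵖ P]
  {N N' : Type u} [AddCommGroup N] [AddCommGroup N'] [Module k N] [Module k N']
  [Module R N] [Module R N'] [IsScalarTower k R N] [IsScalarTower k R N']

/-- The map `P ⊗_R N ⟶ (P →₀ N)`, `p ⊗ n ↦ s(p) n`, given by a map `s` from `P` to the free
module on `P`. -/
def toFinsupp (s : P →ₗ[Rᵐᵒᵖ] (P →₀ Rᵐᵒᵖ)) : BalTensor k R P N →ₗ[k] (P →₀ N) :=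
  (balancedRel k R P N).liftQ
    (TensorProduct.lift (LinearMap.mk₂ k
      (fun p n ↦ (s p).mapRange (fun r ↦ r.unop • n) (by simp))
      (fun p p' n ↦ by ext q; simp [add_smul])
      (fun c p n ↦ by
        ext q
        simp [LinearMap.map_smul_of_tower])
      (fun p n n' ↦ by ext q; simp)
      (fun c p n ↦ by ext q; simp [smul_comm c]))) (by
    rw [balancedRel, Submodule.span_le]
    rintro _ ⟨p, r, n, rfl⟩
    ext q
    simp [mul_smul])

/-- The map `(P →₀ N) ⟶ P ⊗_R N`. -/
def ofFinsupp : (P →₀ N) →ₗ[k] BalTensor k R P N :=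
  Finsupp.lsum k fun p ↦ (balancedRel k R P N).mkQ ∘ₗ TensorProduct.mk k P N p

lemma ofFinsupp_toFinsupp (s : P →ₗ[Rᵐᵒᵖ] (P →₀ Rᵐᵒᵖ))
    (hs : ∀ p, Finsupp.linearCombination Rᵐᵒᵖ id (s p) = p) (x : BalTensor k R P N) :
    ofFinsupp k (toFinsupp k s x) = x := by
  suffices h : ofFinsupp k ∘ₗ toFinsupp k s = (LinearMap.id : BalTensor k R P N →ₗ[k] _) from
    DFunLike.congr_fun h x
  refine BalTensor.hom_ext fun p n ↦ ?_
  have key : ∀ t : P →₀ Rᵐᵒᵖ,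
      ofFinsupp k (t.mapRange (fun r ↦ r.unop • n) (by simp)) =
        BalTensor.tmul k R (Finsupp.linearCombination Rᵐᵒᵖ id t) n := by
    intro t
    induction t using Finsupp.induction_linear with
    | zero => simp [BalTensor.tmul]
    | add f g hf hg =>
      rw [Finsupp.mapRange_add (fun x y ↦ by simp [add_smul]), map_add, hf, hg, map_add,
        BalTensor.add_tmul]
    | single q r =>
      rw [Finsupp.mapRange_single, Finsupp.linearCombination_single]
      refine Eq.trans ?_ (BalTensor.op_smul_tmul k R q r.unop n).symm
      simp [ofFinsupp, BalTensor.tmul]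
  exact (key (s p)).trans (by rw [hs]; rfl)

lemma toFinsupp_map (s : P →ₗ[Rᵐᵒᵖ] (P →₀ Rᵐᵒᵖ)) (g : N →ₗ[R] N') (x : BalTensor k R P N) :
    toFinsupp k s (BalTensor.map k LinearMap.id g x) =
      (toFinsupp k s x).mapRange g (map_zero g) := by
  suffices h : toFinsupp k s ∘ₗ BalTensor.map k LinearMap.id g =
      Finsupp.mapRange.linearMap (g.restrictScalars k) ∘ₗ toFinsupp k s from
    DFunLike.congr_fun h x
  refine BalTensor.hom_ext fun p n ↦ ?_
  ext q
  exact (map_smul g _ _).symm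

lemma map_ofFinsupp (g : N →ₗ[R] N') (y : P →₀ N) :
    BalTensor.map k LinearMap.id g (ofFinsupp k y) =
      ofFinsupp k (y.mapRange g (map_zero g)) := by
  suffices h : BalTensor.map k LinearMap.id g ∘ₗ ofFinsupp k =
      (ofFinsupp k : (P →₀ N') →ₗ[k] BalTensor k R P N') ∘ₗ
        Finsupp.mapRange.linearMap (g.restrictScalars k) from
    DFunLike.congr_fun h y
  ext p n
  simp [ofFinsupp, BalTensor.map]

end ProjectiveExact

lemma tensor_shortExact (P : ModuleCat.{u} Rᵐᵒᵖ) [Projective P] {S : ShortComplex (ModuleCat.{u} R)}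
    (hS : S.ShortExact) : (S.map ((tensorBifunctor k R).obj P)).ShortExact := by
  have hP : Module.Projective Rᵐᵒᵖ P := (IsProjective.iff_projective P).2 inferInstance
  obtain ⟨s, hs⟩ := hP.out
  have hinj : Function.Injective S.f.hom := hS.moduleCat_injective_f
  have hsurj : Function.Surjective S.g.hom := hS.moduleCat_surjective_g
  have hex : ∀ n, S.g.hom n = 0 → ∃ m, S.f.hom m = n :=
    (ShortComplex.moduleCat_exact_iff S).1 hS.exact
  have hinj' : Function.Injective (fun y : P →₀ S.X₁ ↦ y.mapRange S.f.hom (map_zero _)) :=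
    Finsupp.mapRange_injective _ _ hinj
  have hsurj' : Function.Surjective (fun y : P →₀ S.X₂ ↦ y.mapRange S.g.hom (map_zero _)) :=
    Finsupp.mapRange_surjective _ _ hsurj
  refine { exact := ?_, mono_f := ?_, epi_g := ?_ }
  · rw [ShortComplex.moduleCat_exact_iff]
    intro (x : BalTensor k R P S.X₂) hx
    replace hx : BalTensor.map k LinearMap.id S.g.hom x = 0 := hx
    have h1 : (toFinsupp k s x).mapRange S.g.hom (map_zero _) = 0 := by
      rw [← toFinsupp_map, hx, map_zero]
    have h2 : ∀ p, ∃ m, S.f.hom m = toFinsupp k s x p := fun p ↦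
      hex _ (by simpa using DFunLike.congr_fun h1 p)
    choose m hm using h2
    classical
    let y : P →₀ S.X₁ := Finsupp.onFinset (toFinsupp k s x).support m (fun p hp ↦ by
      rw [Finsupp.mem_support_iff, ← hm p]
      exact fun h ↦ hp (hinj (by rw [h, map_zero])))
    refine ⟨ofFinsupp k y, (map_ofFinsupp k S.f.hom y).trans ?_⟩
    conv_rhs => rw [← ofFinsupp_toFinsupp k s hs x]
    congr 1
    ext p
    simp [y, hm]
  · refine (ModuleCat.mono_iff_injective _).2 fun (x y : BalTensor k R P S.X₁) hxy ↦ ?_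
    replace hxy : BalTensor.map k LinearMap.id S.f.hom x =
      BalTensor.map k LinearMap.id S.f.hom y := hxy
    rw [← ofFinsupp_toFinsupp k s hs x, ← ofFinsupp_toFinsupp k s hs y]
    congr 1
    refine hinj' ?_
    dsimp only
    rw [← toFinsupp_map, ← toFinsupp_map, hxy]
  · refine (ModuleCat.epi_iff_surjective _).2 fun (x : BalTensor k R P S.X₃) ↦ ?_
    obtain ⟨y, hy⟩ := hsurj' (toFinsupp k s x)
    refine ⟨ofFinsupp k y, (map_ofFinsupp k S.g.hom y).trans ?_⟩
    rw [← ofFinsupp_toFinsupp k s hs x]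
    exact congrArg _ hy

/-! ### Tor -/

/-- The inclusion of the natural numbers in the integers, as an embedding of the shapes of chain
complexes. -/
def chainEmbedding : ComplexShape.Embedding (ComplexShape.down ℕ) (ComplexShape.down ℤ) :=
  ComplexShape.Embedding.mk' _ _ (fun n ↦ (n : ℤ)) (fun _ _ h ↦ by simpa using h)
    (fun _ _ ↦ by simp only [ComplexShape.down_Rel]; omega)

/-- A projective resolution of `M`, as a chain complex indexed by `ℤ`. -/
def projRes (M : ModuleCat.{u} Rᵐᵒᵖ) : ChainComplex (ModuleCat.{u} Rᵐᵒᵖ) ℤ :=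
  (projectiveResolution M).complex.extend chainEmbedding

instance (M : ModuleCat.{u} Rᵐᵒᵖ) (i : ℤ) : Projective ((projRes R M).X i) := by
  by_cases h : ∃ n : ℕ, chainEmbedding.f n = i
  · obtain ⟨n, hn⟩ := h
    exact Projective.of_iso (HomologicalComplex.extendXIso _ _ hn).symm inferInstance
  · push Not at h
    have hz := HomologicalComplex.isZero_extend_X
      (projectiveResolution M).complex chainEmbedding i h
    exact ⟨fun f e _ ↦ ⟨0, hz.eq_of_src _ _⟩⟩

/-- The functor `N ↦ Q ⊗_R N` for a complex `Q` of right modules. -/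
def tensorComplex (Q : ChainComplex (ModuleCat.{u} Rᵐᵒᵖ) ℤ) :
    ModuleCat.{u} R ⥤ ChainComplex (ModuleCat.{u} k) ℤ where
  obj N := (((tensorBifunctor k R).flip.obj N).mapHomologicalComplex _).obj Q
  map g :=
    { f := fun i ↦ ((tensorBifunctor k R).obj (Q.X i)).map g
      comm' := fun i j _ ↦ (((tensorBifunctor k R).map (Q.d i j)).naturality g) }
  map_id N := by
    ext i : 1
    exact ((tensorBifunctor k R).obj (Q.X i)).map_id N
  map_comp f g := by
    ext i : 1
    exact ((tensorBifunctor k R).obj (Q.X i)).map_comp f g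

instance (Q : ChainComplex (ModuleCat.{u} Rᵐᵒᵖ) ℤ) : (tensorComplex k R Q).Additive where
  map_add {_ _ f g} := by
    ext i : 1
    exact ((tensorBifunctor k R).obj (Q.X i)).map_add

lemma tensorComplex_shortExact (Q : ChainComplex (ModuleCat.{u} Rᵐᵒᵖ) ℤ)
    [∀ i, Projective (Q.X i)] {S : ShortComplex (ModuleCat.{u} R)} (hS : S.ShortExact) :
    (S.map (tensorComplex k R Q)).ShortExact :=
  HomologicalComplex.shortExact_of_degreewise_shortExact _
    fun i ↦ tensor_shortExact k R (Q.X i) hS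

variable {R}

/-- The functor `Tor_i^R(M, -)`, for `i ∈ ℤ`: the homology of `P ⊗_R -`, where `P` is a
projective resolution of `M`. -/
def torFunctor (M : ModuleCat.{u} Rᵐᵒᵖ) (i : ℤ) : ModuleCat.{u} R ⥤ ModuleCat.{u} k :=
  tensorComplex k R (projRes R M) ⋙ HomologicalComplex.homologyFunctor _ _ i

instance (M : ModuleCat.{u} Rᵐᵒᵖ) (i : ℤ) : (torFunctor k M i).Additive := by
  dsimp [torFunctor]; infer_instance

/-- `Tor^R(M, -)` as a homological functor, with the usual connecting homomorphisms. -/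
def tor (M : ModuleCat.{u} Rᵐᵒᵖ) :
    HomologicalFunctor (ModuleCat.{u} R) (ModuleCat.{u} k) where
  T i := AdditiveFunctor.of (torFunctor k M i)
  δ hS i j hij := (tensorComplex_shortExact k R (projRes R M) hS).δ i j hij
  δ_naturality hS hS' φ i j hij :=
    (HomologicalComplex.HomologySequence.δ_naturality
      ((tensorComplex k R (projRes R M)).mapShortComplex.map φ)
      (tensorComplex_shortExact k R _ hS) (tensorComplex_shortExact k R _ hS') i j hij).symm
  map_comp_δ hS i j hij := (tensorComplex_shortExact k R _ hS).comp_δ i j hij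
  δ_comp_map hS i j hij := (tensorComplex_shortExact k R _ hS).δ_comp i j hij
  exact₁ hS i j hij := (tensorComplex_shortExact k R _ hS).homology_exact₁ i j hij
  exact₂ hS i := (tensorComplex_shortExact k R _ hS).homology_exact₂ i
  exact₃ hS i j hij := (tensorComplex_shortExact k R _ hS).homology_exact₃ i j hij

/-- Complete homology `Ťor_i^R(M, -)`: the `J`-completion of `Tor^R(M, -)`. -/
def completeTor (M : ModuleCat.{u} Rᵐᵒᵖ) (i : ℤ) : ModuleCat.{u} R ⥤ ModuleCat.{u} k :=
  (tor k M).completion i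

/-! ### Stable homology -/

section Stable

variable (Q : ChainComplex (ModuleCat.{u} Rᵐᵒᵖ) ℤ)

/-- The pairs `(p, q)` with `p - q = n`. -/
abbrev Bidegree (n : ℤ) : Type := {a : ℤ × ℤ // a.1 = a.2 + n}

/-- The degree `n` component `∏_q Q_{q+n} ⊗_R J^q` of the completed tensor product. -/
abbrev ProdTensor (J : CochainComplex (ModuleCat.{u} R) ℤ) (n : ℤ) : Type u :=
  ∀ a : Bidegree n, BalTensor k R (Q.X a.1.1) (J.X a.1.2)

/-- The differential of the completed tensor product, which extends
`x ⊗ y ↦ d x ⊗ y + (-1)^|x| x ⊗ d y`. -/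
def prodTensorD (J : CochainComplex (ModuleCat.{u} R) ℤ) (i j : ℤ) (h : j + 1 = i) :
    ProdTensor k Q J i →ₗ[k] ProdTensor k Q J j :=
  LinearMap.pi fun b ↦
    BalTensor.map k (Q.d (b.1.1 + 1) b.1.1).hom LinearMap.id ∘ₗ
        LinearMap.proj (⟨(b.1.1 + 1, b.1.2), by have := b.2; dsimp only; omega⟩ : Bidegree i) +
      (b.1.1.negOnePow : ℤ) • (BalTensor.map k LinearMap.id (J.d (b.1.2 - 1) b.1.2).hom ∘ₗ
        LinearMap.proj (⟨(b.1.1, b.1.2 - 1), by have := b.2; dsimp only; omega⟩ : Bidegree i))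

lemma prodTensorD_apply (J : CochainComplex (ModuleCat.{u} R) ℤ) (i j : ℤ) (h : j + 1 = i)
    (x : ProdTensor k Q J i) (p q p' q' : ℤ) (hpq : p = q + j) (hp : p + 1 = p')
    (hq : q' + 1 = q) :
    prodTensorD k Q J i j h x ⟨(p, q), hpq⟩ =
      BalTensor.map k (Q.d p' p).hom LinearMap.id
          (x ⟨(p', q), by dsimp only; omega⟩) +
        (p.negOnePow : ℤ) • BalTensor.map k LinearMap.id (J.d q' q).hom
          (x ⟨(p, q'), by dsimp only; omega⟩) := by
  obtain rfl : q' = q - 1 := by omega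
  subst hp
  rfl

lemma prodTensorD_comp (J : CochainComplex (ModuleCat.{u} R) ℤ) (i j l : ℤ) (h : j + 1 = i)
    (h' : l + 1 = j) (x : ProdTensor k Q J i) :
    prodTensorD k Q J j l h' (prodTensorD k Q J i j h x) = 0 := by
  funext ⟨⟨p, q⟩, hpq⟩
  dsimp only at hpq
  have hQ : (Q.d (p + 1) p).hom ∘ₗ (Q.d (p + 1 + 1) (p + 1)).hom = 0 := by
    rw [← ModuleCat.hom_comp, Q.d_comp_d]; rfl
  have hJ : (J.d (q - 1) q).hom ∘ₗ (J.d (q - 1 - 1) (q - 1)).hom = 0 := by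
    rw [← ModuleCat.hom_comp, J.d_comp_d]; rfl
  rw [prodTensorD_apply k Q J j l h' _ p q (p + 1) (q - 1) hpq rfl (by omega),
    prodTensorD_apply k Q J i j h x (p + 1) q (p + 1 + 1) (q - 1) (by omega) rfl (by omega),
    prodTensorD_apply k Q J i j h x p (q - 1) (p + 1) (q - 1 - 1) (by omega) rfl (by omega)]
  simp only [map_add, map_zsmul, BalTensor.map_map, hQ, hJ, BalTensor.map_zero_left,
    BalTensor.map_zero_right, LinearMap.zero_apply, LinearMap.id_comp, LinearMap.comp_id,
    Int.negOnePow_succ, smul_add, smul_zero]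
  simp

/-- The degree `n` component of the tensor product complex, as a submodule of the degree `n`
component of the completed tensor product: the families with finite support. -/
def finTensor (J : CochainComplex (ModuleCat.{u} R) ℤ) (n : ℤ) :
    Submodule k (ProdTensor k Q J n) where
  carrier := {x | {a | x a ≠ 0}.Finite}
  zero_mem' := by simp
  add_mem' {x y} hx hy := (hx.union hy).subset fun a ha ↦ by
    by_contra h
    simp only [Set.mem_union, Set.mem_ofPred_eq, not_or, not_not] at h
    exact ha (by simp [h.1, h.2])
  smul_mem' c x hx := hx.subset fun a ha h ↦ ha (by simp [h])

lemma finTensor_le_comap (J : CochainComplex (ModuleCat.{u} R) ℤ) (i j : ℤ) (h : j + 1 = i) :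
    finTensor k Q J i ≤ (finTensor k Q J j).comap (prodTensorD k Q J i j h) := by
  intro x (hx : {a | x a ≠ 0}.Finite)
  have h1 : ((fun b : Bidegree j ↦ (⟨(b.1.1 + 1, b.1.2), by
      have := b.2; dsimp only; omega⟩ : Bidegree i)) ⁻¹' {a | x a ≠ 0}).Finite :=
    hx.preimage (fun b _ b' _ hb ↦ by
      simp only [Subtype.mk.injEq, Prod.mk.injEq] at hb
      exact Subtype.ext (Prod.ext (by omega) hb.2))
  have h2 : ((fun b : Bidegree j ↦ (⟨(b.1.1, b.1.2 - 1), by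
      have := b.2; dsimp only; omega⟩ : Bidegree i)) ⁻¹' {a | x a ≠ 0}).Finite :=
    hx.preimage (fun b _ b' _ hb ↦ by
      simp only [Subtype.mk.injEq, Prod.mk.injEq] at hb
      exact Subtype.ext (Prod.ext hb.1 (by omega)))
  refine (h1.union h2).subset fun b hb ↦ ?_
  by_contra hcon
  simp only [Set.mem_union, Set.mem_preimage, Set.mem_ofPred_eq, not_or, not_not] at hcon
  refine hb ?_
  simp [prodTensorD, hcon.1, hcon.2]

/-- The quotient `Q ⊗̃_R J` of the completed tensor product by the tensor product. -/
def stableTensor (J : CochainComplex (ModuleCat.{u} R) ℤ) : ChainComplex (ModuleCat.{u} k) ℤ where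
  X n := ModuleCat.of k (ProdTensor k Q J n ⧸ finTensor k Q J n)
  d i j := if h : j + 1 = i then
    ModuleCat.ofHom ((finTensor k Q J i).mapQ (finTensor k Q J j) (prodTensorD k Q J i j h)
      (finTensor_le_comap k Q J i j h)) else 0
  shape i j h := dif_neg h
  d_comp_d' i j l hij hjl := by
    have hij' : j + 1 = i := hij
    have hjl' : l + 1 = j := hjl
    rw [dif_pos hij', dif_pos hjl']
    refine ModuleCat.hom_ext (Submodule.linearMap_qext _ (LinearMap.ext fun x ↦ ?_))
    exact congrArg (finTensor k Q J l).mkQ (prodTensorD_comp k Q J i j l hij' hjl' x)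

lemma stableTensor_d (J : CochainComplex (ModuleCat.{u} R) ℤ) (i j : ℤ) (h : j + 1 = i) :
    (stableTensor k Q J).d i j =
      ModuleCat.ofHom ((finTensor k Q J i).mapQ (finTensor k Q J j) (prodTensorD k Q J i j h)
        (finTensor_le_comap k Q J i j h)) :=
  dif_pos h

variable {J J' : CochainComplex (ModuleCat.{u} R) ℤ}

/-- The map of completed tensor products induced by `φ : J ⟶ J'`. -/
def prodTensorMap (φ : J ⟶ J') (n : ℤ) : ProdTensor k Q J n →ₗ[k] ProdTensor k Q J' n :=
  LinearMap.pi fun a ↦ BalTensor.map k LinearMap.id (φ.f a.1.2).hom ∘ₗ LinearMap.proj a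

lemma finTensor_le_comap_map (φ : J ⟶ J') (n : ℤ) :
    finTensor k Q J n ≤ (finTensor k Q J' n).comap (prodTensorMap k Q φ n) :=
  fun x (hx : {a | x a ≠ 0}.Finite) ↦ hx.subset fun a ha h ↦ ha (by simp [prodTensorMap, h])

lemma prodTensorMap_comm (φ : J ⟶ J') (i j : ℤ) (h : j + 1 = i) (x : ProdTensor k Q J i) :
    prodTensorD k Q J' i j h (prodTensorMap k Q φ i x) =
      prodTensorMap k Q φ j (prodTensorD k Q J i j h x) := by
  funext ⟨⟨p, q⟩, hpq⟩
  have hφ : (J'.d (q - 1) q).hom ∘ₗ (φ.f (q - 1)).hom = (φ.f q).hom ∘ₗ (J.d (q - 1) q).hom := by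
    rw [← ModuleCat.hom_comp, ← ModuleCat.hom_comp, φ.comm]
  simp [prodTensorD, prodTensorMap, BalTensor.map_map, hφ]

/-- The map `Q ⊗̃_R J ⟶ Q ⊗̃_R J'` induced by `φ : J ⟶ J'`. -/
def stableTensorMap (φ : J ⟶ J') : stableTensor k Q J ⟶ stableTensor k Q J' where
  f n := ModuleCat.ofHom ((finTensor k Q J n).mapQ (finTensor k Q J' n) (prodTensorMap k Q φ n)
    (finTensor_le_comap_map k Q φ n))
  comm' i j hij := by
    rw [stableTensor_d k Q J i j hij, stableTensor_d k Q J' i j hij]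
    refine ModuleCat.hom_ext (Submodule.linearMap_qext _ (LinearMap.ext fun x ↦ ?_))
    exact congrArg (finTensor k Q J' j).mkQ (prodTensorMap_comm k Q φ i j hij x)

/-- The functor `J ↦ Q ⊗̃_R J`. -/
def stableTensorFunctor :
    CochainComplex (ModuleCat.{u} R) ℤ ⥤ ChainComplex (ModuleCat.{u} k) ℤ where
  obj J := stableTensor k Q J
  map φ := stableTensorMap k Q φ
  map_id J := by
    ext n : 1
    refine ModuleCat.hom_ext (Submodule.linearMap_qext _ (LinearMap.ext fun x ↦ ?_))
    exact congrArg (finTensor k Q J n).mkQ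
      (funext fun a ↦ DFunLike.congr_fun (BalTensor.map_id k R) (x a))
  map_comp {J J' J''} φ ψ := by
    ext n : 1
    refine ModuleCat.hom_ext (Submodule.linearMap_qext _ (LinearMap.ext fun x ↦ ?_))
    exact congrArg (finTensor k Q J'' n).mkQ
      (funext fun a ↦ (BalTensor.map_map k R LinearMap.id LinearMap.id (φ.f a.1.2).hom
        (ψ.f a.1.2).hom (x a)).symm)

/-- The map of degree `1` of completed tensor products induced by a homotopy. -/
def prodTensorHomotopy {φ ψ : J ⟶ J'} (H : Homotopy φ ψ) (i j : ℤ) (h : i + 1 = j) :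
    ProdTensor k Q J i →ₗ[k] ProdTensor k Q J' j :=
  LinearMap.pi fun b ↦ (b.1.1.negOnePow : ℤ) •
    (BalTensor.map k LinearMap.id (H.hom (b.1.2 + 1) b.1.2).hom ∘ₗ
      LinearMap.proj (⟨(b.1.1, b.1.2 + 1), by have := b.2; dsimp only; omega⟩ : Bidegree i))

lemma prodTensorHomotopy_apply {φ ψ : J ⟶ J'} (H : Homotopy φ ψ) (i j : ℤ) (h : i + 1 = j)
    (x : ProdTensor k Q J i) (p q q' : ℤ) (hpq : p = q + j) (hq : q + 1 = q') :
    prodTensorHomotopy k Q H i j h x ⟨(p, q), hpq⟩ =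
      (p.negOnePow : ℤ) • BalTensor.map k LinearMap.id (H.hom q' q).hom
        (x ⟨(p, q'), by dsimp only; omega⟩) := by
  subst hq
  rfl

lemma finTensor_le_comap_homotopy {φ ψ : J ⟶ J'} (H : Homotopy φ ψ) (i j : ℤ) (h : i + 1 = j) :
    finTensor k Q J i ≤ (finTensor k Q J' j).comap (prodTensorHomotopy k Q H i j h) := by
  intro x (hx : {a | x a ≠ 0}.Finite)
  have h1 : ((fun b : Bidegree j ↦ (⟨(b.1.1, b.1.2 + 1), by
      have := b.2; dsimp only; omega⟩ : Bidegree i)) ⁻¹' {a | x a ≠ 0}).Finite :=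
    hx.preimage (fun b _ b' _ hb ↦ by
      simp only [Subtype.mk.injEq, Prod.mk.injEq] at hb
      exact Subtype.ext (Prod.ext hb.1 (by omega)))
  refine h1.subset fun b hb hcon ↦ hb ?_
  simp [prodTensorHomotopy, hcon]

lemma prodTensorHomotopy_comm {φ ψ : J ⟶ J'} (H : Homotopy φ ψ) (i j l : ℤ) (h : j + 1 = i)
    (h' : i + 1 = l) (x : ProdTensor k Q J i) :
    prodTensorMap k Q φ i x =
      prodTensorHomotopy k Q H j i h (prodTensorD k Q J i j h x) +
        prodTensorD k Q J' l i h' (prodTensorHomotopy k Q H i l h' x) +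
          prodTensorMap k Q ψ i x := by
  funext ⟨⟨p, q⟩, hpq⟩
  dsimp only at hpq
  have hH : (φ.f q).hom = (H.hom (q + 1) q).hom ∘ₗ (J.d q (q + 1)).hom +
      (J'.d (q - 1) q).hom ∘ₗ (H.hom q (q - 1)).hom + (ψ.f q).hom := by
    have := H.comm q
    rw [dNext_eq _ (show (ComplexShape.up ℤ).Rel q (q + 1) from rfl),
      prevD_eq _ (show (ComplexShape.up ℤ).Rel (q - 1) q by simp)] at this
    rw [this]
    rfl
  have hsq : ∀ z : BalTensor k R (Q.X p) (J'.X q),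
      (p.negOnePow : ℤ) • (p.negOnePow : ℤ) • z = z := fun z ↦ by
    rw [smul_smul, ← Units.val_mul, Int.units_mul_self, Units.val_one, one_smul]
  rw [Pi.add_apply, Pi.add_apply,
    prodTensorHomotopy_apply k Q H j i h _ p q (q + 1) hpq rfl,
    prodTensorD_apply k Q J i j h x p (q + 1) (p + 1) q (by omega) rfl rfl,
    prodTensorD_apply k Q J' l i h' _ p q (p + 1) (q - 1) hpq rfl (by omega),
    prodTensorHomotopy_apply k Q H i l h' x (p + 1) q (q + 1) (by omega) rfl,
    prodTensorHomotopy_apply k Q H i l h' x p (q - 1) q (by omega) (by omega)]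
  simp only [prodTensorMap, LinearMap.pi_apply, LinearMap.comp_apply, LinearMap.proj_apply, hH,
    BalTensor.map_add_right, LinearMap.add_apply, map_add, map_zsmul, smul_add, hsq,
    BalTensor.map_map, LinearMap.id_comp, LinearMap.comp_id, Int.negOnePow_succ, Units.val_neg,
    neg_smul, map_neg]
  abel

/-- The components of the homotopy `stableTensorHomotopy` below. -/
def stableTensorHomotopyHom {φ ψ : J ⟶ J'} (H : Homotopy φ ψ) (i j : ℤ) :
    (stableTensor k Q J).X i ⟶ (stableTensor k Q J').X j :=
  if h : i + 1 = j then
    ModuleCat.ofHom ((finTensor k Q J i).mapQ (finTensor k Q J' j)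
      (prodTensorHomotopy k Q H i j h) (finTensor_le_comap_homotopy k Q H i j h)) else 0

lemma stableTensorHomotopyHom_eq {φ ψ : J ⟶ J'} (H : Homotopy φ ψ) (i j : ℤ) (h : i + 1 = j) :
    stableTensorHomotopyHom k Q H i j =
      ModuleCat.ofHom ((finTensor k Q J i).mapQ (finTensor k Q J' j)
        (prodTensorHomotopy k Q H i j h) (finTensor_le_comap_homotopy k Q H i j h)) :=
  dif_pos h

/-- Homotopic maps induce homotopic maps on `Q ⊗̃_R -`. -/
def stableTensorHomotopy {φ ψ : J ⟶ J'} (H : Homotopy φ ψ) :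
    Homotopy (stableTensorMap k Q φ) (stableTensorMap k Q ψ) where
  hom := stableTensorHomotopyHom k Q H
  zero i j h := dif_neg h
  comm i := by
    rw [dNext_eq _ (show (ComplexShape.down ℤ).Rel i (i - 1) by simp),
      prevD_eq _ (show (ComplexShape.down ℤ).Rel (i + 1) i from rfl),
      stableTensorHomotopyHom_eq k Q H (i - 1) i (by omega),
      stableTensorHomotopyHom_eq k Q H i (i + 1) rfl,
      stableTensor_d k Q J i (i - 1) (by omega), stableTensor_d k Q J' (i + 1) i rfl]
    refine ModuleCat.hom_ext (Submodule.linearMap_qext _ (LinearMap.ext fun x ↦ ?_))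
    exact congrArg (finTensor k Q J' i).mkQ
      (prodTensorHomotopy_comm k Q H i (i - 1) (i + 1) (by omega) rfl x)

/-- The functor `J ↦ H_i(Q ⊗̃_R J)` on the homotopy category. -/
def stableTensorHomology (i : ℤ) :
    HomotopyCategory (ModuleCat.{u} R) (ComplexShape.up ℤ) ⥤ ModuleCat.{u} k :=
  CategoryTheory.Quotient.lift _
    (stableTensorFunctor k Q ⋙ HomologicalComplex.homologyFunctor _ _ i)
    (fun _ _ _ _ ⟨H⟩ ↦ (stableTensorHomotopy k Q H).homologyMap_eq i)

end Stable

/-- Stable homology `T̃or_i^R(M, -)`: the functor `N ↦ H_{i+1}(P ⊗̃_R I)`, where `P` is a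
projective resolution of `M` and `I` is an injective resolution of `N`. -/
def stableTor (M : ModuleCat.{u} Rᵐᵒᵖ) (i : ℤ) : ModuleCat.{u} R ⥤ ModuleCat.{u} k :=
  injectiveResolutions (ModuleCat.{u} R) ⋙
    ComplexShape.embeddingUpNat.extendHomotopyFunctor (ModuleCat.{u} R) ⋙
      stableTensorHomology k (projRes R M) (i + 1)

end Tensor

/-! ### Flat dimension and `sfli` -/

section Flat

variable {R : Type u} [Ring R]

/-- A left `R`-module `N` is flat if `- ⊗_R N` preserves injective maps of right modules. -/
def IsFlat (N : ModuleCat.{u} R) : Prop :=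
  ∀ ⦃M M' : ModuleCat.{u} Rᵐᵒᵖ⦄ (f : M ⟶ M'),
    Mono f → Mono (((tensorBifunctor ℤ R).map f).app N)

/-- `N` has a flat resolution `0 ⟶ F_n ⟶ ⋯ ⟶ F_0 ⟶ N ⟶ 0` of length `n`. -/
def HasFlatResolution : ℕ → ModuleCat.{u} R → Prop
  | 0, N => IsFlat N
  | n + 1, N => ∃ S : ShortComplex (ModuleCat.{u} R), S.ShortExact ∧ Nonempty (S.X₃ ≅ N) ∧
      IsFlat S.X₂ ∧ HasFlatResolution n S.X₁

/-- The flat dimension of `N`: the least length of a flat resolution, `⊤` if there is none. -/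
def flatDimension (N : ModuleCat.{u} R) : ℕ∞ :=
  ⨅ (n : ℕ) (_ : HasFlatResolution n N), (n : ℕ∞)

variable (R)

/-- `sfli R`: the supremum of the flat dimensions of all injective `R`-modules. -/
def sfli : ℕ∞ := ⨆ (E : ModuleCat.{u} R) (_ : Injective E), flatDimension E

/-- Von Neumann regular rings. -/
def IsVonNeumannRegular : Prop := ∀ a : R, ∃ x : R, a = a * x * a

/-- Iwanaga–Gorenstein rings: noetherian on both sides, and of finite injective dimension as a
module over itself on both sides. -/
structure IsIwanagaGorenstein : Prop where
  noetherian_left : IsNoetherianRing R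
  noetherian_right : IsNoetherianRing Rᵐᵒᵖ
  injectiveDimension_left : injectiveDimension (ModuleCat.of R R) < ⊤
  injectiveDimension_right : injectiveDimension (ModuleCat.of Rᵐᵒᵖ R) < ⊤

end Flat

end CompleteHomology

end

/-! Let `d` bound the flat dimensions of all injective modules. Computing Tor along flat resolutions
gives `Tor_j(M, E) = 0` for every injective `E` and all `j > d` (`exists_isZero_tor_of_sfli`). Fix
`n` with `n + i > d`; both theories are then compared with `Tor_{n+i}(M, Z^n)`, where `Z^n` is the
module of cocycles in degree `n` of an injective resolution `J` of `N`, that is, an `n`-th cosyzygy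
of `N`.

Complete homology. The long exact sequence of `0 → N → I → ΩN → 0` shows that `S¹Tor_{j+1} → Tor_j`
is an isomorphism for `j > d`, so the inverse system is constant from `n` on and its limit is
`SⁿTor_{n+i}` (`nonempty_completion_iso`). A functor `T` that vanishes on injectives does not see
the choice of cosyzygies, and `S¹T(N) = T(ΩN)`; iterating gives `SⁿT(Z^0) = T(Z^n)`
(`nonempty_iteratedSatellite_cycles_iso`).

Stable homology. As `J` vanishes in negative degrees, `P ⊗̃ J` is also the quotient of the completed
by the ordinary tensor product when only the columns `q ≥ n` are kept. The column `P ⊗ J^q` has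
homology `Tor(M, J^q)`, which is zero above degree `d`, and a family over `q ≥ n` can be corrected
one column after the other without end; hence the truncated completed product is exact in high
degrees (`geComplex_exactAt`) and the connecting homomorphism is an isomorphism there. In the
ordinary truncated product elements have finite support, and the rows are exact because `P` is
projective, so each cycle can be pushed down to column `n`: the homology is that of `P ⊗ Z^n`
(`isIso_homologyMap_cyclesToFin`). The truncated complexes are reindexed so that `P_m ⊗ J^n` lies in
degree `m`; with this numbering `H_{i+1}(P ⊗̃ J)` becomes `Tor_{n+i}(M, Z^n)`.

Finiteness of `sfli`. Over a von Neumann regular ring every module is flat, by the ideal criterion.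
Over an Iwanaga–Gorenstein ring, an injective `E` and a finite right module `L` satisfy the duality
`Tor_j(L, E) = Hom(Ext^j(L, R), E)`; the part of it that is needed is that `Ext^1(L, R) = 0` forces
`Tor_1(L, E) = 0`. Shifting dimensions on both sides, the injective dimension of `R` as a right
module bounds the flat dimension of `E`. -/

noncomputable section

namespace CompleteHomology

attribute [local instance] restrictModule isScalarTower_restrictModule

/-! ### Balanced maps, right exactness and flatness -/

namespace BalTensor

section

variable (k : Type w) [CommRing k] {R : Type u} [Ring R] [Algebra k R]
  {M M' M'' : Type u} [AddCommGroup M] [AddCommGroup M'] [AddCommGroup M'']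
  [Module k M] [Module k M'] [Module k M'']
  [Module Rᵐᵒᵖ M] [Module Rᵐᵒᵖ M'] [Module Rᵐᵒᵖ M'']
  [IsScalarTower k Rᵐᵒᵖ M] [IsScalarTower k Rᵐᵒᵖ M'] [IsScalarTower k Rᵐᵒᵖ M'']
  {N N' N'' : Type u} [AddCommGroup N] [AddCommGroup N'] [AddCommGroup N'']
  [Module k N] [Module k N'] [Module k N'']
  [Module R N] [Module R N'] [Module R N'']
  [IsScalarTower k R N] [IsScalarTower k R N'] [IsScalarTower k R N'']

lemma smul_eq_op_smul (c : k) (m : M) : c • m = MulOpposite.op (algebraMap k R c) • m := by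
  have : c • m = (c • (1 : Rᵐᵒᵖ)) • m := by rw [smul_assoc, one_smul]
  rw [this, Algebra.algebraMap_eq_smul_one, MulOpposite.op_smul, MulOpposite.op_one]

lemma smul_eq_smul (c : k) (n : N) : c • n = algebraMap k R c • n := by
  rw [Algebra.algebraMap_eq_smul_one, smul_assoc, one_smul]

lemma induction_on {p : BalTensor k R M N → Prop} (x : BalTensor k R M N)
    (zero : p 0) (tmul : ∀ m n, p (tmul k R m n)) (add : ∀ x y, p x → p y → p (x + y)) : p x := by
  obtain ⟨t, rfl⟩ := (balancedRel k R M N).mkQ_surjective x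
  induction t with
  | zero => simpa using zero
  | tmul m n => exact tmul m n
  | add a b ha hb => rw [map_add]; exact add _ _ ha hb

/-- The additive map out of `M ⊗_R N` given by a balanced biadditive map. -/
def liftAdd {X : Type*} [AddCommGroup X] (f : M →+ N →+ X)
    (hf : ∀ m (r : R) n, f (MulOpposite.op r • m) n = f m (r • n)) : BalTensor k R M N →+ X :=
  QuotientAddGroup.lift (balancedRel k R M N).toAddSubgroup
    (TensorProduct.liftAddHom f fun c m n ↦ by
      rw [smul_eq_op_smul k (R := R) c m, smul_eq_smul k (R := R) c n, hf]) (by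
    intro x hx
    -- The target is only an additive group, so the `k`-span is rewritten as the additive closure of
    -- the multiples `c • y` of the generators. Each multiple is killed because `c` acts through a
    -- central element of `R`.
    have h1 : x ∈ (balancedRel k R M N).toAddSubmonoid := hx
    rw [balancedRel, Submodule.span_eq_closure] at h1
    clear hx
    induction h1 using AddSubmonoid.closure_induction with
    | zero => exact zero_mem _
    | add a b _ _ ha hb => exact add_mem ha hb
    | mem y hy =>
      obtain ⟨c, -, _, ⟨m, r, n, rfl⟩, rfl⟩ := hy
      rw [AddMonoidHom.mem_ker]
      dsimp only
      rw [smul_sub, TensorProduct.smul_tmul', TensorProduct.smul_tmul', map_sub,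
        TensorProduct.liftAddHom_tmul, TensorProduct.liftAddHom_tmul, smul_eq_op_smul k (R := R),
        smul_eq_op_smul k (R := R), hf, hf, hf, sub_eq_zero, ← mul_smul, ← mul_smul,
        Algebra.commutes])

lemma addHom_ext {X : Type*} [AddCommGroup X] {f g : BalTensor k R M N →+ X}
    (h : ∀ m n, f (tmul k R m n) = g (tmul k R m n)) : f = g := by
  ext x
  induction x using induction_on with
  | zero => simp
  | tmul m n => exact h m n
  | add a b ha hb => rw [map_add, map_add, ha, hb]

variable (R M N) in
/-- `tmul` as a biadditive map. -/
def mkAdd : M →+ N →+ BalTensor k R M N :=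
  AddMonoidHom.mk' (fun m ↦ AddMonoidHom.mk' (fun n ↦ tmul k R m n) (tmul_add k R m))
    (fun m m' ↦ by ext n; exact add_tmul k R m m' n)

@[simp]
lemma mkAdd_apply (m : M) (n : N) : mkAdd k R M N m n = tmul k R m n := rfl

lemma map_surjective {f : M →ₗ[Rᵐᵒᵖ] M'} {g : N →ₗ[R] N'} (hf : Function.Surjective f)
    (hg : Function.Surjective g) : Function.Surjective (map k f g) := by
  intro y
  induction y using induction_on with
  | zero => exact ⟨0, map_zero _⟩
  | tmul m n =>
    obtain ⟨m, rfl⟩ := hf m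
    obtain ⟨n, rfl⟩ := hg n
    exact ⟨tmul k R m n, rfl⟩
  | add a b ha hb =>
    obtain ⟨a, rfl⟩ := ha
    obtain ⟨b, rfl⟩ := hb
    exact ⟨a + b, map_add _ _ _⟩

/-- Each balancing relation lifts along surjections. This reduces right exactness over `R` to right
exactness over `k`. -/
lemma balancedRel_le_map {f : M →ₗ[Rᵐᵒᵖ] M'} {g : N →ₗ[R] N'} (hf : Function.Surjective f)
    (hg : Function.Surjective g) :
    balancedRel k R M' N' ≤ (balancedRel k R M N).map
      (TensorProduct.map (f.restrictScalars k) (g.restrictScalars k)) := by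
  conv_lhs => rw [balancedRel]
  rw [Submodule.span_le]
  rintro _ ⟨m, r, n, rfl⟩
  obtain ⟨m, rfl⟩ := hf m
  obtain ⟨n, rfl⟩ := hg n
  exact ⟨_, Submodule.subset_span ⟨m, r, n, rfl⟩, by simp⟩

/-- Right exactness of the tensor product in the first variable. -/
lemma exact_left {f : M →ₗ[Rᵐᵒᵖ] M'} {g : M' →ₗ[Rᵐᵒᵖ] M''} (h : Function.Exact f g)
    (hg : Function.Surjective g) (x : BalTensor k R M' N)
    (hx : map k g (LinearMap.id : N →ₗ[R] N) x = 0) :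
    ∃ y, map k f (LinearMap.id : N →ₗ[R] N) y = x := by
  obtain ⟨t, rfl⟩ := (balancedRel k R M' N).mkQ_surjective x
  have h1 : TensorProduct.map (g.restrictScalars k)
      ((LinearMap.id : N →ₗ[R] N).restrictScalars k) t ∈ balancedRel k R M'' N :=
    (Submodule.Quotient.mk_eq_zero _).1 hx
  -- The image of `t` is a relation, not zero. Subtracting a relation `s` with the same image leaves
  -- the class of `t` unchanged and puts `t - s` in the kernel over `k`.
  obtain ⟨s, hs, hst⟩ := balancedRel_le_map k hg (g := LinearMap.id) Function.surjective_id h1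
  have h2 : (g.restrictScalars k).rTensor N (t - s) = 0 := by
    rw [map_sub, sub_eq_zero]; exact hst.symm
  obtain ⟨v, hv⟩ := ((rTensor_exact N (f := f.restrictScalars k) (g := g.restrictScalars k)
    h hg) _).1 h2
  refine ⟨(balancedRel k R M N).mkQ v, ?_⟩
  change (balancedRel k R M' N).mkQ ((f.restrictScalars k).rTensor N v) = _
  rw [hv, map_sub, sub_eq_self]
  exact (Submodule.Quotient.mk_eq_zero _).2 hs

/-- Right exactness of the tensor product in the second variable. -/
lemma exact_right {f : N →ₗ[R] N'} {g : N' →ₗ[R] N''} (h : Function.Exact f g)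
    (hg : Function.Surjective g) (x : BalTensor k R M N')
    (hx : map k (LinearMap.id : M →ₗ[Rᵐᵒᵖ] M) g x = 0) :
    ∃ y, map k (LinearMap.id : M →ₗ[Rᵐᵒᵖ] M) f y = x := by
  obtain ⟨t, rfl⟩ := (balancedRel k R M N').mkQ_surjective x
  have h1 : TensorProduct.map ((LinearMap.id : M →ₗ[Rᵐᵒᵖ] M).restrictScalars k)
      (g.restrictScalars k) t ∈ balancedRel k R M N'' :=
    (Submodule.Quotient.mk_eq_zero _).1 hx
  obtain ⟨s, hs, hst⟩ := balancedRel_le_map k (f := LinearMap.id) Function.surjective_id hg h1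
  have h2 : (g.restrictScalars k).lTensor M (t - s) = 0 := by
    rw [map_sub, sub_eq_zero]; exact hst.symm
  obtain ⟨v, hv⟩ := ((lTensor_exact M (f := f.restrictScalars k) (g := g.restrictScalars k)
    h hg) _).1 h2
  refine ⟨(balancedRel k R M N).mkQ v, ?_⟩
  change (balancedRel k R M N').mkQ ((f.restrictScalars k).lTensor M v) = _
  rw [hv, map_sub, sub_eq_self]
  exact (Submodule.Quotient.mk_eq_zero _).2 hs

/-- The map `m ⊗ n ↦ g(m) n` given by a functional `g` on the right module `M`. -/
def contract (g : M →ₗ[Rᵐᵒᵖ] Rᵐᵒᵖ) : BalTensor k R M N →+ N :=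
  liftAdd k (AddMonoidHom.mk' (fun m ↦ AddMonoidHom.mk' (fun n : N ↦ (g m).unop • n)
    (smul_add _)) (fun m m' ↦ by ext n; simp [add_smul])) (fun m r n ↦ by simp [mul_smul])

@[simp]
lemma contract_tmul (g : M →ₗ[Rᵐᵒᵖ] Rᵐᵒᵖ) (m : M) (n : N) :
    contract k g (tmul k R m n) = (g m).unop • n := rfl

lemma contract_map (g : M' →ₗ[Rᵐᵒᵖ] Rᵐᵒᵖ) (f : M →ₗ[Rᵐᵒᵖ] M') (h : N →ₗ[R] N')
    (x : BalTensor k R M N) :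
    contract k g (map k f h x) = h (contract k (g ∘ₗ f) x) := by
  suffices H : (contract k g).comp (map k f h).toAddMonoidHom =
      h.toAddMonoidHom.comp (contract k (g ∘ₗ f)) from DFunLike.congr_fun H x
  refine addHom_ext k fun m n ↦ ?_
  simp

/-! ### Character modules and the ideal criterion for flatness. -/

section Character

variable (R N) in
/-- The character module of a left module, as a right module. -/
def Character : Type u :=
  -- This makes `R` a parameter of the type, so that the `Rᵐᵒᵖ`-action below can be an instance.
  let _ : Ring R := inferInstance
  N →+ AddCircle (1 : ℚ)

instance : AddCommGroup (Character R N) := inferInstanceAs (AddCommGroup (N →+ AddCircle (1 : ℚ)))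

instance : FunLike (Character R N) N (AddCircle (1 : ℚ)) :=
  inferInstanceAs (FunLike (N →+ AddCircle (1 : ℚ)) _ _)

instance : AddMonoidHomClass (Character R N) N (AddCircle (1 : ℚ)) :=
  inferInstanceAs (AddMonoidHomClass (N →+ AddCircle (1 : ℚ)) _ _)

@[ext] lemma Character.ext {c c' : Character R N} (h : ∀ x, c x = c' x) : c = c' :=
  DFunLike.ext _ _ h

lemma Character.add_apply (c c' : Character R N) (x : N) : (c + c') x = c x + c' x := rfl

instance : Module Rᵐᵒᵖ (Character R N) where
  smul r c := AddMonoidHom.comp (c : N →+ AddCircle (1 : ℚ)) (DistribSMul.toAddMonoidHom N r.unop)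
  one_smul c := Character.ext fun x ↦ congrArg c (one_smul R x)
  mul_smul r s c := Character.ext fun x ↦ congrArg c (mul_smul s.unop r.unop x)
  smul_zero _ := rfl
  smul_add _ _ _ := rfl
  add_smul r s c := Character.ext fun x ↦
    (congrArg c (add_smul r.unop s.unop x)).trans (map_add c _ _)
  zero_smul c := Character.ext fun x ↦ (congrArg c (zero_smul R x)).trans (map_zero c)

lemma Character.smul_apply (r : Rᵐᵒᵖ) (c : Character R N) (x : N) : (r • c) x = c (r.unop • x) :=
  rfl

/-- A map from `M` to the character module of `N` as a character of `M ⊗_R N`. -/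
def ofCharacter (φ : M →ₗ[Rᵐᵒᵖ] Character R N) : BalTensor k R M N →+ AddCircle (1 : ℚ) :=
  liftAdd k (AddMonoidHom.mk' (fun m ↦ AddMonoidHom.mk' (fun n ↦ φ m n) (map_add (φ m)))
    (fun m m' ↦ by ext n; simp [Character.add_apply])) (fun m r n ↦ by
      simp [Character.smul_apply])

/-- A character of `M ⊗_R N` as a map from `M` to the character module of `N`. -/
def toCharacter (χ : BalTensor k R M N →+ AddCircle (1 : ℚ)) : M →ₗ[Rᵐᵒᵖ] Character R N where
  toFun m := χ.comp (mkAdd k R M N m)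
  map_add' m m' := by rw [map_add]; exact AddMonoidHom.comp_add _ _ _
  map_smul' r m := Character.ext fun n ↦ congrArg χ (op_smul_tmul k R m r.unop n)

/-- If `J ⊗_R N → N` is injective for all right ideals `J`, then the character module of `N` is
injective. -/
lemma baer_character (h : ∀ J : Ideal Rᵐᵒᵖ, Function.Injective
    (contract k J.subtype : BalTensor k R J N →+ N)) : Module.Baer Rᵐᵒᵖ (Character R N) := by
  intro J g
  -- By adjunction `g` is a character of `J ⊗ N`. It extends along `J ⊗ N → N` to a character `χ` of
  -- `N`, and `1 ↦ χ` is the required extension of `g`.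
  obtain ⟨χ, hχ⟩ := CharacterModule.dual_surjective_of_injective
    (contract k J.subtype : BalTensor k R J N →+ N).toIntLinearMap (h J) (ofCharacter k g)
  refine ⟨LinearMap.toSpanSingleton Rᵐᵒᵖ (Character R N) (χ : N →+ AddCircle (1 : ℚ)),
    fun x hx ↦ Character.ext fun n ↦ ?_⟩
  exact DFunLike.congr_fun hχ (tmul k R (⟨x, hx⟩ : J) n)

/-- The flatness criterion: only the right ideals have to be tested. -/
lemma map_injective_of_ideals (h : ∀ J : Ideal Rᵐᵒᵖ, Function.Injective
    (contract k J.subtype : BalTensor k R J N →+ N)) {f : M →ₗ[Rᵐᵒᵖ] M'}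
    (hf : Function.Injective f) :
    Function.Injective (map k f (LinearMap.id : N →ₗ[R] N)) := by
  rw [injective_iff_map_eq_zero]
  intro t ht
  refine CharacterModule.eq_zero_of_character_apply fun χ ↦ ?_
  -- Every character `χ` of `M ⊗ N` factors through `M' ⊗ N`, since the corresponding map from `M`
  -- to the injective character module extends to `M'`. So all characters kill `t`.
  obtain ⟨ψ, hψ⟩ := (baer_character k h).extension_property f hf (toCharacter k χ)
  have : (χ : BalTensor k R M N →+ AddCircle (1 : ℚ)) =
      (ofCharacter k ψ).comp (map k f LinearMap.id).toAddMonoidHom := by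
    refine addHom_ext k fun m n ↦ ?_
    exact (DFunLike.congr_fun (DFunLike.congr_fun hψ m) n).symm
  change (χ : BalTensor k R M N →+ AddCircle (1 : ℚ)) t = 0
  rw [this]
  exact (congrArg (ofCharacter k ψ) ht).trans (map_zero _)

end Character

end

section

variable (k : Type w) [CommRing k] {R : Type u} [Ring R] [Algebra k R]
  {M M' : Type u} [AddCommGroup M] [AddCommGroup M']
  [Module k M] [Module k M'] [Module Rᵐᵒᵖ M] [Module Rᵐᵒᵖ M']
  [IsScalarTower k Rᵐᵒᵖ M] [IsScalarTower k Rᵐᵒᵖ M']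
  {N N' : Type u} [AddCommGroup N] [AddCommGroup N'] [Module k N] [Module k N']
  [Module R N] [Module R N'] [IsScalarTower k R N] [IsScalarTower k R N']

/-! ### Independence of the base ring. -/

section ChangeBase

universe w'

variable (k' : Type w') [CommRing k'] [Algebra k' R]
  [Module k' M] [Module k' M'] [IsScalarTower k' Rᵐᵒᵖ M] [IsScalarTower k' Rᵐᵒᵖ M']
  [Module k' N] [Module k' N'] [IsScalarTower k' R N] [IsScalarTower k' R N']

variable (R M N) in
/-- The additive group `M ⊗_R N` does not depend on the base ring. -/
def changeBase : BalTensor k R M N ≃+ BalTensor k' R M N :=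
  AddMonoidHom.toAddEquiv
    (liftAdd k (mkAdd k' R M N) (op_smul_tmul k' R)) (liftAdd k' (mkAdd k R M N)
      (op_smul_tmul k R))
    (addHom_ext k fun _ _ ↦ rfl) (addHom_ext k' fun _ _ ↦ rfl)

lemma changeBase_map (f : M →ₗ[Rᵐᵒᵖ] M') (g : N →ₗ[R] N') (x : BalTensor k R M N) :
    changeBase k R M' N' k' (map k f g x) = map k' f g (changeBase k R M N k' x) := by
  suffices h : (changeBase k R M' N' k').toAddMonoidHom.comp (map k f g).toAddMonoidHom =
      (map k' f g).toAddMonoidHom.comp (changeBase k R M N k').toAddMonoidHom from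
    DFunLike.congr_fun h x
  exact addHom_ext k fun _ _ ↦ rfl

lemma map_injective_changeBase {f : M →ₗ[Rᵐᵒᵖ] M'} {g : N →ₗ[R] N'}
    (h : Function.Injective (map k f g)) : Function.Injective (map k' f g) := by
  intro x y hxy
  obtain ⟨x, rfl⟩ := (changeBase k R M N k').surjective x
  obtain ⟨y, rfl⟩ := (changeBase k R M N k').surjective y
  rw [← changeBase_map, ← changeBase_map] at hxy
  rw [h ((changeBase k R M' N' k').injective hxy)]

end ChangeBase

/-! ### Projective left modules are flat: `- ⊗ N` is a natural retract of `M ↦ (N →₀ M)`. -/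

section Projective

/-- The map `M ⊗_R N ⟶ (N →₀ M)` given by a map from `N` to the free module on `N`. -/
def toFinsuppRight (s : N →ₗ[R] (N →₀ R)) : BalTensor k R M N →+ (N →₀ M) :=
  liftAdd k (AddMonoidHom.mk' (fun m ↦ AddMonoidHom.mk'
      (fun n ↦ (s n).mapRange (fun r ↦ MulOpposite.op r • m) (by simp))
      (fun n n' ↦ by ext q; simp [add_smul]))
    (fun m m' ↦ by ext n q; simp)) (fun m r n ↦ by ext q; simp [mul_smul])

/-- The map `(N →₀ M) ⟶ M ⊗_R N`. -/
def ofFinsuppRight : (N →₀ M) →+ BalTensor k R M N :=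
  Finsupp.liftAddHom fun n ↦ (mkAdd k R M N).flip n

lemma ofFinsuppRight_toFinsuppRight (s : N →ₗ[R] (N →₀ R))
    (hs : ∀ n, Finsupp.linearCombination R id (s n) = n) (x : BalTensor k R M N) :
    ofFinsuppRight k (toFinsuppRight k s x) = x := by
  suffices h : (ofFinsuppRight k).comp (toFinsuppRight k s) =
      AddMonoidHom.id (BalTensor k R M N) from DFunLike.congr_fun h x
  refine addHom_ext k fun m n ↦ ?_
  have key : ∀ t : N →₀ R,
      ofFinsuppRight k (t.mapRange (fun r ↦ MulOpposite.op r • m) (by simp)) =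
        tmul k R m (Finsupp.linearCombination R id t) := by
    intro t
    induction t using Finsupp.induction_linear with
    | zero => simp [tmul]
    | add f g hf hg =>
      rw [Finsupp.mapRange_add (fun x y ↦ by simp [add_smul]), map_add, hf, hg, map_add,
        tmul_add]
    | single q r =>
      rw [Finsupp.mapRange_single, Finsupp.linearCombination_single]
      refine Eq.trans ?_ (op_smul_tmul k R m r q)
      simp [ofFinsuppRight]
  exact (key (s n)).trans (by rw [hs]; rfl)

lemma toFinsuppRight_map (s : N →ₗ[R] (N →₀ R)) (f : M →ₗ[Rᵐᵒᵖ] M') (x : BalTensor k R M N) :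
    toFinsuppRight k s (map k f LinearMap.id x) =
      (toFinsuppRight k s x).mapRange f (map_zero f) := by
  suffices h : (toFinsuppRight k s).comp
      (map k f (LinearMap.id : N →ₗ[R] N)).toAddMonoidHom =
      (Finsupp.mapRange.addMonoidHom f.toAddMonoidHom).comp (toFinsuppRight k s) from
    DFunLike.congr_fun h x
  refine addHom_ext k fun m n ↦ ?_
  ext q
  exact (map_smul f (MulOpposite.op (s n q)) m).symm

lemma map_injective_of_projective [Module.Projective R N] {f : M →ₗ[Rᵐᵒᵖ] M'}
    (hf : Function.Injective f) : Function.Injective (map k f (LinearMap.id : N →ₗ[R] N)) := by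
  obtain ⟨s, hs⟩ := Module.Projective.out (R := R) (P := N)
  intro x y hxy
  rw [← ofFinsuppRight_toFinsuppRight k s hs x, ← ofFinsuppRight_toFinsuppRight k s hs y]
  congr 1
  refine Finsupp.mapRange_injective _ (map_zero f) hf ?_
  rw [← toFinsuppRight_map, ← toFinsuppRight_map, hxy]

end Projective

/-! ### Flatness over von Neumann regular rings. -/

section Regular

/-- Two elements of a left ideal have a common right unit in it. If `e` is a right unit of `x` and
`g` one of `z = y - y * e`, take `e + g - e * g`: its complement is `(1 - e) * (1 - g)`, and `x * (1
- e) = 0` while `y * (1 - e) = z` and `z * (1 - g) = 0`. -/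
lemma exists_mul_eq_of_mem {S : Type*} [Ring S] (hS : ∀ a : S, ∃ x, a = a * x * a)
    (J : Ideal S) {x y : S} (hx : x ∈ J) (hy : y ∈ J) : ∃ e ∈ J, x * e = x ∧ y * e = y := by
  obtain ⟨a, ha⟩ := hS x
  have hxe : x * (a * x) = x := by rw [← mul_assoc, ← ha]
  obtain ⟨b, hb⟩ := hS (y - y * (a * x))
  have hee : (a * x) * (a * x) = a * x := by rw [mul_assoc a, hxe]
  have he : a * x ∈ J := J.mul_mem_left a hx
  generalize a * x = e at *
  have hz : (y - y * e) * e = 0 := by rw [sub_mul, mul_assoc, hee, sub_self]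
  have hg : b * (y - y * e) ∈ J := J.mul_mem_left _ (J.sub_mem hy (J.mul_mem_left _ he))
  have hzg : (y - y * e) * (b * (y - y * e)) = y - y * e := by rw [← mul_assoc, ← hb]
  refine ⟨e + b * (y - y * e) - e * (b * (y - y * e)),
    J.sub_mem (J.add_mem he hg) (J.mul_mem_left _ hg), ?_, ?_⟩
  · rw [mul_sub, mul_add, ← mul_assoc x e, hxe, add_sub_cancel_right]
  · generalize b * (y - y * e) = g at *
    have h1 : y * g - y * e * g = y - y * e := by rw [← sub_mul, hzg]
    rw [mul_sub, mul_add, ← mul_assoc, add_sub_assoc, h1]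
    abel

lemma contract_injective_of_regular (hR : IsVonNeumannRegular R) (J : Ideal Rᵐᵒᵖ) :
    Function.Injective (contract k J.subtype : BalTensor k R J N →+ N) := by
  have hS : ∀ a : Rᵐᵒᵖ, ∃ x, a = a * x * a := fun a ↦ by
    obtain ⟨x, hx⟩ := hR a.unop
    exact ⟨MulOpposite.op x, MulOpposite.unop_injective (by simpa [mul_assoc] using hx)⟩
  -- Every tensor is elementary and is determined by its image in `N`: a common right unit `e` of
  -- the entries from `J` lets them move across the tensor sign.
  have key : ∀ t : BalTensor k R J N, ∃ e : J, t = tmul k R e (contract k J.subtype t) := by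
    have hmove : ∀ (e x : J) (n : N), (x : Rᵐᵒᵖ) * e = x →
        tmul k R e ((x : Rᵐᵒᵖ).unop • n) = tmul k R x n := fun e x n h ↦ by
      rw [← op_smul_tmul]
      congr 1
      exact Subtype.ext h
    intro t
    induction t using induction_on with
    | zero => exact ⟨0, by simp [tmul]⟩
    | tmul m n =>
      obtain ⟨e, he, h, -⟩ := exists_mul_eq_of_mem hS J m.2 m.2
      exact ⟨⟨e, he⟩, (hmove ⟨e, he⟩ m n h).symm⟩
    | add a b ha hb =>
      obtain ⟨x, hx⟩ := ha
      obtain ⟨y, hy⟩ := hb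
      obtain ⟨e, he, h, h'⟩ := exists_mul_eq_of_mem hS J x.2 y.2
      have hx' := congrArg (contract k J.subtype) hx
      have hy' := congrArg (contract k J.subtype) hy
      refine ⟨⟨e, he⟩, ?_⟩
      rw [map_add, tmul_add, hx', hy', contract_tmul, contract_tmul]
      refine congrArg₂ _ (hx.trans ?_) (hy.trans ?_)
      · exact (hmove ⟨e, he⟩ x _ h).symm
      · exact (hmove ⟨e, he⟩ y _ h').symm
  rw [injective_iff_map_eq_zero]
  intro t ht
  obtain ⟨e, he⟩ := key t
  rw [he, ht]
  simp [tmul]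

end Regular

end

end BalTensor

/-! ### Flatness over `ℤ` and over `k`. -/

section

variable (k : Type w) [CommRing k] {R : Type u} [Ring R] [Algebra k R]

/-- The functor `- ⊗_R N` with values in `k`-modules preserves injective maps. -/
def PreservesInjective (N : ModuleCat.{u} R) : Prop :=
  ∀ ⦃M M' : ModuleCat.{u} Rᵐᵒᵖ⦄ (f : M ⟶ M'), Function.Injective f.hom →
    Function.Injective (BalTensor.map k f.hom (LinearMap.id : N →ₗ[R] N))

lemma PreservesInjective.changeBase {N : ModuleCat.{u} R} (h : PreservesInjective k N)
    (k' : Type*) [CommRing k'] [Algebra k' R] : PreservesInjective k' N :=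
  fun _ _ f hf ↦ BalTensor.map_injective_changeBase k k' (h f hf)

/-- `IsFlat` uses tensor products over `ℤ`, whereas Tor takes values in `k`-modules. The underlying
groups are the same. -/
lemma isFlat_iff (N : ModuleCat.{u} R) : IsFlat N ↔ PreservesInjective k N := by
  refine ⟨fun h ↦ PreservesInjective.changeBase ℤ (fun M M' f hf ↦ ?_) k, fun h M M' f hf ↦ ?_⟩
  · exact (ModuleCat.mono_iff_injective _).1 (h f ((ModuleCat.mono_iff_injective f).2 hf))
  · exact (ModuleCat.mono_iff_injective _).2
      (h.changeBase k ℤ f ((ModuleCat.mono_iff_injective f).1 hf))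

lemma isFlat_of_ideals (N : ModuleCat.{u} R) (h : ∀ J : Ideal Rᵐᵒᵖ, Function.Injective
    (BalTensor.contract k J.subtype : BalTensor k R J N →+ N)) : IsFlat N :=
  (isFlat_iff k N).2 fun _ _ _ hf ↦ BalTensor.map_injective_of_ideals k h hf

lemma preservesInjective_of_projective (N : ModuleCat.{u} R) [Projective N] :
    PreservesInjective k N := by
  have : Module.Projective R N := (IsProjective.iff_projective N).2 inferInstance
  exact fun _ _ _ hf ↦ BalTensor.map_injective_of_projective k hf

end

lemma sfli_lt_top_of_regular (k : Type w) [CommRing k] {R : Type u} [Ring R] [Algebra k R]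
    (hR : IsVonNeumannRegular R) : sfli R < ⊤ := by
  refine lt_of_le_of_lt (b := 0) (iSup₂_le fun E _ ↦ ?_) (by simp)
  exact iInf₂_le (0 : ℕ)
    (isFlat_of_ideals k E fun J ↦ BalTensor.contract_injective_of_regular k hR J)

/-! ### Injective modules over Iwanaga–Gorenstein rings -/

namespace BalTensor

section

variable (k : Type w) [CommRing k] {R : Type u} [Ring R] [Algebra k R]
  {M : Type u} [AddCommGroup M] [Module k M] [Module Rᵐᵒᵖ M] [IsScalarTower k Rᵐᵒᵖ M]
  {N N' : Type u} [AddCommGroup N] [AddCommGroup N'] [Module k N] [Module k N']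
  [Module R N] [Module R N'] [IsScalarTower k R N] [IsScalarTower k R N']

lemma map_injective_of_projective_left [Module.Projective Rᵐᵒᵖ M] {g : N →ₗ[R] N'}
    (hg : Function.Injective g) :
    Function.Injective (map k (LinearMap.id : M →ₗ[Rᵐᵒᵖ] M) g) := by
  obtain ⟨s, hs⟩ := Module.Projective.out (R := Rᵐᵒᵖ) (P := M)
  intro x y hxy
  rw [← ofFinsupp_toFinsupp k s hs x, ← ofFinsupp_toFinsupp k s hs y]
  congr 1
  refine Finsupp.mapRange_injective _ (map_zero g) hg ?_
  rw [← toFinsupp_map, ← toFinsupp_map, hxy]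

lemma tmul_zero (m : M) : tmul k R m (0 : N) = 0 := by simp [tmul]

lemma zero_tmul (n : N) : tmul k R (0 : M) n = 0 := by simp [tmul]

lemma tmul_sum {ι : Type*} (s : Finset ι) (m : M) (f : ι → N) :
    tmul k R m (∑ i ∈ s, f i) = ∑ i ∈ s, tmul k R m (f i) :=
  map_sum (mkAdd k R M N m) f s

lemma sum_tmul {ι : Type*} (s : Finset ι) (f : ι → M) (n : N) :
    tmul k R (∑ i ∈ s, f i) n = ∑ i ∈ s, tmul k R (f i) n :=
  map_sum ((mkAdd k R M N).flip n) f s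

lemma contract_id_injective :
    Function.Injective (contract k (LinearMap.id : Rᵐᵒᵖ →ₗ[Rᵐᵒᵖ] Rᵐᵒᵖ) :
      BalTensor k R Rᵐᵒᵖ N →+ N) := by
  have key : (mkAdd k R Rᵐᵒᵖ N 1).comp (contract k LinearMap.id) =
      AddMonoidHom.id (BalTensor k R Rᵐᵒᵖ N) := addHom_ext k fun m n ↦ by
    rw [AddMonoidHom.comp_apply, contract_tmul, mkAdd_apply, ← op_smul_tmul]
    simp
  exact Function.LeftInverse.injective (g := mkAdd k R Rᵐᵒᵖ N 1) fun x ↦ DFunLike.congr_fun key x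

lemma eq_sum_single {a : ℕ} (s : BalTensor k R (Fin a → Rᵐᵒᵖ) N) :
    s = ∑ i, tmul k R (Pi.single i 1) (contract k (LinearMap.proj i) s) := by
  have key : AddMonoidHom.id (BalTensor k R (Fin a → Rᵐᵒᵖ) N) =
      ∑ i, (mkAdd k R (Fin a → Rᵐᵒᵖ) N (Pi.single i 1)).comp (contract k (LinearMap.proj i)) := by
    refine addHom_ext k fun m n ↦ ?_
    rw [AddMonoidHom.finsetSum_apply, AddMonoidHom.id_apply]
    conv_lhs => rw [pi_eq_sum_univ' m]
    rw [sum_tmul]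
    refine Finset.sum_congr rfl fun i _ ↦ ?_
    rw [AddMonoidHom.comp_apply, contract_tmul, mkAdd_apply, ← op_smul_tmul]
    congr 1
  simpa using DFunLike.congr_fun key s

/-- If `N` is injective and `M` is finitely presented, then functionals on `M` separate the
elements of `M ⊗_R N`. -/
lemma eq_zero_of_contract [IsNoetherianRing Rᵐᵒᵖ] [Module.Finite Rᵐᵒᵖ M] [Module.Injective R N]
    (t : BalTensor k R M N) (ht : ∀ g : M →ₗ[Rᵐᵒᵖ] Rᵐᵒᵖ, contract k g t = 0) : t = 0 := by
  -- Choose a presentation of `M` by `a` generators and `b` relations `A j`, and lift `t` to a tuple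
  -- `e` of elements of `N`.
  obtain ⟨a, π, hπ⟩ := Module.Finite.exists_fin' Rᵐᵒᵖ M
  obtain ⟨b, ρ, hρ⟩ := Module.Finite.exists_fin' Rᵐᵒᵖ (LinearMap.ker π)
  obtain ⟨s, rfl⟩ := map_surjective k (N := N) (g := LinearMap.id) hπ Function.surjective_id t
  let A : Fin b → Fin a → Rᵐᵒᵖ := fun j ↦ ρ (Pi.single j 1)
  have hA : ∀ j, π (A j) = 0 := fun j ↦ (ρ (Pi.single j 1)).2
  let e : Fin a → N := fun i ↦ contract k (LinearMap.proj i) s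
  -- `Ψ` is the dual of the relation matrix: its kernel consists of the functionals on the
  -- generators that descend to `M`. The map `φ` below evaluates such a functional on the lift `s`
  -- of `t`.
  let Ψ : (Fin a → R) →ₗ[R] (Fin b → R) := LinearMap.pi fun j ↦
    ∑ i, (LinearMap.toSpanSingleton R R (A j i).unop) ∘ₗ LinearMap.proj i
  have hΨ : ∀ h j, Ψ h j = ∑ i, h i * (A j i).unop := fun h j ↦ by simp [Ψ]
  let φ : (Fin a → R) →ₗ[R] N := ∑ i, (LinearMap.toSpanSingleton R N (e i)) ∘ₗ LinearMap.proj i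
  have hφ : ∀ h, φ h = ∑ i, h i • e i := fun h ↦ by simp [φ]
  have hs : s = ∑ i, tmul k R (Pi.single i 1) (e i) := eq_sum_single k s
  -- An element `h` of `ker Ψ` gives a functional `g'` on `M`, and `φ h` is the contraction of `t`
  -- with `g'`, which is zero by assumption.
  have hker : LinearMap.ker Ψ ≤ LinearMap.ker φ := by
    intro h hh
    let g : (Fin a → Rᵐᵒᵖ) →ₗ[Rᵐᵒᵖ] Rᵐᵒᵖ :=
      ∑ i, (LinearMap.toSpanSingleton Rᵐᵒᵖ Rᵐᵒᵖ (MulOpposite.op (h i))) ∘ₗ LinearMap.proj i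
    have hg : ∀ x, g x = ∑ i, x i * MulOpposite.op (h i) := fun x ↦ by simp [g]
    have hgA : ∀ j, g (A j) = 0 := fun j ↦ by
      apply MulOpposite.unop_injective
      have := congrFun (LinearMap.mem_ker.1 hh) j
      rw [hΨ] at this
      rw [hg, Finset.unop_sum, MulOpposite.unop_zero]
      simpa using this
    have hgρ : g ∘ₗ (LinearMap.ker π).subtype ∘ₗ ρ = 0 := by
      refine LinearMap.pi_ext' fun j ↦ LinearMap.ext_ring ?_
      simpa using hgA j
    have hgπ : LinearMap.ker π ≤ LinearMap.ker g := fun x hx ↦ by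
      obtain ⟨y, hy⟩ := hρ ⟨x, hx⟩
      have := DFunLike.congr_fun hgρ y
      simpa [hy] using this
    let eπ := π.quotKerEquivOfSurjective hπ
    let g' : M →ₗ[Rᵐᵒᵖ] Rᵐᵒᵖ := (LinearMap.ker π).liftQ g hgπ ∘ₗ eπ.symm.toLinearMap
    have hg' : g' ∘ₗ π = g := by
      refine LinearMap.ext fun x ↦ ?_
      have : eπ.symm (π x) = (LinearMap.ker π).mkQ x := by
        rw [LinearEquiv.symm_apply_eq]; rfl
      change (LinearMap.ker π).liftQ g hgπ (eπ.symm (π x)) = g x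
      rw [this]; rfl
    have h1 := ht g'
    rw [contract_map, hg', hs, map_sum] at h1
    rw [LinearMap.mem_ker, hφ]
    simpa [hg, Pi.single_apply] using h1
  -- So `φ` factors through the image of `Ψ` and, as `N` is injective, extends to `θ` on all of
  -- `R^b`. Then `φ = θ ∘ Ψ` writes `s` as a sum of tensors `A j ⊗ θ (Pi.single j 1)`, which vanish
  -- in `M ⊗ N`.
  obtain ⟨θ, hθ⟩ := Module.Injective.extension_property R (P := (Fin a → R) ⧸ LinearMap.ker Ψ)
    (P' := Fin b → R) (M := N)
    ((LinearMap.ker Ψ).liftQ Ψ le_rfl)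
    (LinearMap.ker_eq_bot.1 (Submodule.ker_liftQ_eq_bot _ _ _ le_rfl))
    ((LinearMap.ker Ψ).liftQ φ hker)
  have hθ' : ∀ h, θ (Ψ h) = φ h := fun h ↦
    DFunLike.congr_fun hθ ((LinearMap.ker Ψ).mkQ h)
  have he : ∀ i, e i = ∑ j, (A j i).unop • θ (Pi.single j 1) := fun i ↦ by
    have h1 : e i = φ (Pi.single i 1) := by simp [hφ, Pi.single_apply]
    rw [h1, ← hθ', pi_eq_sum_univ' (Ψ _), map_sum]
    refine Finset.sum_congr rfl fun j _ ↦ ?_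
    rw [map_smul, hΨ]
    simp [Pi.single_apply]
  have hs' : s = ∑ j, tmul k R (A j) (θ (Pi.single j 1)) := by
    rw [hs]
    simp only [he, tmul_sum]
    rw [Finset.sum_comm]
    refine Finset.sum_congr rfl fun j _ ↦ ?_
    conv_rhs => rw [pi_eq_sum_univ' (A j)]
    rw [sum_tmul]
    refine Finset.sum_congr rfl fun i _ ↦ ?_
    rw [← op_smul_tmul]
    congr 1
  rw [hs', map_sum]
  refine Finset.sum_eq_zero fun j _ ↦ ?_
  rw [map_tmul, hA, zero_tmul]

end

end BalTensor

/-! ### Vanishing of `Tor₁` and dimension shifting against `Ext(-, R)`. -/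

section

variable (k : Type w) [CommRing k] {R : Type u} [Ring R] [Algebra k R]

/-- `Tor₁(L, N) = 0`, tested on all presentations of `L` by finite projective modules. -/
def TorOneVanishes (L : ModuleCat.{u} Rᵐᵒᵖ) (N : ModuleCat.{u} R) : Prop :=
  ∀ (S : ShortComplex (ModuleCat.{u} Rᵐᵒᵖ)), S.ShortExact → S.X₃ = L →
    Module.Finite Rᵐᵒᵖ S.X₂ → Projective S.X₂ →
      Function.Injective (BalTensor.map k S.f.hom (LinearMap.id : N →ₗ[R] N))

lemma finite_X₁ [IsNoetherianRing Rᵐᵒᵖ] {S : ShortComplex (ModuleCat.{u} Rᵐᵒᵖ)}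
    (hS : S.ShortExact) [Module.Finite Rᵐᵒᵖ S.X₂] : Module.Finite Rᵐᵒᵖ S.X₁ :=
  Module.Finite.of_injective S.f.hom hS.moduleCat_injective_f

variable (R) in
/-- The ring `R` as a right module over itself. -/
abbrev rightRegular : ModuleCat.{u} Rᵐᵒᵖ := ModuleCat.of Rᵐᵒᵖ R

variable (R) in
/-- The isomorphism of right modules between `R` and `Rᵐᵒᵖ`. -/
def rightRegularEquiv : rightRegular R ≃ₗ[Rᵐᵒᵖ] Rᵐᵒᵖ where
  __ := (MulOpposite.opAddEquiv : R ≃+ Rᵐᵒᵖ)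
  map_smul' _ _ := rfl

/-- The obstruction to extending `g` is its image in `Ext^1(S.X₃, R)`. The functional is transported
between `Rᵐᵒᵖ` and `R` as a right module. -/
lemma exists_extension_of_ext {S : ShortComplex (ModuleCat.{u} Rᵐᵒᵖ)} (hS : S.ShortExact)
    (h : ∀ e : Abelian.Ext S.X₃ (rightRegular R) 1, e = 0) (g : S.X₁ →ₗ[Rᵐᵒᵖ] Rᵐᵒᵖ) :
    ∃ g' : S.X₂ →ₗ[Rᵐᵒᵖ] Rᵐᵒᵖ, g' ∘ₗ S.f.hom = g := by
  let g₁ : S.X₁ ⟶ rightRegular R := ModuleCat.ofHom ((rightRegularEquiv R).symm.toLinearMap ∘ₗ g)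
  obtain ⟨x, hx⟩ := Abelian.Ext.contravariant_sequence_exact₁ hS _ (Abelian.Ext.mk₀ g₁)
    (n₁ := 1) rfl (h _)
  obtain ⟨g₂, rfl⟩ := (Abelian.Ext.mk₀_bijective _ _).2 x
  rw [Abelian.Ext.mk₀_comp_mk₀] at hx
  have h1 := (Abelian.Ext.mk₀_bijective _ _).1 hx
  refine ⟨(rightRegularEquiv R).toLinearMap ∘ₗ g₂.hom, LinearMap.ext fun y ↦ ?_⟩
  have h2 : g₂.hom (S.f.hom y) = (rightRegularEquiv R).symm (g y) :=
    congrArg (fun f ↦ f.hom y) h1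
  simp [h2]

/-- Dimension shift: `e` dies in `Ext^{j+2}(S.X₃, Y)`, so it comes from `Ext^{j+1}(S.X₂, Y)`, which
is zero as `S.X₂` is projective. -/
lemma ext_eq_zero_of_shortExact {S : ShortComplex (ModuleCat.{u} Rᵐᵒᵖ)} (hS : S.ShortExact)
    [Projective S.X₂] {Y : ModuleCat.{u} Rᵐᵒᵖ} (j : ℕ)
    (h : ∀ e : Abelian.Ext S.X₃ Y (j + 2), e = 0) (e : Abelian.Ext S.X₁ Y (j + 1)) : e = 0 := by
  obtain ⟨x, rfl⟩ := Abelian.Ext.contravariant_sequence_exact₁ hS _ e (n₁ := j + 2) (by omega) (h _)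
  rw [Abelian.Ext.eq_zero_of_projective x, Abelian.Ext.comp_zero]

/-- Let `t` lie in the kernel of `S.X₁ ⊗ E → S.X₂ ⊗ E`. As `Ext^1(L, R) = 0`, every functional on
`S.X₁` extends to `S.X₂`, so all functionals contract `t` to zero; they separate elements since
`S.X₁` is finitely presented and `E` is injective. -/
lemma torOneVanishes_of_injective [IsNoetherianRing Rᵐᵒᵖ] (L : ModuleCat.{u} Rᵐᵒᵖ)
    (h : ∀ e : Abelian.Ext L (rightRegular R) 1, e = 0) (E : ModuleCat.{u} R) [Injective E] :
    TorOneVanishes k L E := by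
  rintro S hS rfl _ _
  have := finite_X₁ hS
  have : Module.Injective R E := (Module.injective_iff_injective_object R E).2 inferInstance
  rw [injective_iff_map_eq_zero]
  intro t ht
  refine BalTensor.eq_zero_of_contract k t fun g ↦ ?_
  obtain ⟨g, rfl⟩ := exists_extension_of_ext hS h g
  have := BalTensor.contract_map k g S.f.hom (LinearMap.id : E →ₗ[R] E) t
  rw [ht, map_zero] at this
  exact this.symm

lemma exists_finite_presentation (L : ModuleCat.{u} Rᵐᵒᵖ) [Module.Finite Rᵐᵒᵖ L] :
    ∃ S : ShortComplex (ModuleCat.{u} Rᵐᵒᵖ), S.ShortExact ∧ S.X₃ = L ∧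
      Module.Finite Rᵐᵒᵖ S.X₂ ∧ Projective S.X₂ := by
  obtain ⟨a, π, hπ⟩ := Module.Finite.exists_fin' Rᵐᵒᵖ L
  let f : ModuleCat.of Rᵐᵒᵖ (Fin a → Rᵐᵒᵖ) ⟶ L := ModuleCat.ofHom π
  have : Epi f := (ModuleCat.epi_iff_surjective f).2 hπ
  refine ⟨ShortComplex.mk (kernel.ι f) f (kernel.condition f), ?_, rfl, ?_, ?_⟩
  · exact { exact := ShortComplex.exact_of_f_is_kernel _ (kernelIsKernel f) }
  · exact inferInstanceAs (Module.Finite Rᵐᵒᵖ (Fin a → Rᵐᵒᵖ))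
  · exact (IsProjective.iff_projective (R := Rᵐᵒᵖ) (Fin a → Rᵐᵒᵖ)).1 inferInstance

lemma exact_hom {A : Type*} [Ring A] {S : ShortComplex (ModuleCat.{u} A)} (hS : S.ShortExact) :
    Function.Exact S.f.hom S.g.hom :=
  (ShortComplex.ShortExact.moduleCat_exact_iff_function_exact S).1 hS.exact

/-- If `Tor₁(L, N) = 0` then tensoring with `L` preserves the injectivity of `K ⟶ P`, where
`0 ⟶ K ⟶ P ⟶ N ⟶ 0` is exact. -/
lemma map_injective_of_torOneVanishes (L : ModuleCat.{u} Rᵐᵒᵖ) [Module.Finite Rᵐᵒᵖ L]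
    {T : ShortComplex (ModuleCat.{u} R)} (hT : T.ShortExact) (h : TorOneVanishes k L T.X₃) :
    Function.Injective (BalTensor.map k (LinearMap.id : L →ₗ[Rᵐᵒᵖ] L) T.f.hom) := by
  obtain ⟨S, hS, rfl, hF, hP⟩ := exists_finite_presentation L
  have hP' : Module.Projective Rᵐᵒᵖ S.X₂ := (IsProjective.iff_projective S.X₂).2 inferInstance
  rw [injective_iff_map_eq_zero]
  intro x hx
  obtain ⟨x, rfl⟩ := BalTensor.map_surjective k (g := LinearMap.id) hS.moduleCat_surjective_g
    Function.surjective_id x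
  rw [BalTensor.map_map] at hx
  -- Chase in the diagram of `S ⊗ T`: the lift `x` in `S.X₂ ⊗ T.X₁` becomes in `S.X₂ ⊗ T.X₂` the
  -- image of some `y` in `S.X₁ ⊗ T.X₂`. By the vanishing of `Tor₁`, `y` dies in `S.X₁ ⊗ T.X₃`, so
  -- it comes from some `z` in `S.X₁ ⊗ T.X₁`, and `z` maps to `x` because `S.X₂` is projective.
  obtain ⟨y, hy⟩ := BalTensor.exact_left k (exact_hom hS) hS.moduleCat_surjective_g
    (BalTensor.map k LinearMap.id T.f.hom x) (by rw [BalTensor.map_map]; exact hx)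
  have hy0 : BalTensor.map k LinearMap.id T.g.hom y = 0 := by
    refine h S hS rfl hF hP ?_
    have : BalTensor.map k LinearMap.id T.g.hom
        (BalTensor.map k S.f.hom (LinearMap.id : T.X₂ →ₗ[R] T.X₂) y) = 0 := by
      rw [hy, BalTensor.map_map, (exact_hom hT).linearMap_comp_eq_zero,
        BalTensor.map_zero_right, LinearMap.zero_apply]
    rw [map_zero, ← this, BalTensor.map_map, BalTensor.map_map]
    rfl
  obtain ⟨z, rfl⟩ := BalTensor.exact_right k (exact_hom hT) hT.moduleCat_surjective_g y hy0
  have hz : BalTensor.map k S.f.hom LinearMap.id z = x := by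
    refine BalTensor.map_injective_of_projective_left k hT.moduleCat_injective_f ?_
    rw [← hy, BalTensor.map_map, BalTensor.map_map]
    rfl
  rw [← hz, BalTensor.map_map, (exact_hom hS).linearMap_comp_eq_zero,
    BalTensor.map_zero_left, LinearMap.zero_apply]

/-- This is `Tor₁(L, T.X₁) = Tor₂(L, T.X₃) = Tor₁(L', T.X₃)` for a syzygy `L'` of `L`, together with
`Ext^{j+1}(L', R) = Ext^{j+2}(L, R) = 0`. In terms of maps, `S.X₁ ⊗ T.X₁ → S.X₁ ⊗ T.X₂ → S.X₂ ⊗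
T.X₂` is injective and factors through `S.X₂ ⊗ T.X₁`. -/
lemma TorOneVanishes.syzygy [IsNoetherianRing Rᵐᵒᵖ] (L : ModuleCat.{u} Rᵐᵒᵖ)
    {T : ShortComplex (ModuleCat.{u} R)} (hT : T.ShortExact) [Projective T.X₂] (j : ℕ)
    (hL : ∀ e : Abelian.Ext L (rightRegular R) (j + 2), e = 0)
    (h : ∀ L' : ModuleCat.{u} Rᵐᵒᵖ, Module.Finite Rᵐᵒᵖ L' →
      (∀ e : Abelian.Ext L' (rightRegular R) (j + 1), e = 0) → TorOneVanishes k L' T.X₃) :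
    TorOneVanishes k L T.X₁ := by
  rintro S hS rfl _ _
  have hfin := finite_X₁ hS
  have h1 := map_injective_of_torOneVanishes k S.X₁ hT
    (h S.X₁ hfin (ext_eq_zero_of_shortExact hS j hL))
  have h2 := preservesInjective_of_projective k T.X₂ S.f hS.moduleCat_injective_f
  intro x y hxy
  refine h1 (h2 ?_)
  have h3 := congrArg (BalTensor.map k (LinearMap.id : S.X₂ →ₗ[Rᵐᵒᵖ] S.X₂) T.f.hom) hxy
  rw [BalTensor.map_map, BalTensor.map_map] at h3
  rw [BalTensor.map_map, BalTensor.map_map]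
  exact h3

/-- By the ideal criterion it is enough to use `Tor₁(R/J, N) = 0` for right ideals `J`, tested on
the presentation `0 → J → R → R/J → 0`. -/
lemma isFlat_of_torOneVanishes (N : ModuleCat.{u} R)
    (h : ∀ L : ModuleCat.{u} Rᵐᵒᵖ, Module.Finite Rᵐᵒᵖ L → TorOneVanishes k L N) : IsFlat N := by
  refine isFlat_of_ideals k N fun J ↦ ?_
  let i : ModuleCat.of Rᵐᵒᵖ J ⟶ ModuleCat.of Rᵐᵒᵖ Rᵐᵒᵖ := ModuleCat.ofHom J.subtype
  have : Mono i := (ModuleCat.mono_iff_injective i).2 J.injective_subtype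
  have h1 := h (cokernel i)
    (Module.Finite.of_surjective (cokernel.π i).hom
      ((ModuleCat.epi_iff_surjective (cokernel.π i)).1 inferInstance))
    (ShortComplex.mk i (cokernel.π i) (cokernel.condition i))
    { exact := ShortComplex.exact_of_g_is_cokernel _ (cokernelIsCokernel i) } rfl
    (inferInstanceAs (Module.Finite Rᵐᵒᵖ Rᵐᵒᵖ))
    ((IsProjective.iff_projective (R := Rᵐᵒᵖ) Rᵐᵒᵖ).1 inferInstance)
  have h2 : Function.Injective (BalTensor.map k J.subtype (LinearMap.id : N →ₗ[R] N)) :=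
    -- The base ring does not change here. The step passes from the `k`-module structures restricted
    -- from the bundled modules to the standard ones on `J` and `Rᵐᵒᵖ`.
    @BalTensor.map_injective_changeBase k _ R _ _ J Rᵐᵒᵖ _ _
      (restrictModule k (ModuleCat.of Rᵐᵒᵖ J)) (restrictModule k (ModuleCat.of Rᵐᵒᵖ Rᵐᵒᵖ)) _ _
      (isScalarTower_restrictModule k (ModuleCat.of Rᵐᵒᵖ J))
      (isScalarTower_restrictModule k (ModuleCat.of Rᵐᵒᵖ Rᵐᵒᵖ)) N N _ _ _ _ _ _ _ _
      k _ _ _ _ _ _ _ _ _ _ J.subtype LinearMap.id h1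
  intro x y hxy
  have h3 := BalTensor.contract_map k LinearMap.id J.subtype (LinearMap.id : N →ₗ[R] N)
  refine h2 (BalTensor.contract_id_injective k ?_)
  rw [h3, h3]
  exact hxy

/-- Here `j` counts the syzygies already taken: `Ext^{j+1}(L, R) = 0` implies `Tor₁(L, N) = 0` when
`N` is a `j`-th syzygy of an injective module. After `r` more syzygies the condition on Ext holds
for every `L`, and the module is flat. -/
lemma hasFlatResolution_of_torOneVanishes [IsNoetherianRing Rᵐᵒᵖ] (r : ℕ) :
    ∀ (j : ℕ) (N : ModuleCat.{u} R)
      (_ : ∀ L : ModuleCat.{u} Rᵐᵒᵖ, Module.Finite Rᵐᵒᵖ L →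
        (∀ e : Abelian.Ext L (rightRegular R) (j + 1), e = 0) → TorOneVanishes k L N)
      (_ : ∀ (L : ModuleCat.{u} Rᵐᵒᵖ) (e : Abelian.Ext L (rightRegular R) (j + r + 1)), e = 0),
      HasFlatResolution r N := by
  induction r with
  | zero => exact fun j N h h' ↦ isFlat_of_torOneVanishes k N fun L hL ↦ h L hL (h' L)
  | succ r ih =>
    intro j N h h'
    let T : ShortComplex (ModuleCat.{u} R) :=
      ShortComplex.mk (kernel.ι (Projective.π N)) (Projective.π N) (kernel.condition _)
    have hT : T.ShortExact :=
      { exact := ShortComplex.exact_of_f_is_kernel _ (kernelIsKernel _)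
        mono_f := inferInstanceAs (Mono (kernel.ι (Projective.π N)))
        epi_g := inferInstanceAs (Epi (Projective.π N)) }
    have hP : Projective T.X₂ := inferInstanceAs (Projective (Projective.over N))
    have hflat : IsFlat T.X₂ := (isFlat_iff k _).2 (preservesInjective_of_projective k T.X₂)
    refine ⟨T, hT, ⟨Iso.refl _⟩, hflat, ih (j + 1) T.X₁ ?_ fun L ↦ ?_⟩
    · exact fun L hL hL' ↦ TorOneVanishes.syzygy k L hT j hL' h
    · rw [show j + 1 + r + 1 = j + (r + 1) + 1 by omega]
      exact h' L

end

lemma sfli_lt_top_of_gorenstein (k : Type w) [CommRing k] {R : Type u} [Ring R] [Algebra k R]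
    (hR : IsIwanagaGorenstein R) : sfli R < ⊤ := by
  have := hR.noetherian_right
  obtain ⟨n, hn⟩ := (injectiveDimension_ne_top_iff _).1 hR.injectiveDimension_right.ne
  refine lt_of_le_of_lt (b := (n : ℕ∞)) (iSup₂_le fun E hE ↦ ?_) (ENat.natCast_lt_top n)
  -- Here `n` bounds the injective dimension of `R` as a right module, so `Ext^{n+1}(-, R) = 0`.
  refine iInf₂_le n (hasFlatResolution_of_torOneVanishes k n 0 E (fun L _ hL ↦ ?_) fun L e ↦ ?_)
  · exact torOneVanishes_of_injective k L hL E
  · exact Abelian.Ext.eq_zero_of_hasInjectiveDimensionLT e (n + 1) (by omega)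

/-! ### Vanishing of Tor -/

section

variable (k : Type w) [CommRing k] {R : Type u} [Ring R] [Algebra k R]

lemma exactAt_iff_forall {A : Type*} [Ring A] (K : ChainComplex (ModuleCat.{u} A) ℤ) (i : ℤ) :
    K.ExactAt i ↔ ∀ x : K.X i, (K.d i (i - 1)).hom x = 0 →
      ∃ y : K.X (i + 1), (K.d (i + 1) i).hom y = x := by
  rw [K.exactAt_iff' (i + 1) i (i - 1) (by simp) (by simp), ShortComplex.moduleCat_exact_iff]
  rfl

lemma projRes_exactAt (M : ModuleCat.{u} Rᵐᵒᵖ) {i : ℤ} (hi : 0 < i) : (projRes R M).ExactAt i := by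
  obtain ⟨n, rfl⟩ : ∃ n : ℕ, ((n + 1 : ℕ) : ℤ) = i := ⟨(i - 1).toNat, by omega⟩
  exact ((projectiveResolution M).complex.extend_exactAt_iff chainEmbedding rfl).2
    ((projectiveResolution M).complex_exactAt_succ n)

/-- Factor the differential through its image `B`. The inclusion of `B` stays injective after
tensoring with `N`, and right exactness handles `Q.X (i + 1) → Q.X i → B → 0`. -/
lemma tensorComplex_exactAt {Q : ChainComplex (ModuleCat.{u} Rᵐᵒᵖ) ℤ} {i : ℤ} (hQ : Q.ExactAt i)
    {N : ModuleCat.{u} R} (hN : PreservesInjective k N) :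
    ((tensorComplex k R Q).obj N).ExactAt i := by
  rw [exactAt_iff_forall] at hQ ⊢
  intro (x : BalTensor k R (Q.X i) N) hx
  replace hx : BalTensor.map k (Q.d i (i - 1)).hom (LinearMap.id : N →ₗ[R] N) x = 0 := hx
  let B : ModuleCat.{u} Rᵐᵒᵖ := ModuleCat.of Rᵐᵒᵖ (LinearMap.range (Q.d i (i - 1)).hom)
  let p : Q.X i →ₗ[Rᵐᵒᵖ] B := (Q.d i (i - 1)).hom.rangeRestrict
  let j : B ⟶ Q.X (i - 1) := ModuleCat.ofHom (LinearMap.range (Q.d i (i - 1)).hom).subtype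
  have hpx : BalTensor.map k p (LinearMap.id : N →ₗ[R] N) x = 0 := by
    refine hN j (Submodule.injective_subtype _) ?_
    rw [map_zero, BalTensor.map_map]
    exact hx
  refine BalTensor.exact_left k (f := (Q.d (i + 1) i).hom) (g := p) (fun y ↦ ⟨fun hy ↦ ?_, ?_⟩)
    (LinearMap.surjective_rangeRestrict _) x hpx
  · exact hQ y (congrArg Subtype.val hy)
  · rintro ⟨z, rfl⟩
    refine Subtype.ext ?_
    exact congrArg (fun f ↦ f.hom z) (Q.d_comp_d (i + 1) i (i - 1))

lemma isZero_tor_of_hasFlatResolution (M : ModuleCat.{u} Rᵐᵒᵖ) (n : ℕ) :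
    ∀ (N : ModuleCat.{u} R), HasFlatResolution n N → ∀ i : ℤ, n < i →
      IsZero ((torFunctor k M i).obj N) := by
  have hflat : ∀ (N : ModuleCat.{u} R), IsFlat N → ∀ i : ℤ, 0 < i →
      IsZero ((torFunctor k M i).obj N) := fun N hN i hi ↦
    (tensorComplex_exactAt k (projRes_exactAt M hi) ((isFlat_iff k N).1 hN)).isZero_homology
  induction n with
  | zero => exact fun N hN i hi ↦ hflat N hN i (by simpa using hi)
  | succ n ih =>
    rintro N ⟨S, hS, ⟨e⟩, h2, h1⟩ i hi
    push_cast at hi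
    refine IsZero.of_iso ?_ ((torFunctor k M i).mapIso e.symm)
    -- `Tor_i(S.X₃)` sits between `Tor_i(S.X₂)`, zero by flatness, and `Tor_{i-1}(S.X₁)`, zero by
    -- induction.
    exact ((tor k M).exact₃ hS i (i - 1) (by omega)).isZero_of_both_zeros
      ((hflat _ h2 i (by omega)).eq_of_src _ _) ((ih _ h1 (i - 1) (by omega)).eq_of_tgt _ _)

lemma exists_isZero_tor_of_sfli (h : sfli R < ⊤) :
    ∃ d : ℕ, ∀ (M : ModuleCat.{u} Rᵐᵒᵖ) (E : ModuleCat.{u} R), Injective E → ∀ i : ℤ, d < i →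
      IsZero ((torFunctor k M i).obj E) := by
  obtain ⟨d, hd⟩ := ENat.ne_top_iff_exists.1 h.ne
  refine ⟨d, fun M E hE i hi ↦ ?_⟩
  have h1 : flatDimension E < (d + 1 : ℕ) := by
    refine lt_of_le_of_lt ((le_iSup₂ (f := fun (E : ModuleCat.{u} R) (_ : Injective E) ↦
      flatDimension E) E hE).trans hd.ge) ?_
    exact_mod_cast Nat.lt_succ_self d
  obtain ⟨n, hn⟩ := iInf_lt_iff.1 h1
  obtain ⟨hn, hnd⟩ := iInf_lt_iff.1 hn
  have hnd' : n < d + 1 := by exact_mod_cast hnd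
  exact isZero_tor_of_hasFlatResolution k M n E hn i (by omega)

end

/-! ### Satellites of functors that vanish on injective objects -/

section

variable {C : Type*} [Category* C] [Abelian C] {D : Type*} [Category* D] [Abelian D]

/-- An extension of `f : S.X₁ ⟶ S'.X₁` to a morphism of short exact sequences. -/
def extendToShortComplex {S S' : ShortComplex C} (hS : S.ShortExact) [Injective S'.X₂]
    (f : S.X₁ ⟶ S'.X₁) : S ⟶ S' :=
  have := hS.mono_f
  { τ₁ := f
    τ₂ := Injective.factorThru (f ≫ S'.f) S.f
    τ₃ := hS.gIsCokernel.desc (CokernelCofork.ofπ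
      (Injective.factorThru (f ≫ S'.f) S.f ≫ S'.g) (by
        rw [← Category.assoc, Injective.comp_factorThru, Category.assoc, S'.zero, comp_zero]))
    comm₁₂ := (Injective.comp_factorThru _ _).symm
    comm₂₃ := (hS.gIsCokernel.fac (CokernelCofork.ofπ
      (Injective.factorThru (f ≫ S'.f) S.f ≫ S'.g) _) WalkingParallelPair.one).symm }

/-- Two morphisms that agree on `X₁` differ on `X₃` by a map that factors through `S'.X₂`, and `T`
kills `S'.X₂`. Hence for `T` vanishing on injectives, `T` of a cosyzygy is functorial and
independent of choices. -/
lemma map_τ₃_eq (T : C ⥤ D) [T.Additive] {S S' : ShortComplex C} (hS : S.ShortExact)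
    (hT : IsZero (T.obj S'.X₂)) (α β : S ⟶ S') (h : α.τ₁ = β.τ₁) : T.map α.τ₃ = T.map β.τ₃ := by
  have := hS.epi_g
  let c : CokernelCofork S.f := CokernelCofork.ofπ (α.τ₂ - β.τ₂) (by
    rw [Preadditive.comp_sub, ← α.comm₁₂, ← β.comm₁₂, h, sub_self])
  let t : S.X₃ ⟶ S'.X₂ := hS.gIsCokernel.desc c
  have ht : S.g ≫ t = α.τ₂ - β.τ₂ := hS.gIsCokernel.fac c WalkingParallelPair.one
  have h1 : α.τ₃ - β.τ₃ = t ≫ S'.g := by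
    rw [← cancel_epi S.g, Preadditive.comp_sub, ← α.comm₂₃, ← β.comm₂₃, ← Preadditive.sub_comp,
      ← ht, Category.assoc]
  rw [← sub_eq_zero, ← T.map_sub, h1, T.map_comp, hT.eq_of_tgt (T.map t) 0, zero_comp]

variable [EnoughInjectives C]

instance (N : C) : Injective (cosyzygySeq N).X₂ := inferInstanceAs (Injective (Injective.under N))

/-- `T` vanishes on injective objects. -/
def VanishesOnInjectives (T : C ⥤ D) : Prop := ∀ E : C, Injective E → IsZero (T.obj E)

/-- The map `ΩN ⟶ X` given by an exact sequence `0 ⟶ N ⟶ E ⟶ X ⟶ 0` with `E` injective. -/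
def fromCosyzygy (S : ShortComplex C) [Injective S.X₂] : cosyzygy S.X₁ ⟶ S.X₃ :=
  (extendToShortComplex (S' := S) (cosyzygySeq_shortExact S.X₁) (𝟙 S.X₁)).τ₃

/-- The map `X ⟶ ΩN` given by an exact sequence `0 ⟶ N ⟶ E ⟶ X ⟶ 0`. -/
def toCosyzygy {S : ShortComplex C} (hS : S.ShortExact) : S.X₃ ⟶ cosyzygy S.X₁ :=
  (extendToShortComplex (S' := cosyzygySeq S.X₁) hS (𝟙 S.X₁)).τ₃

lemma map_fromCosyzygy_naturality (T : C ⥤ D) [T.Additive] (hT : VanishesOnInjectives T)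
    {S S' : ShortComplex C} [Injective S.X₂] [Injective S'.X₂] (φ : S ⟶ S') :
    T.map (cosyzygyMap φ.τ₁) ≫ T.map (fromCosyzygy S') = T.map (fromCosyzygy S) ≫ T.map φ.τ₃ :=
  ((T.map_comp _ _).symm.trans (map_τ₃_eq T (cosyzygySeq_shortExact S.X₁) (hT _ inferInstance)
    (cosyzygySeqMap φ.τ₁ ≫ extendToShortComplex (cosyzygySeq_shortExact S'.X₁) (𝟙 S'.X₁))
    (extendToShortComplex (cosyzygySeq_shortExact S.X₁) (𝟙 S.X₁) ≫ φ)
    ((Category.comp_id φ.τ₁).trans (Category.id_comp φ.τ₁).symm))).trans (T.map_comp _ _)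

/-- The composite lies over the identity of `S.X₁`, as the identity does, so `T` does not
distinguish them. The two cosyzygies themselves need not be isomorphic. -/
lemma map_fromCosyzygy_toCosyzygy (T : C ⥤ D) [T.Additive] (hT : VanishesOnInjectives T)
    {S : ShortComplex C} (hS : S.ShortExact) [Injective S.X₂] :
    T.map (fromCosyzygy S) ≫ T.map (toCosyzygy hS) = 𝟙 _ :=
  ((T.map_comp _ _).symm.trans (map_τ₃_eq T (cosyzygySeq_shortExact S.X₁) (hT _ inferInstance)
    (extendToShortComplex (S' := S) (cosyzygySeq_shortExact S.X₁) (𝟙 S.X₁) ≫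
      extendToShortComplex (S' := cosyzygySeq S.X₁) hS (𝟙 S.X₁)) (𝟙 _)
      (Category.id_comp (𝟙 S.X₁)))).trans (T.map_id _)

lemma map_toCosyzygy_fromCosyzygy (T : C ⥤ D) [T.Additive] (hT : VanishesOnInjectives T)
    {S : ShortComplex C} (hS : S.ShortExact) [Injective S.X₂] :
    T.map (toCosyzygy hS) ≫ T.map (fromCosyzygy S) = 𝟙 _ :=
  ((T.map_comp _ _).symm.trans (map_τ₃_eq T hS (hT _ inferInstance)
    (extendToShortComplex (S' := cosyzygySeq S.X₁) hS (𝟙 S.X₁) ≫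
      extendToShortComplex (S' := S) (cosyzygySeq_shortExact S.X₁) (𝟙 S.X₁)) (𝟙 _)
      (Category.id_comp (𝟙 S.X₁)))).trans (T.map_id _)

/-- The comparison `S¹T(N) ⟶ T(X)` given by an exact sequence `0 ⟶ N ⟶ E ⟶ X ⟶ 0` with
`E` injective. -/
def satelliteComparison (T : C ⥤ D) (hT : VanishesOnInjectives T) (S : ShortComplex C)
    [Injective S.X₂] : satelliteObj T S.X₁ ⟶ T.obj S.X₃ :=
  satelliteDesc (T.map (fromCosyzygy S)) ((hT _ inferInstance).eq_of_src _ _)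

lemma satelliteComparison_naturality (T : C ⥤ D) [T.Additive] (hT : VanishesOnInjectives T)
    {S S' : ShortComplex C} [Injective S.X₂] [Injective S'.X₂] (φ : S ⟶ S') :
    satelliteMap T φ.τ₁ ≫ satelliteComparison T hT S' =
      satelliteComparison T hT S ≫ T.map φ.τ₃ := by
  rw [← cancel_epi (satelliteπ T S.X₁), π_satelliteMap_assoc, satelliteComparison,
    satelliteComparison, π_satelliteDesc, π_satelliteDesc_assoc,
    map_fromCosyzygy_naturality T hT φ]

lemma isIso_satelliteComparison (T : C ⥤ D) [T.Additive] (hT : VanishesOnInjectives T)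
    {S : ShortComplex C} (hS : S.ShortExact) [Injective S.X₂] :
    IsIso (satelliteComparison T hT S) := by
  refine ⟨T.map (toCosyzygy hS) ≫ satelliteπ T S.X₁, ?_, ?_⟩
  · rw [← cancel_epi (satelliteπ T S.X₁), satelliteComparison, π_satelliteDesc_assoc,
      ← Category.assoc, map_fromCosyzygy_toCosyzygy T hT hS, Category.comp_id, Category.id_comp]
  · rw [Category.assoc, satelliteComparison, π_satelliteDesc,
      map_toCosyzygy_fromCosyzygy T hT hS]

/-- For injective `E` the sequence `0 → E → I → ΩE → 0` splits, so `T(I) → T(ΩE)` is epi. This lets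
the iteration of satellites proceed. -/
lemma vanishesOnInjectives_satellite (T : C ⥤ D) [T.Additive] :
    VanishesOnInjectives (satelliteFunctor T) := by
  intro E hE
  have hsplit : IsSplitEpi (cosyzygyπ E) := by
    have : Epi (cosyzygySeq E).g := inferInstanceAs (Epi (cosyzygyπ E))
    let r : Injective.under E ⟶ E := Injective.factorThru (𝟙 E) (Injective.ι E)
    have hr : Injective.ι E ≫ r = 𝟙 E := Injective.comp_factorThru _ _
    let s := ShortComplex.Splitting.ofExactOfRetraction (cosyzygySeq E)
      (cosyzygySeq_shortExact E).exact r hr inferInstance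
    exact ⟨⟨s.s, s.s_g⟩⟩
  have : Epi (T.map (cosyzygyπ E)) := inferInstance
  exact isZero_cokernel_of_epi _

end

/-! ### Resolutions as cochain complexes -/

section

variable (C : Type*) [Category* C] [Abelian C] {D : Type*} [Category* D] [Abelian D]

/-- The cochain complexes that are injective resolutions of their zeroth cocycles. -/
def isResolution : ObjectProperty (CochainComplex C ℤ) := fun J ↦
  (∀ q, Injective (J.X q)) ∧ (∀ q < 0, IsZero (J.X q)) ∧ ∀ q > 0, J.ExactAt q

/-- The functor that sends a resolution to its cocycles in degree `n`. -/
def resolutionCycles (n : ℤ) : (isResolution C).FullSubcategory ⥤ C :=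
  (isResolution C).ι ⋙ HomologicalComplex.cyclesFunctor C _ n

variable {C}

/-- The sequence `Z^q ⟶ J^q ⟶ Z^{q+1}`. -/
def cyclesSeq (J : CochainComplex C ℤ) (q q' : ℤ) : ShortComplex C :=
  ShortComplex.mk (J.iCycles q) (J.toCycles q q') (by
    rw [← cancel_mono (J.iCycles q')]; simp)

/-- The morphism of sequences `Z^q ⟶ J^q ⟶ Z^{q+1}` induced by a morphism of complexes. -/
def cyclesSeqMap {J J' : CochainComplex C ℤ} (φ : J ⟶ J') (q q' : ℤ) :
    cyclesSeq J q q' ⟶ cyclesSeq J' q q' where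
  τ₁ := HomologicalComplex.cyclesMap φ q
  τ₂ := φ.f q
  τ₃ := HomologicalComplex.cyclesMap φ q'
  comm₁₂ := HomologicalComplex.cyclesMap_i φ q
  comm₂₃ := by
    change φ.f q ≫ J'.toCycles q q' = J.toCycles q q' ≫ HomologicalComplex.cyclesMap φ q'
    rw [← cancel_mono (J'.iCycles q')]
    simp

/-- `Z^q` is the kernel of `J^q → Z^{q'}` because `Z^{q'} → J^{q'}` is mono, and the cokernel of
`J^q → Z^{q'}` is the homology at `q'`. -/
lemma cyclesSeq_shortExact (J : CochainComplex C ℤ) (q q' : ℤ) (h : q + 1 = q')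
    (hJ : J.ExactAt q') : (cyclesSeq J q q').ShortExact where
  exact := ShortComplex.exact_of_f_is_kernel _
    (isKernelOfComp (J.iCycles q') (J.d q q') (J.cyclesIsKernel q q' (by simp [h]))
      (cyclesSeq J q q').zero (J.toCycles_i q q'))
  mono_f := inferInstanceAs (Mono (J.iCycles q))
  epi_g := Preadditive.epi_of_isZero_cokernel'
    _ (J.homologyIsCokernel q q' (by simp [← h])) hJ.isZero_homology

variable [EnoughInjectives C]

/-- `S¹T(Z^q) ≅ T(Z^{q+1})`, as functors of the resolution. -/
def satelliteCyclesIso (T : C ⥤ D) [T.Additive] (hT : VanishesOnInjectives T) (n : ℕ) :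
    resolutionCycles C n ⋙ satelliteFunctor T ≅ resolutionCycles C (n + 1 : ℕ) ⋙ T :=
  have hinj (J : (isResolution C).FullSubcategory) :
    Injective (cyclesSeq J.obj n (n + 1 : ℕ)).X₂ := J.property.1 _
  NatIso.ofComponents (fun J ↦
    have := hinj J
    have := isIso_satelliteComparison T hT
      (cyclesSeq_shortExact J.obj n (n + 1 : ℕ) (by simp) (J.property.2.2 _ (by positivity)))
    @asIso _ _ _ _ (satelliteComparison T hT (cyclesSeq J.obj n (n + 1 : ℕ))) this)
    (fun φ ↦ satelliteComparison_naturality T hT (cyclesSeqMap φ.hom n (n + 1 : ℕ)))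

/-- `SⁿT(Z^0) ≅ T(Z^n)`, as functors of the resolution. -/
theorem nonempty_iteratedSatellite_cycles_iso (n : ℕ) : ∀ (T : C ⥤+ D) (_ : VanishesOnInjectives T.obj),
    Nonempty (resolutionCycles C 0 ⋙ ((iteratedSatellite n).obj T).obj ≅
      resolutionCycles C n ⋙ T.obj) := by
  induction n with
  | zero => exact fun T _ ↦ ⟨Iso.refl _⟩
  | succ n ih =>
    intro T hT
    obtain ⟨e⟩ := ih (satellite.obj T) (vanishesOnInjectives_satellite T.obj)
    -- `Sⁿ⁺¹T(Z^0) = Sⁿ(S¹T)(Z^0) ≅ S¹T(Z^n) ≅ T(Z^{n+1})`.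
    exact ⟨e ≪≫ satelliteCyclesIso T.obj hT n⟩

end

/-! ### The completion of a homological functor that vanishes on injectives in high degrees. -/

namespace HomologicalFunctor

variable {C : Type*} [Category* C] [Abelian C] [EnoughInjectives C]
  {D : Type*} [Category* D] [Abelian D] (H : HomologicalFunctor C D)

/-- In `T_i(I) → T_i(ΩN) → T_j(N) → T_j(I)` exactness at `T_i(ΩN)` makes the map from the cokernel
mono, and `T_j(I) = 0` makes it epi. -/
lemma isIso_satelliteToSelf (i j : ℤ) (hij : j + 1 = i)
    (hj : VanishesOnInjectives (H.T j).obj) : IsIso (H.satelliteToSelf i j hij) := by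
  have happ : ∀ N, IsIso ((H.satelliteToSelf i j hij).hom.app N) := fun N ↦ by
    have h1 : Mono ((H.satelliteToSelf i j hij).hom.app N) :=
      (H.exact₃ (cosyzygySeq_shortExact N) i j hij).mono_cokernelDesc
    have h2 : Epi (H.cosyzygyδ i j hij N) :=
      (H.exact₁ (cosyzygySeq_shortExact N) i j hij).epi_f
        ((hj _ (inferInstanceAs (Injective (Injective.under N)))).eq_of_tgt _ _)
    have h3 : satelliteπ (H.T i).obj N ≫ (H.satelliteToSelf i j hij).hom.app N =
      H.cosyzygyδ i j hij N := π_satelliteDesc _ _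
    have h4 : Epi ((H.satelliteToSelf i j hij).hom.app N) := by
      rw [← h3] at h2
      exact epi_of_epi (satelliteπ (H.T i).obj N) _
    exact isIso_of_mono_of_epi _
  have : IsIso ((AdditiveFunctor.forget C D).map (H.satelliteToSelf i j hij)) :=
    NatTrans.isIso_iff_isIso_app _ |>.2 happ
  exact isIso_of_reflects_iso _ (AdditiveFunctor.forget C D)

lemma isIso_ofOpSequence_map {A : Type*} [Category* A] {X : ℕ → A} (f : ∀ n, X (n + 1) ⟶ X n)
    (n : ℕ) (hf : ∀ m ≥ n, IsIso (f m)) :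
    (Functor.ofOpSequence f).IsEventuallyConstantTo (Opposite.op n) := by
  have key : ∀ m (h : n ≤ m), IsIso ((Functor.ofOpSequence f).map (homOfLE h).op) := by
    intro m h
    induction m, h using Nat.le_induction with
    | base =>
      have : (homOfLE (le_refl n)).op = 𝟙 (Opposite.op n) := Subsingleton.elim _ _
      rw [this]
      infer_instance
    | succ m h ih =>
      have : (homOfLE (h.trans (Nat.le_add_right m 1))).op =
        (homOfLE (Nat.le_add_right m 1)).op ≫ (homOfLE h).op := Subsingleton.elim _ _
      rw [this, Functor.map_comp, Functor.ofOpSequence_map_homOfLE_succ]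
      have := hf m h
      exact @IsIso.comp_isIso _ _ _ _ _ _ _ this ih
  intro m g
  have : g = (homOfLE (leOfHom g.unop)).op := Subsingleton.elim _ _
  rw [this]
  exact key _ _

/-- If `T_j` vanishes on injective objects for all `j ≥ n + i`, then the completion in degree `i`
is `SⁿT_{n+i}`. -/
lemma nonempty_completion_iso [HasLimitsOfShape ℕᵒᵖ D] (i : ℤ) (n : ℕ)
    (h : ∀ j : ℤ, n + i ≤ j → VanishesOnInjectives (H.T j).obj) :
    Nonempty (H.completion i ≅ H.completionTerm i n) := by
  have hstep : ∀ m ≥ n, IsIso (H.completionStep i m) := fun m hm ↦ by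
    have := H.isIso_satelliteToSelf ((m + 1 : ℕ) + i) (m + i) (by push_cast; ring)
      (h _ (by omega))
    have h1 : IsIso ((iteratedSatellite m).map
      (H.satelliteToSelf ((m + 1 : ℕ) + i) (m + i) (by push_cast; ring))) :=
      @Functor.map_isIso _ _ _ _ _ _ _ _ this
    exact @Functor.map_isIso _ _ _ _ _ _ (AdditiveFunctor.forget C D) _ h1
  have := (isIso_ofOpSequence_map (H.completionStep i) n hstep).isIso_π_of_isLimit
    (limit.isLimit (H.completionSystem i))
  exact ⟨@asIso _ _ _ _ ((limit.cone (H.completionSystem i)).π.app (Opposite.op n)) this⟩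

end HomologicalFunctor

/-! ### The truncated completed tensor product -/

section

variable (k : Type w) [CommRing k] {R : Type u} [Ring R] [Algebra k R]
  (Q : ChainComplex (ModuleCat.{u} Rᵐᵒᵖ) ℤ)

section Elements

variable {J : CochainComplex (ModuleCat.{u} R) ℤ}

/-- The families that vanish on all components with `q < n`. -/
def geTensor (J : CochainComplex (ModuleCat.{u} R) ℤ) (n t : ℤ) :
    Submodule k (ProdTensor k Q J t) where
  carrier := {x | ∀ a, a.1.2 < n → x a = 0}
  zero_mem' _ _ := rfl
  add_mem' hx hy a ha := by rw [Pi.add_apply, hx a ha, hy a ha, add_zero]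
  smul_mem' c x hx a ha := by rw [Pi.smul_apply, hx a ha, smul_zero]

lemma prodTensorD_mem_ge (n i j : ℤ) (h : j + 1 = i) (x : ProdTensor k Q J i)
    (hx : x ∈ geTensor k Q J n i) : prodTensorD k Q J i j h x ∈ geTensor k Q J n j := by
  rintro ⟨⟨p, q⟩, hpq⟩ (hq : q < n)
  rw [prodTensorD_apply k Q J i j h x p q (p + 1) (q - 1) hpq rfl (by omega), hx _ hq,
    hx _ (show q - 1 < n by omega)]
  simp

/-- The value of the differential on a homogeneous element. -/
lemma prodTensorD_single (i j : ℤ) (h : j + 1 = i) (p q p' q' : ℤ) (hpq : p = q + i)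
    (hp : p' + 1 = p) (hq : q + 1 = q') (z : BalTensor k R (Q.X p) (J.X q)) :
    prodTensorD k Q J i j h (Pi.single (⟨(p, q), hpq⟩ : Bidegree i) z) =
      Pi.single (⟨(p', q), by dsimp only; omega⟩ : Bidegree j)
          (BalTensor.map k (Q.d p p').hom LinearMap.id z) +
        (p.negOnePow : ℤ) • Pi.single (⟨(p, q'), by dsimp only; omega⟩ : Bidegree j)
          (BalTensor.map k LinearMap.id (J.d q q').hom z) := by
  funext ⟨⟨a, b⟩, hab⟩
  dsimp only at hab
  rw [prodTensorD_apply k Q J i j h _ a b (a + 1) (b - 1) hab rfl (by omega), Pi.add_apply,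
    Pi.smul_apply]
  by_cases h1 : b = q
  · obtain rfl : a = p' := by omega
    subst h1 hp
    rw [Pi.single_eq_same, Pi.single_eq_same, Pi.single_eq_of_ne, Pi.single_eq_of_ne]
    · simp
    · simp only [ne_eq, Subtype.mk.injEq, Prod.mk.injEq]; omega
    · simp only [ne_eq, Subtype.mk.injEq, Prod.mk.injEq]; omega
  · rw [Pi.single_eq_of_ne (i := (⟨(p, q), hpq⟩ : Bidegree i)) (i' := ⟨(a + 1, b), _⟩),
      Pi.single_eq_of_ne (i := (⟨(p', q), _⟩ : Bidegree j)) (i' := ⟨(a, b), _⟩)]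
    · by_cases h2 : b = q'
      · obtain rfl : a = p := by omega
        obtain rfl : q = b - 1 := by omega
        subst h2
        rw [Pi.single_eq_same, Pi.single_eq_same]
        simp
      · rw [Pi.single_eq_of_ne, Pi.single_eq_of_ne]
        · simp
        · simp only [ne_eq, Subtype.mk.injEq, Prod.mk.injEq]; omega
        · simp only [ne_eq, Subtype.mk.injEq, Prod.mk.injEq]; omega
    · simp only [ne_eq, Subtype.mk.injEq, Prod.mk.injEq]; omega
    · simp only [ne_eq, Subtype.mk.injEq, Prod.mk.injEq]; omega

/-- In a fixed total degree a bidegree is determined by its `q`, so bounded support is finite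
support. -/
lemma mem_finTensor_of_bounded {t : ℤ} (x : ProdTensor k Q J t) (n n' : ℤ)
    (h : ∀ a, a.1.2 < n → x a = 0) (h' : ∀ a, n' < a.1.2 → x a = 0) : x ∈ finTensor k Q J t := by
  have hinj : Function.Injective (fun a : Bidegree t ↦ a.1.2) := fun a b hab ↦
    Subtype.ext (Prod.ext (by rw [a.2, b.2]; simpa using hab) hab)
  refine ((Set.finite_Icc n n').preimage hinj.injOn).subset fun a ha ↦ ?_
  by_contra hcon
  simp only [Set.mem_preimage, Set.mem_Icc, not_and_or, not_le] at hcon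
  exact ha (hcon.elim (h a) (h' a))

lemma exists_bound_of_mem_finTensor {t : ℤ} {x : ProdTensor k Q J t} (n : ℤ)
    (hx : x ∈ finTensor k Q J t) : ∃ s : ℕ, ∀ a, n + s < a.1.2 → x a = 0 := by
  have hfin : {a | x a ≠ 0}.Finite := hx
  obtain ⟨c, hc⟩ := (hfin.image (fun a ↦ a.1.2)).bddAbove
  refine ⟨(c - n).toNat, fun a ha ↦ ?_⟩
  by_contra hcon
  have : a.1.2 ≤ c := hc ⟨a, hcon, rfl⟩
  omega

/-- A bounded family whose differential vanishes in positive degrees is, up to a boundary, an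
element of `Q ⊗_R Z^n`. -/
lemma exists_eq_single_add (n t : ℤ)
    (hJ : ∀ p q q', n < q' → q + 1 = q' → ∀ z : BalTensor k R (Q.X p) (J.X q'),
      BalTensor.map k (LinearMap.id : Q.X p →ₗ[Rᵐᵒᵖ] Q.X p) (J.d q' (q' + 1)).hom z = 0 →
        ∃ v, BalTensor.map k (LinearMap.id : Q.X p →ₗ[Rᵐᵒᵖ] Q.X p) (J.d q q').hom v = z)
    (s : ℕ) : ∀ (x : ProdTensor k Q J t) (_ : ∀ a, a.1.2 < n → x a = 0)
      (_ : ∀ a, n + s < a.1.2 → x a = 0)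
      (_ : ∀ b, n < b.1.2 → prodTensorD k Q J t (t - 1) (by omega) x b = 0),
      ∃ (p : ℤ) (hp : p = n + t) (z : BalTensor k R (Q.X p) (J.X n)) (y : ProdTensor k Q J (t + 1)),
        BalTensor.map k (LinearMap.id : Q.X p →ₗ[Rᵐᵒᵖ] Q.X p) (J.d n (n + 1)).hom z = 0 ∧
        (∀ a, a.1.2 < n → y a = 0) ∧ y ∈ finTensor k Q J (t + 1) ∧
        x = Pi.single (⟨(p, n), hp⟩ : Bidegree t) z + prodTensorD k Q J (t + 1) t rfl y := by
  have hunit : ∀ (p : ℤ) {q : ℤ} (z : BalTensor k R (Q.X p) (J.X q)),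
      (p.negOnePow : ℤ) • (p.negOnePow : ℤ) • z = z := fun p q z ↦ by
    rw [smul_smul, ← Units.val_mul, Int.units_mul_self, Units.val_one, one_smul]
  -- In column `q + 1` the differential collects the image of `x` from column `q + 1` and that from
  -- column `q`. If the first is absent, the component in column `q` is a cocycle for `J`.
  have htop : ∀ (x : ProdTensor k Q J t) (p q : ℤ) (hpq : p = q + t),
      prodTensorD k Q J t (t - 1) (by omega) x ⟨(p, q + 1), by dsimp only; omega⟩ = 0 →
      x ⟨(p + 1, q + 1), by dsimp only; omega⟩ = 0 →
      BalTensor.map k (LinearMap.id : Q.X p →ₗ[Rᵐᵒᵖ] Q.X p) (J.d q (q + 1)).hom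
        (x ⟨(p, q), hpq⟩) = 0 := fun x p q hpq h1 h2 ↦ by
    rw [prodTensorD_apply k Q J t (t - 1) (by omega) x p (q + 1) (p + 1) q (by omega) rfl rfl, h2,
      map_zero, zero_add] at h1
    rw [← hunit p (BalTensor.map k _ _ _), h1, smul_zero]
  induction s with
  | zero =>
    intro x hlt hgt hD
    refine ⟨n + t, rfl, x ⟨(n + t, n), rfl⟩, 0, ?_, fun _ _ ↦ rfl, zero_mem _, ?_⟩
    · exact htop x (n + t) n rfl (hD _ (by dsimp only; omega)) (hgt _ (by dsimp only; simp))
    · rw [map_zero, add_zero]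
      funext ⟨⟨p, q⟩, hpq⟩
      dsimp only at hpq
      by_cases h : q = n
      · subst h hpq
        rw [Pi.single_eq_same]
      · rw [Pi.single_eq_of_ne (by simp only [ne_eq, Subtype.mk.injEq, Prod.mk.injEq]; omega)]
        rcases lt_or_gt_of_ne h with h | h
        · exact hlt _ h
        · exact hgt _ (by dsimp only; simpa using h)
  | succ s ih =>
    intro x hlt hgt hD
    obtain ⟨q, hq⟩ : ∃ q, q = n + s := ⟨_, rfl⟩
    obtain ⟨p, hp⟩ : ∃ p, p = q + 1 + t := ⟨_, rfl⟩
    -- The top component of `x` is a horizontal cocycle, hence the horizontal boundary of some `v`.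
    -- Subtracting the differential of `± v` clears column `n + s + 1`, and the induction continues
    -- with smaller support. The sign in `y₁` cancels the one in the differential.
    obtain ⟨v, hv⟩ := hJ p q (q + 1) (by omega) rfl (x ⟨(p, q + 1), hp⟩)
      (htop x p (q + 1) hp (hD _ (by dsimp only; omega)) (hgt _ (by dsimp only; push_cast; omega)))
    have hpq : p = q + (t + 1) := by omega
    let y₁ : ProdTensor k Q J (t + 1) :=
      (p.negOnePow : ℤ) • Pi.single (⟨(p, q), hpq⟩ : Bidegree (t + 1)) v
    have hDy : prodTensorD k Q J (t + 1) t rfl y₁ =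
        (p.negOnePow : ℤ) • Pi.single (⟨(p - 1, q), by dsimp only; omega⟩ : Bidegree t)
            (BalTensor.map k (Q.d p (p - 1)).hom LinearMap.id v) +
          Pi.single (⟨(p, q + 1), hp⟩ : Bidegree t) (x ⟨(p, q + 1), hp⟩) := by
      rw [map_zsmul, prodTensorD_single k Q (t + 1) t rfl p q (p - 1) (q + 1) hpq (by omega) rfl,
        smul_add, smul_smul, ← Units.val_mul, Int.units_mul_self, Units.val_one, one_smul, hv]
    have hy₁ : ∀ a, a.1.2 ≠ q → y₁ a = 0 := fun a ha ↦ by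
      dsimp only [y₁]
      rw [Pi.smul_apply, Pi.single_eq_of_ne (fun h ↦ ha (by rw [h])), smul_zero]
    obtain ⟨p', hp', z, y, hz, hy, hyf, hxy⟩ := ih (x - prodTensorD k Q J (t + 1) t rfl y₁)
      (fun a ha ↦ by
        rw [Pi.sub_apply, hlt a ha, prodTensorD_mem_ge k Q n (t + 1) t rfl y₁
          (fun b hb ↦ hy₁ b (by omega)) a ha, sub_zero])
      (by
        rintro ⟨⟨a, b⟩, hab⟩ (ha : n + s < b)
        rw [Pi.sub_apply, hDy, Pi.add_apply, Pi.smul_apply,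
          Pi.single_eq_of_ne (by simp only [ne_eq, Subtype.mk.injEq, Prod.mk.injEq]; omega),
          smul_zero, zero_add]
        by_cases hb : b = q + 1
        · obtain rfl : a = p := by dsimp only at hab; omega
          subst hb
          rw [Pi.single_eq_same, sub_self]
        · rw [Pi.single_eq_of_ne (by simp only [ne_eq, Subtype.mk.injEq, Prod.mk.injEq]; omega),
            sub_zero]
          exact hgt _ (by dsimp only; push_cast; omega))
      (fun b hb ↦ by rw [map_sub, prodTensorD_comp, sub_zero]; exact hD b hb)
    refine ⟨p', hp', z, y + y₁, hz, fun a ha ↦ ?_, add_mem hyf ?_, ?_⟩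
    · rw [Pi.add_apply, hy a ha, hy₁ a (by omega), add_zero]
    · exact mem_finTensor_of_bounded k Q y₁ q q (fun a ha ↦ hy₁ a ha.ne) (fun a ha ↦ hy₁ a ha.ne')
    · rw [map_add, ← add_assoc, ← hxy, sub_add_cancel]

/-- If the columns `Q ⊗_R J^q` are exact in the relevant degrees, then every cycle of the
completed tensor product that is bounded below is a boundary. -/
lemma exists_prodTensorD_eq (n t : ℤ)
    (hQ : ∀ p q, n ≤ q → p = q + t → ∀ z : BalTensor k R (Q.X p) (J.X q),
      BalTensor.map k (Q.d p (p - 1)).hom (LinearMap.id : J.X q →ₗ[R] J.X q) z = 0 →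
        ∃ v, BalTensor.map k (Q.d (p + 1) p).hom (LinearMap.id : J.X q →ₗ[R] J.X q) v = z)
    (x : ProdTensor k Q J t) (hx : ∀ a, a.1.2 < n → x a = 0)
    (hD : prodTensorD k Q J t (t - 1) (by omega) x = 0) :
    ∃ y : ProdTensor k Q J (t + 1), (∀ a, a.1.2 < n → y a = 0) ∧
      prodTensorD k Q J (t + 1) t rfl y = x := by
  classical
  -- The equation `D y = x` reads, in column `q`, `∂ y_q = rhs`, where `rhs` depends only on column
  -- `q - 1` of `y`. So `y` can be found column by column.
  let rhs (y : ProdTensor k Q J (t + 1)) (p q : ℤ) (hpq : p = q + t) :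
      BalTensor k R (Q.X p) (J.X q) :=
    x ⟨(p, q), hpq⟩ - (p.negOnePow : ℤ) • BalTensor.map k LinearMap.id (J.d (q - 1) q).hom
      (y ⟨(p, q - 1), by dsimp only; omega⟩)
  let Φ (y : ProdTensor k Q J (t + 1)) : ProdTensor k Q J (t + 1) := fun b ↦
    if h : n ≤ b.1.2 ∧ ∃ v, BalTensor.map k (Q.d b.1.1 (b.1.1 - 1)).hom LinearMap.id v =
      rhs y (b.1.1 - 1) b.1.2 (by have := b.2; omega) then h.2.choose else 0
  -- One application of `Φ` solves each column from the one before it. Column `n` is correct after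
  -- one application, and column `q` after `q - n + 1`. All columns may be nonzero, which is why the
  -- direct product is needed.
  let y : ProdTensor k Q J (t + 1) := fun b ↦ Φ^[(b.1.2 - n).toNat + 1] 0 b
  have hΦlt : ∀ y b, b.1.2 < n → Φ y b = 0 := fun y b hb ↦ dif_neg fun h ↦ by omega
  have hylt : ∀ b, b.1.2 < n → y b = 0 := fun b hb ↦ by
    simp only [y, Function.iterate_succ_apply']
    exact hΦlt _ b hb
  have hrhs : ∀ (p q : ℤ) (hpq : p = q + t), n ≤ q →
      rhs (Φ^[(q - n).toNat] 0) p q hpq = rhs y p q hpq := fun p q hpq hq ↦ by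
    have : Φ^[(q - n).toNat] 0 ⟨(p, q - 1), by dsimp only; omega⟩ =
        y ⟨(p, q - 1), by dsimp only; omega⟩ := by
      rcases hq.eq_or_lt with rfl | hq
      · rw [hylt _ (by dsimp only; omega)]
        simp
      · have : (q - n).toNat = (q - 1 - n).toNat + 1 := by omega
        rw [this]
    simp only [rhs, this]
  have hfix : ∀ (p p' q : ℤ) (hpq : p = q + t) (hp : p + 1 = p'), n ≤ q →
      (∃ v, BalTensor.map k (Q.d p' p).hom (LinearMap.id : J.X q →ₗ[R] J.X q) v = rhs y p q hpq) →
      BalTensor.map k (Q.d p' p).hom (LinearMap.id : J.X q →ₗ[R] J.X q)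
        (y ⟨(p', q), by dsimp only; omega⟩) = rhs y p q hpq := by
    intro p p' q hpq hp hq hex
    obtain rfl : p = p' - 1 := by omega
    rw [← hrhs _ q hpq hq] at hex ⊢
    have h : y ⟨(p', q), by dsimp only; omega⟩ = Φ (Φ^[(q - n).toNat] 0) ⟨(p', q), by
        dsimp only; omega⟩ := by
      simp only [y, Function.iterate_succ_apply']
    have h2 : Φ (Φ^[(q - n).toNat] 0) ⟨(p', q), by dsimp only; omega⟩ = hex.choose :=
      dif_pos ⟨hq, hex⟩
    rw [h, h2]
    exact hex.choose_spec
  refine ⟨y, hylt, ?_⟩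
  have key : ∀ (s : ℕ) (b : Bidegree t), b.1.2 < n + s →
      prodTensorD k Q J (t + 1) t rfl y b = x b := by
    intro s
    induction s with
    | zero =>
      intro b hb
      have hb' : b.1.2 < n := by simpa using hb
      rw [hx b hb', prodTensorD_mem_ge k Q n (t + 1) t rfl y hylt b hb']
    | succ s ih =>
      rintro ⟨⟨p, q⟩, hpq⟩ hb
      dsimp only at hpq hb
      by_cases hq : n ≤ q
      · rw [prodTensorD_apply k Q J (t + 1) t rfl y p q (p + 1) (q - 1) hpq rfl (by omega)]
        rw [hfix p (p + 1) q hpq rfl hq (hQ p q hq hpq _ ?_), sub_add_cancel]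
        -- It remains to see that `rhs` is a cycle of the column: apply the differential of `J` to
        -- the equation already solved in column `q - 1` and compare with `D x = 0`.
        have h1 := congrFun hD ⟨(p - 1, q), by dsimp only; omega⟩
        rw [prodTensorD_apply k Q J t (t - 1) (by omega) x (p - 1) q p (q - 1) (by omega)
          (by omega) (by omega), Pi.zero_apply] at h1
        have h2 := ih ⟨(p - 1, q - 1), by dsimp only; omega⟩ (by dsimp only; push_cast at hb; omega)
        rw [prodTensorD_apply k Q J (t + 1) t rfl y (p - 1) (q - 1) p (q - 1 - 1) (by omega)
          (by omega) (by omega)] at h2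
        have h3 := congrArg (BalTensor.map k (LinearMap.id : Q.X (p - 1) →ₗ[Rᵐᵒᵖ] Q.X (p - 1))
          (J.d (q - 1) q).hom) h2
        have hJ : (J.d (q - 1) q).hom ∘ₗ (J.d (q - 1 - 1) (q - 1)).hom = 0 := by
          rw [← ModuleCat.hom_comp, J.d_comp_d]; rfl
        simp only [map_add, map_zsmul, BalTensor.map_map, hJ, BalTensor.map_zero_right,
          LinearMap.zero_apply, smul_zero, add_zero, LinearMap.id_comp, LinearMap.comp_id] at h3
        simp only [rhs, map_sub, map_zsmul, BalTensor.map_map, LinearMap.id_comp,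
          LinearMap.comp_id]
        rw [h3]
        have hsign : (p.negOnePow : ℤ) = - ((p - 1).negOnePow : ℤ) := by
          conv_lhs => rw [show p = p - 1 + 1 by omega, Int.negOnePow_succ, Units.val_neg]
        rw [hsign, neg_smul, sub_neg_eq_add]
        exact h1
      · have hb' : q < n := by omega
        rw [hx _ hb', prodTensorD_mem_ge k Q n (t + 1) t rfl y hylt _ hb']
  funext b
  exact key ((b.1.2 - n).toNat + 1) b (by push_cast; omega)

end Elements

end

lemma BalTensor.eq_zero_of_subsingleton (k : Type w) [CommRing k] {R : Type u} [Ring R]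
    [Algebra k R] {M N : Type u} [AddCommGroup M] [Module k M] [Module Rᵐᵒᵖ M]
    [IsScalarTower k Rᵐᵒᵖ M] [AddCommGroup N] [Module k N] [Module R N] [IsScalarTower k R N]
    [Subsingleton N] (x : BalTensor k R M N) : x = 0 := by
  induction x using BalTensor.induction_on with
  | zero => rfl
  | tmul p z => rw [Subsingleton.elim z 0, BalTensor.tmul_zero]
  | add _ _ h h' => rw [h, h', add_zero]

/-! ### Homology of complexes of modules in terms of elements -/

section

variable {A : Type*} [Ring A]

/-- A chain complex of modules given by its differentials of degree `-1`. -/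
def chainComplexOfStep (X : ℤ → ModuleCat.{u} A) (d : ∀ i j, j + 1 = i → (X i ⟶ X j))
    (hd : ∀ i j l h h', d i j h ≫ d j l h' = 0) : ChainComplex (ModuleCat.{u} A) ℤ where
  X := X
  d i j := if h : j + 1 = i then d i j h else 0
  shape i j h := dif_neg h
  d_comp_d' i j l (hij : j + 1 = i) (hjl : l + 1 = j) := by rw [dif_pos hij, dif_pos hjl, hd]

lemma chainComplexOfStep_d (X : ℤ → ModuleCat.{u} A) (d : ∀ i j, j + 1 = i → (X i ⟶ X j))
    (hd : ∀ i j l h h', d i j h ≫ d j l h' = 0) (i j : ℤ) (h : j + 1 = i) :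
    (chainComplexOfStep X d hd).d i j = d i j h := dif_pos h

lemma exists_iCycles_eq {c : ComplexShape ℤ} (K : HomologicalComplex (ModuleCat.{u} A) c)
    {i j : ℤ} (hij : c.next i = j) (x : K.X i) (hx : (K.d i j).hom x = 0) :
    ∃ z : K.cycles i, (K.iCycles i).hom z = x :=
  (ShortComplex.moduleCat_exact_iff _).1
    (ShortComplex.exact_of_f_is_kernel (ShortComplex.mk _ _ (K.iCycles_d i j))
      (K.cyclesIsKernel i j hij)) x hx

lemma iCycles_injective {c : ComplexShape ℤ} (K : HomologicalComplex (ModuleCat.{u} A) c) (i : ℤ) :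
    Function.Injective (K.iCycles i).hom :=
  (ModuleCat.mono_iff_injective _).1 inferInstance

lemma homologyπ_eq_zero_iff (K : ChainComplex (ModuleCat.{u} A) ℤ) {i : ℤ} (z : K.cycles i) :
    (K.homologyπ i).hom z = 0 ↔ ∃ y : K.X (i + 1), (K.d (i + 1) i).hom y = (K.iCycles i).hom z := by
  have hd : ∀ y, (K.iCycles i).hom ((K.toCycles (i + 1) i).hom y) = (K.d (i + 1) i).hom y :=
    fun y ↦ congrArg (fun f ↦ f.hom y) (K.toCycles_i (i + 1) i)
  constructor
  · intro h
    obtain ⟨y, rfl⟩ := (ShortComplex.moduleCat_exact_iff _).1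
      (ShortComplex.exact_of_g_is_cokernel (ShortComplex.mk _ _ (K.toCycles_comp_homologyπ (i + 1) i))
        (K.homologyIsCokernel (i + 1) i (by simp))) z h
    exact ⟨y, (hd y).symm⟩
  · rintro ⟨y, hy⟩
    rw [← hd] at hy
    rw [← iCycles_injective K i hy]
    exact congrArg (fun f ↦ f.hom y) (K.toCycles_comp_homologyπ (i + 1) i)

/-- Injectivity and surjectivity on homology, stated on representatives so that the computations
with families above apply directly. -/
lemma isIso_homologyMap_of_forall {K L : ChainComplex (ModuleCat.{u} A) ℤ} (φ : K ⟶ L) (i : ℤ)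
    (hinj : ∀ (x : K.X i) (y : L.X (i + 1)), (K.d i (i - 1)).hom x = 0 →
      (L.d (i + 1) i).hom y = (φ.f i).hom x → ∃ x', (K.d (i + 1) i).hom x' = x)
    (hsurj : ∀ y : L.X i, (L.d i (i - 1)).hom y = 0 → ∃ (x : K.X i) (y' : L.X (i + 1)),
      (K.d i (i - 1)).hom x = 0 ∧ y = (φ.f i).hom x + (L.d (i + 1) i).hom y') :
    IsIso (HomologicalComplex.homologyMap φ i) := by
  have hπ : ∀ z, (HomologicalComplex.homologyMap φ i).hom ((K.homologyπ i).hom z) =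
      (L.homologyπ i).hom ((HomologicalComplex.cyclesMap φ i).hom z) := fun z ↦
    congrArg (fun f ↦ f.hom z) (HomologicalComplex.homologyπ_naturality φ i)
  have hi : ∀ z, (L.iCycles i).hom ((HomologicalComplex.cyclesMap φ i).hom z) =
      (φ.f i).hom ((K.iCycles i).hom z) := fun z ↦
    congrArg (fun f ↦ f.hom z) (HomologicalComplex.cyclesMap_i φ i)
  have hKπ : Function.Surjective (K.homologyπ i).hom :=
    (ModuleCat.epi_iff_surjective _).1 inferInstance
  have hLπ : Function.Surjective (L.homologyπ i).hom :=
    (ModuleCat.epi_iff_surjective _).1 inferInstance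
  have : Mono (HomologicalComplex.homologyMap φ i) := by
    rw [ModuleCat.mono_iff_injective]
    refine (injective_iff_map_eq_zero (HomologicalComplex.homologyMap φ i).hom).2 fun h hh ↦ ?_
    obtain ⟨z, rfl⟩ := hKπ h
    rw [hπ, homologyπ_eq_zero_iff] at hh
    obtain ⟨y, hy⟩ := hh
    rw [hi] at hy
    rw [homologyπ_eq_zero_iff]
    exact hinj _ y (congrArg (fun f ↦ f.hom z) (K.iCycles_d i (i - 1))) hy
  have : Epi (HomologicalComplex.homologyMap φ i) := by
    rw [ModuleCat.epi_iff_surjective]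
    intro h
    obtain ⟨z, rfl⟩ := hLπ h
    obtain ⟨x, y', hx, hxy⟩ := hsurj ((L.iCycles i).hom z)
      (congrArg (fun f ↦ f.hom z) (L.iCycles_d i (i - 1)))
    obtain ⟨z', rfl⟩ := exists_iCycles_eq K (j := i - 1) (by simp) x hx
    refine ⟨(K.homologyπ i).hom z', ?_⟩
    refine (hπ z').trans (Eq.symm ?_)
    rw [← sub_eq_zero, ← map_sub, homologyπ_eq_zero_iff]
    refine ⟨y', ?_⟩
    rw [map_sub, hi, hxy, add_sub_cancel_left]
  exact isIso_of_mono_of_epi _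

end

/-! ### The short exact sequence of truncated complexes -/

section

variable (k : Type w) [CommRing k] {R : Type u} [Ring R] [Algebra k R]
  (Q : ChainComplex (ModuleCat.{u} Rᵐᵒᵖ) ℤ) (J J' : CochainComplex (ModuleCat.{u} R) ℤ) (n : ℤ)

lemma prodTensorMap_mem_ge (φ : J ⟶ J') (t : ℤ) (x : ProdTensor k Q J t)
    (hx : x ∈ geTensor k Q J n t) : prodTensorMap k Q φ t x ∈ geTensor k Q J' n t :=
  fun a ha ↦ by simp [prodTensorMap, hx a ha]

/-- The part of the completed tensor product in the degrees `q ≥ n`, reindexed. -/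
def geComplex : ChainComplex (ModuleCat.{u} k) ℤ :=
  chainComplexOfStep (fun m ↦ ModuleCat.of k (geTensor k Q J n (m - n)))
    (fun i j h ↦ ModuleCat.ofHom
      ((prodTensorD k Q J (i - n) (j - n) (by omega)).restrict (prodTensorD_mem_ge k Q n _ _ _)))
    (fun i j l h h' ↦ by
      refine ModuleCat.hom_ext (LinearMap.ext fun x ↦ Subtype.ext ?_)
      exact prodTensorD_comp k Q J (i - n) (j - n) (l - n) (by omega) (by omega) x.1)

lemma geComplex_d (i j : ℤ) (h : j + 1 = i) (x : (geComplex k Q J n).X i) :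
    (((geComplex k Q J n).d i j).hom x).1 =
      prodTensorD k Q J (i - n) (j - n) (by omega) x.1 := by
  have h1 : (geComplex k Q J n).d i j = _ := chainComplexOfStep_d _ _ _ i j h
  rw [h1]
  rfl

/-- The part of the tensor product in the degrees `q ≥ n`, reindexed. -/
def finComplex : ChainComplex (ModuleCat.{u} k) ℤ :=
  chainComplexOfStep
    (fun m ↦ ModuleCat.of k ↥(geTensor k Q J n (m - n) ⊓ finTensor k Q J (m - n)))
    (fun i j h ↦ ModuleCat.ofHom
      ((prodTensorD k Q J (i - n) (j - n) (by omega)).restrict fun x hx ↦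
        ⟨prodTensorD_mem_ge k Q n _ _ _ x hx.1, finTensor_le_comap k Q J _ _ _ hx.2⟩))
    (fun i j l h h' ↦ by
      refine ModuleCat.hom_ext (LinearMap.ext fun x ↦ Subtype.ext ?_)
      exact prodTensorD_comp k Q J (i - n) (j - n) (l - n) (by omega) (by omega) x.1)

lemma finComplex_d (i j : ℤ) (h : j + 1 = i) (x : (finComplex k Q J n).X i) :
    (((finComplex k Q J n).d i j).hom x).1 =
      prodTensorD k Q J (i - n) (j - n) (by omega) x.1 := by
  have h1 : (finComplex k Q J n).d i j = _ := chainComplexOfStep_d _ _ _ i j h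
  rw [h1]
  rfl

/-- The complex `Q ⊗̃_R J`, reindexed. -/
def stableShift : ChainComplex (ModuleCat.{u} k) ℤ where
  X m := (stableTensor k Q J).X (m - n)
  d i j := (stableTensor k Q J).d (i - n) (j - n)
  shape i j h := (stableTensor k Q J).shape _ _ fun h' ↦ h (by
    have : j - n + 1 = i - n := h'
    change j + 1 = i
    omega)

lemma stableShift_d (i j : ℤ) (h : j + 1 = i) (x : ProdTensor k Q J (i - n)) :
    ((stableShift k Q J n).d i j).hom ((finTensor k Q J (i - n)).mkQ x) =
      (finTensor k Q J (j - n)).mkQ (prodTensorD k Q J (i - n) (j - n) (by omega) x) := by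
  have := stableTensor_d k Q J (i - n) (j - n) (by omega)
  dsimp only [stableShift]
  rw [this]
  rfl

/-- The inclusion of the tensor product in the completed tensor product. -/
def finToGe : finComplex k Q J n ⟶ geComplex k Q J n where
  f m := ModuleCat.ofHom (Submodule.inclusion inf_le_left)
  comm' i j h := by
    ext x
    refine Subtype.ext ?_
    exact (geComplex_d k Q J n i j h _).trans (finComplex_d k Q J n i j h x).symm

/-- The projection from the completed tensor product to the quotient `Q ⊗̃_R J`. -/
def geToStable : geComplex k Q J n ⟶ stableShift k Q J n where
  f m := ModuleCat.ofHom ((finTensor k Q J (m - n)).mkQ ∘ₗ (geTensor k Q J n (m - n)).subtype)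
  comm' i j h := by
    ext x
    refine (stableShift_d k Q J n i j h x.1).trans ?_
    exact congrArg (finTensor k Q J (j - n)).mkQ (geComplex_d k Q J n i j h x).symm

/-- The sequence of the tensor product, the completed tensor product and their quotient. -/
def truncSeq : ShortComplex (ChainComplex (ModuleCat.{u} k) ℤ) :=
  ShortComplex.mk (finToGe k Q J n) (geToStable k Q J n) (by
    ext m x
    exact (Submodule.Quotient.mk_eq_zero _).2 x.2.2)

lemma truncSeq_shortExact (hJ : ∀ q < 0, IsZero (J.X q)) : (truncSeq k Q J n).ShortExact := by
  refine HomologicalComplex.shortExact_of_degreewise_shortExact _ fun m ↦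
    { exact := ?_, mono_f := ?_, epi_g := ?_ }
  · rw [ShortComplex.moduleCat_exact_iff]
    intro (x : geTensor k Q J n (m - n)) hx
    have hx' : x.1 ∈ finTensor k Q J (m - n) := (Submodule.Quotient.mk_eq_zero _).1 hx
    exact ⟨(⟨x.1, x.2, hx'⟩ : ↥(geTensor k Q J n (m - n) ⊓ finTensor k Q J (m - n))), rfl⟩
  · exact (ModuleCat.mono_iff_injective _).2 (Submodule.inclusion_injective inf_le_left)
  · refine (ModuleCat.epi_iff_surjective _).2 fun (y : _ ⧸ finTensor k Q J (m - n)) ↦ ?_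
    obtain ⟨x, rfl⟩ := (finTensor k Q J (m - n)).mkQ_surjective y
    -- Deleting the columns `q < n` changes only those with `0 ≤ q < n`, since `J` vanishes in
    -- negative degrees. The difference has finite support.
    let x' : ProdTensor k Q J (m - n) := fun a ↦ if a.1.2 < n then 0 else x a
    refine ⟨(⟨x', fun a ha ↦ if_pos ha⟩ : geTensor k Q J n (m - n)), ?_⟩
    refine (Submodule.Quotient.eq _).2 (mem_finTensor_of_bounded k Q _ 0 n (fun a ha ↦ ?_)
      fun a ha ↦ ?_)
    · have : Subsingleton (J.X a.1.2) := ModuleCat.subsingleton_of_isZero (hJ _ ha)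
      exact BalTensor.eq_zero_of_subsingleton k _
    · change x' a - x a = 0
      simp only [x']
      rw [if_neg (by omega), sub_self]

variable {J J'}

/-- The morphism of sequences induced by a morphism of complexes. -/
def truncSeqMap (φ : J ⟶ J') : truncSeq k Q J n ⟶ truncSeq k Q J' n where
  τ₁ :=
    { f := fun m ↦ ModuleCat.ofHom ((prodTensorMap k Q φ (m - n)).restrict fun x hx ↦
        ⟨prodTensorMap_mem_ge k Q J J' n φ _ x hx.1, finTensor_le_comap_map k Q φ _ hx.2⟩)
      comm' := fun i j h ↦ by
        ext x
        refine Subtype.ext ?_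
        refine (finComplex_d k Q J' n i j h _).trans ?_
        refine (prodTensorMap_comm k Q φ (i - n) (j - n) _ x.1).trans ?_
        exact congrArg (prodTensorMap k Q φ (j - n)) (finComplex_d k Q J n i j h x).symm }
  τ₂ :=
    { f := fun m ↦ ModuleCat.ofHom ((prodTensorMap k Q φ (m - n)).restrict
        (prodTensorMap_mem_ge k Q J J' n φ _))
      comm' := fun i j h ↦ by
        ext x
        refine Subtype.ext ?_
        refine (geComplex_d k Q J' n i j h _).trans ?_
        refine (prodTensorMap_comm k Q φ (i - n) (j - n) _ x.1).trans ?_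
        exact congrArg (prodTensorMap k Q φ (j - n)) (geComplex_d k Q J n i j h x).symm }
  τ₃ :=
    { f := fun m ↦ (stableTensorMap k Q φ).f (m - n)
      comm' := fun i j h ↦ (stableTensorMap k Q φ).comm _ _ }
  comm₁₂ := rfl
  comm₂₃ := rfl

end

/-! ### Stable homology in terms of Tor -/

lemma BalTensor.exact_of_projective (k : Type w) [CommRing k] {R : Type u} [Ring R] [Algebra k R]
    {M N N' N'' : Type u} [AddCommGroup M] [Module k M] [Module Rᵐᵒᵖ M] [IsScalarTower k Rᵐᵒᵖ M]
    [AddCommGroup N] [Module k N] [Module R N] [IsScalarTower k R N]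
    [AddCommGroup N'] [Module k N'] [Module R N'] [IsScalarTower k R N']
    [AddCommGroup N''] [Module k N''] [Module R N''] [IsScalarTower k R N'']
    [Module.Projective Rᵐᵒᵖ M] {f : N →ₗ[R] N'} {g : N' →ₗ[R] N''} (h : Function.Exact f g)
    (x : BalTensor k R M N') (hx : map k (LinearMap.id : M →ₗ[Rᵐᵒᵖ] M) g x = 0) :
    ∃ y, map k (LinearMap.id : M →ₗ[Rᵐᵒᵖ] M) f y = x := by
  refine exact_right k (g := g.rangeRestrict) (fun y ↦ ?_) g.surjective_rangeRestrict x ?_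
  · rw [← h y]
    exact ⟨fun hy ↦ congrArg Subtype.val hy, fun hy ↦ Subtype.ext hy⟩
  · refine map_injective_of_projective_left k (LinearMap.range g).injective_subtype ?_
    rw [map_zero, map_map]
    exact hx

/-! ### Homology of the two truncated complexes. -/

section

variable (k : Type w) [CommRing k] {R : Type u} [Ring R] [Algebra k R]
  (Q : ChainComplex (ModuleCat.{u} Rᵐᵒᵖ) ℤ) (J J' : CochainComplex (ModuleCat.{u} R) ℤ) (n : ℤ)

/-- The inclusion of `Q_m ⊗_R Z^n` in the tensor product. -/
def cyclesInclusion (m : ℤ) : BalTensor k R (Q.X m) (J.cycles n) →ₗ[k]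
    ↥(geTensor k Q J n (m - n) ⊓ finTensor k Q J (m - n)) :=
  LinearMap.codRestrict _ (LinearMap.single k
      (fun a : Bidegree (m - n) ↦ BalTensor k R (Q.X a.1.1) (J.X a.1.2)) ⟨(m, n), by simp⟩ ∘ₗ
    BalTensor.map k LinearMap.id (J.iCycles n).hom) fun x ↦ by
  have h : ∀ a : Bidegree (m - n), a.1.2 ≠ n → Pi.single
      (M := fun a : Bidegree (m - n) ↦ BalTensor k R (Q.X a.1.1) (J.X a.1.2))
      (⟨(m, n), by simp⟩ : Bidegree (m - n))
      (BalTensor.map k LinearMap.id (J.iCycles n).hom x) a = 0 := fun a ha ↦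
    Pi.single_eq_of_ne (fun h ↦ ha (by rw [h])) _
  exact ⟨fun a ha ↦ h a ha.ne, mem_finTensor_of_bounded k Q _ n n (fun a ha ↦ h a ha.ne)
    fun a ha ↦ h a ha.ne'⟩

lemma cyclesInclusion_val (m : ℤ) (x : BalTensor k R (Q.X m) (J.cycles n)) :
    (cyclesInclusion k Q J n m x).1 = Pi.single (⟨(m, n), by simp⟩ : Bidegree (m - n))
      (BalTensor.map k LinearMap.id (J.iCycles n).hom x) := rfl

lemma prodTensorD_cyclesInclusion (i j : ℤ) (h : j + 1 = i)
    (x : BalTensor k R (Q.X i) (J.cycles n)) :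
    prodTensorD k Q J (i - n) (j - n) (by omega) (cyclesInclusion k Q J n i x).1 =
      (cyclesInclusion k Q J n j (BalTensor.map k (Q.d i j).hom LinearMap.id x)).1 := by
  rw [cyclesInclusion_val, cyclesInclusion_val,
    prodTensorD_single k Q (i - n) (j - n) (by omega) i n j (n + 1) (by simp) h rfl]
  have h1 : (J.d n (n + 1)).hom ∘ₗ (J.iCycles n).hom = 0 := by
    rw [← ModuleCat.hom_comp, J.iCycles_d]; rfl
  rw [BalTensor.map_map, BalTensor.map_map, BalTensor.map_map, h1, BalTensor.map_zero_right,
    LinearMap.zero_apply, Pi.single_zero, smul_zero, add_zero]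
  rfl

lemma cyclesInclusion_injective (hQ : ∀ p, Projective (Q.X p)) (m : ℤ) :
    Function.Injective (cyclesInclusion k Q J n m) := by
  intro x y hxy
  have : Module.Projective Rᵐᵒᵖ (Q.X m) := (IsProjective.iff_projective _).2 (hQ m)
  refine BalTensor.map_injective_of_projective_left k (iCycles_injective J n) ?_
  have h := congrFun (congrArg Subtype.val hxy) ⟨(m, n), by simp⟩
  rw [cyclesInclusion_val, cyclesInclusion_val, Pi.single_eq_same, Pi.single_eq_same] at h
  exact h

/-- The inclusion `Q ⊗_R Z^n ⟶ Q ⊗_R J` as a morphism of complexes. -/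
def cyclesToFin : (tensorComplex k R Q).obj (J.cycles n) ⟶ finComplex k Q J n where
  f m := ModuleCat.ofHom (cyclesInclusion k Q J n m)
  comm' i j h := by
    refine ModuleCat.hom_ext (LinearMap.ext fun x ↦ Subtype.ext ?_)
    exact (finComplex_d k Q J n i j h _).trans (prodTensorD_cyclesInclusion k Q J n i j h x)

variable {J} in
-- The differential of `x` has to vanish only in the columns `q > n`. This covers cycles, as needed
-- for surjectivity on homology, and also elements whose boundary lies in `Q ⊗ Z^n`, as needed for
-- injectivity.
lemma exists_cyclesInclusion_add (hQ : ∀ p, Projective (Q.X p)) (hJ : ∀ q > n, J.ExactAt q)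
    (m m' : ℤ) (hm : m' + 1 = m) (x : (finComplex k Q J n).X m) (hx : ∀ b, n < b.1.2 →
      prodTensorD k Q J (m - n) (m' - n) (by omega) x.1 b = 0) :
    ∃ (u : ((tensorComplex k R Q).obj (J.cycles n)).X m) (y : (finComplex k Q J n).X (m + 1)),
      x = ((cyclesToFin k Q J n).f m).hom u + ((finComplex k Q J n).d (m + 1) m).hom y := by
  have hproj : ∀ p, Module.Projective Rᵐᵒᵖ (Q.X p) := fun p ↦
    (IsProjective.iff_projective _).2 (hQ p)
  obtain ⟨s, hs⟩ := exists_bound_of_mem_finTensor k Q n x.2.2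
  -- The degrees `m' - n`, `m - n`, `m + 1 - n` are consecutive only up to propositional equality,
  -- so the three degrees are made variables.
  have hcast : ∀ (t t' t'' : ℤ) (h' : t' + 1 = t) (h'' : t + 1 = t'') (ht : m = n + t)
      (x : ProdTensor k Q J t) (_ : ∀ a, a.1.2 < n → x a = 0)
      (_ : ∀ a, n + s < a.1.2 → x a = 0)
      (_ : ∀ b, n < b.1.2 → prodTensorD k Q J t t' h' x b = 0),
      ∃ (z : BalTensor k R (Q.X m) (J.X n)) (y : ProdTensor k Q J t''),
        BalTensor.map k (LinearMap.id : Q.X m →ₗ[Rᵐᵒᵖ] Q.X m) (J.d n (n + 1)).hom z = 0 ∧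
        (∀ a, a.1.2 < n → y a = 0) ∧ y ∈ finTensor k Q J t'' ∧
        x = Pi.single (⟨(m, n), ht⟩ : Bidegree t) z + prodTensorD k Q J t'' t h'' y := by
    intro t t' t'' h' h'' ht x h1 h2 h3
    obtain rfl : t' = t - 1 := by omega
    subst h''
    obtain ⟨p, hp, H⟩ := exists_eq_single_add k Q n t (fun p q q' hq hqq' z hz ↦ by
      have hex : Function.Exact (J.d q q').hom (J.d q' (q' + 1)).hom :=
        (ShortComplex.ShortExact.moduleCat_exact_iff_function_exact _).1
          ((J.exactAt_iff' q q' (q' + 1) (by simp [← hqq']) (by simp)).1 (hJ q' hq))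
      exact BalTensor.exact_of_projective k hex z hz)
      s x h1 h2 h3
    obtain rfl : p = m := by omega
    exact H
  obtain ⟨z, y, hz, hy, hyf, hxy⟩ := hcast (m - n) (m' - n) (m + 1 - n) (by omega) (by omega)
    (by omega) x.1 x.2.1 hs hx
  have hex : Function.Exact (J.iCycles n).hom (J.d n (n + 1)).hom :=
    (ShortComplex.ShortExact.moduleCat_exact_iff_function_exact _).1
      (ShortComplex.exact_of_f_is_kernel (ShortComplex.mk _ _ (J.iCycles_d n (n + 1)))
        (J.cyclesIsKernel n (n + 1) (by simp)))
  obtain ⟨u, rfl⟩ := BalTensor.exact_of_projective k hex z hz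
  let y' : (finComplex k Q J n).X (m + 1) :=
    (⟨y, hy, hyf⟩ : ↥(geTensor k Q J n (m + 1 - n) ⊓ finTensor k Q J (m + 1 - n)))
  have hy' := finComplex_d k Q J n (m + 1) m rfl y'
  refine ⟨u, y', Subtype.ext (hxy.trans ?_)⟩
  exact congrArg _ hy'.symm

lemma isIso_homologyMap_cyclesToFin (hQ : ∀ p, Projective (Q.X p)) (hJ : ∀ q > n, J.ExactAt q)
    (m : ℤ) : IsIso (HomologicalComplex.homologyMap (cyclesToFin k Q J n) m) := by
  have hinj : ∀ m, Function.Injective ((cyclesToFin k Q J n).f m).hom :=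
    cyclesInclusion_injective k Q J n hQ
  have hd : ∀ i (u : ((tensorComplex k R Q).obj (J.cycles n)).X i) j,
      ((finComplex k Q J n).d i j).hom (((cyclesToFin k Q J n).f i).hom u) =
        ((cyclesToFin k Q J n).f j).hom ((((tensorComplex k R Q).obj (J.cycles n)).d i j).hom u) :=
    fun i u j ↦ congrArg (fun f ↦ f.hom u) ((cyclesToFin k Q J n).comm i j)
  have hdd : ∀ i j l y, ((finComplex k Q J n).d j l).hom (((finComplex k Q J n).d i j).hom y) = 0 :=
    fun i j l y ↦ congrArg (fun f ↦ f.hom y) ((finComplex k Q J n).d_comp_d i j l)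
  refine isIso_homologyMap_of_forall _ m (fun x y hx hxy ↦ ?_) fun y hy ↦ ?_
  -- The boundary of `y` is the image of `x`, concentrated in column `n`. So `y` is, up to a
  -- boundary, the image of some `u`, and `u` has boundary `x` because the inclusion is injective.
  · have hD := (finComplex_d k Q J n (m + 1) m rfl y).symm.trans (congrArg Subtype.val hxy)
    obtain ⟨u, v, rfl⟩ := exists_cyclesInclusion_add k Q n hQ hJ (m + 1) m rfl y
      (fun b hb ↦ (congrFun hD b).trans (Pi.single_eq_of_ne (fun h ↦ hb.ne' (by rw [h])) _))
    refine ⟨u, hinj m ?_⟩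
    rw [← hxy, map_add, hdd, add_zero, hd]
  · have hD := (finComplex_d k Q J n m (m - 1) (by omega) y).symm.trans (congrArg Subtype.val hy)
    obtain ⟨u, v, huv⟩ := exists_cyclesInclusion_add k Q n hQ hJ m (m - 1) (by omega) y
      (fun b _ ↦ congrFun hD b)
    refine ⟨u, v, hinj (m - 1) ?_, huv⟩
    rw [huv, map_add, hdd, add_zero, hd] at hy
    rw [hy, map_zero]

variable {J J'}

lemma cyclesToFin_naturality (φ : J ⟶ J') :
    (tensorComplex k R Q).map (HomologicalComplex.cyclesMap φ n) ≫ cyclesToFin k Q J' n =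
      cyclesToFin k Q J n ≫ (truncSeqMap k Q n φ).τ₁ := by
  ext m : 1
  refine ModuleCat.hom_ext (LinearMap.ext fun (x : BalTensor k R (Q.X m) (J.cycles n)) ↦
    Subtype.ext (funext fun ⟨⟨p, q⟩, hpq⟩ ↦ ?_))
  have hφ : (J'.iCycles n).hom ∘ₗ (HomologicalComplex.cyclesMap φ n).hom =
      (φ.f n).hom ∘ₗ (J.iCycles n).hom := by
    rw [← ModuleCat.hom_comp, ← ModuleCat.hom_comp, HomologicalComplex.cyclesMap_i]
  change Pi.single (M := fun a : Bidegree (m - n) ↦ BalTensor k R (Q.X a.1.1) (J'.X a.1.2))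
      (⟨(m, n), _⟩ : Bidegree (m - n)) (BalTensor.map k LinearMap.id (J'.iCycles n).hom
        (BalTensor.map k LinearMap.id (HomologicalComplex.cyclesMap φ n).hom x)) ⟨(p, q), hpq⟩ =
    BalTensor.map k LinearMap.id (φ.f q).hom (Pi.single
      (M := fun a : Bidegree (m - n) ↦ BalTensor k R (Q.X a.1.1) (J.X a.1.2))
      (⟨(m, n), _⟩ : Bidegree (m - n)) (BalTensor.map k LinearMap.id (J.iCycles n).hom x)
        ⟨(p, q), hpq⟩)
  dsimp only at hpq
  by_cases h : q = n
  · obtain rfl : p = m := by omega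
    subst h
    rw [Pi.single_eq_same, Pi.single_eq_same, BalTensor.map_map, BalTensor.map_map, hφ]
  · have hne : (⟨(p, q), hpq⟩ : Bidegree (m - n)) ≠ ⟨(m, n), by simp⟩ := by
      simp only [ne_eq, Subtype.mk.injEq, Prod.mk.injEq]; omega
    rw [Pi.single_eq_of_ne hne, Pi.single_eq_of_ne hne, map_zero]

variable (J) in
-- In the reindexed degree `m` the component in column `q` has `p = q + m - n`, which is at least
-- `m` when `q ≥ n`. So exact columns in the degrees `p ≥ m` are enough.
lemma geComplex_exactAt (m : ℤ) (hQ : ∀ p q, n ≤ q → m ≤ p →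
    ((tensorComplex k R Q).obj (J.X q)).ExactAt p) : (geComplex k Q J n).ExactAt m := by
  rw [exactAt_iff_forall]
  have hcast : ∀ (t t' t'' : ℤ) (h' : t' + 1 = t) (h'' : t + 1 = t'') (ht : m = n + t)
      (x : ProdTensor k Q J t) (_ : ∀ a, a.1.2 < n → x a = 0)
      (_ : prodTensorD k Q J t t' h' x = 0),
      ∃ (y : ProdTensor k Q J t''), (∀ a, a.1.2 < n → y a = 0) ∧
        prodTensorD k Q J t'' t h'' y = x := by
    intro t t' t'' h' h'' ht x h1 h2
    obtain rfl : t' = t - 1 := by omega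
    subst h''
    exact exists_prodTensorD_eq k Q n t (fun p q hq hp ↦
      (exactAt_iff_forall _ p).1 (hQ p q hq (by omega))) x h1 h2
  intro x hx
  obtain ⟨y, hy, hxy⟩ := hcast (m - n) (m - 1 - n) (m + 1 - n) (by omega) (by omega) (by omega)
    x.1 x.2 ((geComplex_d k Q J n m (m - 1) (by omega) x).symm.trans (congrArg Subtype.val hx))
  exact ⟨⟨y, hy⟩, Subtype.ext ((geComplex_d k Q J n (m + 1) m rfl _).trans hxy)⟩

end

/-! ### The comparison isomorphisms as natural isomorphisms of functors of the resolution. -/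

section

variable (k : Type w) [CommRing k] {R : Type u} [Ring R] [Algebra k R]
  (Q : ChainComplex (ModuleCat.{u} Rᵐᵒᵖ) ℤ) (n : ℤ)

/-- The functor `J ↦ truncSeq k Q J n`. -/
def truncSeqFunctor :
    CochainComplex (ModuleCat.{u} R) ℤ ⥤ ShortComplex (ChainComplex (ModuleCat.{u} k) ℤ) where
  obj J := truncSeq k Q J n
  map φ := truncSeqMap k Q n φ
  map_id J := by
    have h (m : ℤ) (x : ProdTensor k Q J (m - n)) : prodTensorMap k Q (𝟙 J) (m - n) x = x :=
      funext fun a ↦ DFunLike.congr_fun (BalTensor.map_id k R) (x a)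
    refine ShortComplex.hom_ext _ _ ?_ ?_ ?_
    · refine HomologicalComplex.hom_ext _ _ fun m ↦ ModuleCat.hom_ext (LinearMap.ext fun x ↦ ?_)
      exact Subtype.ext (h m x.1)
    · refine HomologicalComplex.hom_ext _ _ fun m ↦ ModuleCat.hom_ext (LinearMap.ext fun x ↦ ?_)
      exact Subtype.ext (h m x.1)
    · refine HomologicalComplex.hom_ext _ _ fun m ↦ ?_
      exact congrArg (fun φ ↦ HomologicalComplex.Hom.f φ (m - n)) ((stableTensorFunctor k Q).map_id J)
  map_comp {J J' J''} φ ψ := by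
    have h (m : ℤ) (x : ProdTensor k Q J (m - n)) : prodTensorMap k Q (φ ≫ ψ) (m - n) x =
        prodTensorMap k Q ψ (m - n) (prodTensorMap k Q φ (m - n) x) :=
      funext fun a ↦ (BalTensor.map_map k R LinearMap.id LinearMap.id (φ.f a.1.2).hom
        (ψ.f a.1.2).hom (x a)).symm
    refine ShortComplex.hom_ext _ _ ?_ ?_ ?_
    · refine HomologicalComplex.hom_ext _ _ fun m ↦ ModuleCat.hom_ext (LinearMap.ext fun x ↦ ?_)
      exact Subtype.ext (h m x.1)
    · refine HomologicalComplex.hom_ext _ _ fun m ↦ ModuleCat.hom_ext (LinearMap.ext fun x ↦ ?_)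
      exact Subtype.ext (h m x.1)
    · refine HomologicalComplex.hom_ext _ _ fun m ↦ ?_
      exact congrArg (fun φ ↦ HomologicalComplex.Hom.f φ (m - n))
        ((stableTensorFunctor k Q).map_comp φ ψ)

/-- The differentials around a degree of the reindexed complex. -/
def stableShiftScIso (i j l : ℤ) :
    stableTensorFunctor k Q ⋙
        HomologicalComplex.shortComplexFunctor' _ _ (i - n) (j - n) (l - n) ≅
      truncSeqFunctor k Q n ⋙ ShortComplex.π₃ ⋙
        HomologicalComplex.shortComplexFunctor' _ _ i j l :=
  Iso.refl _

/-- The homology of the reindexed complex. -/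
def stableShiftHomologyIso (m l : ℤ) (h : m - n = l) :
    stableTensorFunctor k Q ⋙ HomologicalComplex.homologyFunctor _ _ l ≅
      truncSeqFunctor k Q n ⋙ ShortComplex.π₃ ⋙ HomologicalComplex.homologyFunctor _ _ m :=
  Functor.isoWhiskerLeft (stableTensorFunctor k Q)
      (HomologicalComplex.homologyFunctorIso' _ _ (m + 1 - n) l (m - 1 - n)
        (by simp; omega) (by simp; omega)) ≪≫
    -- Reindexing leaves the differentials around a degree literally unchanged. Only the middle
    -- degree `m - n` has to be rewritten as `l`.
    Functor.isoWhiskerRight (h ▸ stableShiftScIso k Q n (m + 1) m (m - 1) :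
      stableTensorFunctor k Q ⋙
        HomologicalComplex.shortComplexFunctor' _ _ (m + 1 - n) l (m - 1 - n) ≅ _)
      (ShortComplex.homologyFunctor _) ≪≫
    Functor.isoWhiskerLeft (truncSeqFunctor k Q n ⋙ ShortComplex.π₃)
      (HomologicalComplex.homologyFunctorIso' _ _ (m + 1) m (m - 1) (by simp) (by simp)).symm

variable (M : ModuleCat.{u} Rᵐᵒᵖ)

/-- The homology of the column `P ⊗ J^q` in degree `p` is `Tor_p(M, J^q)`, and `J^q` is injective.
-/
lemma geComplex_exactAt_of_isResolution {J : CochainComplex (ModuleCat.{u} R) ℤ}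
    (hJ : isResolution _ J) (d : ℤ) (hd : ∀ j > d, VanishesOnInjectives (torFunctor k M j))
    (m : ℤ) (hm : d < m) : (geComplex k (projRes R M) J n).ExactAt m :=
  geComplex_exactAt k _ J n m fun p q _ hp ↦
    (HomologicalComplex.exactAt_iff_isZero_homology _ _).2
      (hd p (by omega) (J.X q) (hJ.1 q))

lemma isIso_truncSeq_δ {J : CochainComplex (ModuleCat.{u} R) ℤ}
    (hJ : isResolution _ J) (d : ℤ) (hd : ∀ j > d, VanishesOnInjectives (torFunctor k M j))
    (m : ℤ) (hm : d < m) :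
    IsIso ((truncSeq_shortExact k (projRes R M) J n hJ.2.1).δ (m + 1) m rfl) :=
  ShortComplex.ShortExact.isIso_δ _ _ _ _
    (geComplex_exactAt_of_isResolution k n M hJ d hd _ (by omega)).isZero_homology
    (geComplex_exactAt_of_isResolution k n M hJ d hd _ hm).isZero_homology

/-- The connecting homomorphism of `truncSeq` in homology, for resolutions `J`. -/
def truncSeqδIso (d : ℤ) (hd : ∀ j > d, VanishesOnInjectives (torFunctor k M j))
    (m : ℤ) (hm : d < m) :
    (isResolution (ModuleCat.{u} R)).ι ⋙ truncSeqFunctor k (projRes R M) n ⋙ ShortComplex.π₃ ⋙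
        HomologicalComplex.homologyFunctor _ _ (m + 1) ≅
      (isResolution (ModuleCat.{u} R)).ι ⋙ truncSeqFunctor k (projRes R M) n ⋙ ShortComplex.π₁ ⋙
        HomologicalComplex.homologyFunctor _ _ m :=
  NatIso.ofComponents (fun J ↦
    @asIso _ _ _ _ ((truncSeq_shortExact k (projRes R M) J.obj n J.property.2.1).δ (m + 1) m rfl)
      (isIso_truncSeq_δ k n M J.property d hd m hm))
    fun {J J'} φ ↦ (HomologicalComplex.HomologySequence.δ_naturality
      (truncSeqMap k (projRes R M) n φ.hom)
      (truncSeq_shortExact k (projRes R M) J.obj n J.property.2.1)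
      (truncSeq_shortExact k (projRes R M) J'.obj n J'.property.2.1) (m + 1) m rfl).symm

/-- The complexes `Q ⊗_R Z^n` and `Q ⊗_R J` in degrees at least `n` have the same homology. -/
def cyclesToFinIso (hn : 0 ≤ n) (m : ℤ) :
    resolutionCycles (ModuleCat.{u} R) n ⋙ torFunctor k M m ≅
      (isResolution (ModuleCat.{u} R)).ι ⋙ truncSeqFunctor k (projRes R M) n ⋙ ShortComplex.π₁ ⋙
        HomologicalComplex.homologyFunctor _ _ m :=
  NatIso.ofComponents (fun J ↦
    have : IsIso (HomologicalComplex.homologyMap (cyclesToFin k (projRes R M) J.obj n) m) :=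
      isIso_homologyMap_cyclesToFin k _ _ n inferInstance
        (fun q hq ↦ J.property.2.2 q (by omega)) m
    @asIso _ _ _ _ (HomologicalComplex.homologyMap (cyclesToFin k (projRes R M) J.obj n) m) this)
    fun φ ↦ (HomologicalComplex.homologyMap_comp _ _ _).symm.trans
      ((congrArg (fun f ↦ HomologicalComplex.homologyMap f m)
        (cyclesToFin_naturality k (projRes R M) n φ.hom)).trans
          (HomologicalComplex.homologyMap_comp _ _ _))

end

/-! ### Resolutions of modules -/

section

variable {C : Type*} [Category* C] [Abelian C] [EnoughInjectives C]

/-- The chosen injective resolution of `N`, in non-negative degrees of an unbounded complex. -/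
def resolution (N : C) : (isResolution C).FullSubcategory where
  obj := (injectiveResolution N).cocomplex.extend ComplexShape.embeddingUpNat
  property := by
    refine ⟨fun q ↦ inferInstance, fun q hq ↦ ?_, fun q hq ↦ ?_⟩
    · exact HomologicalComplex.isZero_extend_X _ _ _ fun i hi ↦ by
        have : (i : ℤ) = q := hi
        omega
    · obtain ⟨n, rfl⟩ : ∃ n : ℕ, ((n + 1 : ℕ) : ℤ) = q := ⟨(q - 1).toNat, by omega⟩
      exact (HomologicalComplex.extend_exactAt_iff _ _ rfl).2
        ((injectiveResolution N).cocomplex_exactAt_succ n)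

/-- A map of the chosen resolutions that extends `f`. -/
def resolutionMap {N N' : C} (f : N ⟶ N') : resolution N ⟶ resolution N' :=
  ObjectProperty.homMk (HomologicalComplex.extendMap
    (InjectiveResolution.desc f (injectiveResolution N') (injectiveResolution N))
    ComplexShape.embeddingUpNat)

/-- `N` is the object of zeroth cocycles of an injective resolution. -/
def zeroCyclesIso {N : C} (I : InjectiveResolution N) : N ≅ I.cocomplex.cycles 0 :=
  I.isLimitKernelFork.conePointUniqueUpToIso (I.cocomplex.cyclesIsKernel 0 1 (by simp))

lemma zeroCyclesIso_hom_iCycles {N : C} (I : InjectiveResolution N) :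
    (zeroCyclesIso I).hom ≫ I.cocomplex.iCycles 0 = I.ι.f 0 :=
  IsLimit.conePointUniqueUpToIso_hom_comp _ _ WalkingParallelPair.zero

lemma zeroCyclesIso_naturality {N N' : C} (f : N ⟶ N') (I : InjectiveResolution N)
    (I' : InjectiveResolution N') :
    f ≫ (zeroCyclesIso I').hom =
      (zeroCyclesIso I).hom ≫ HomologicalComplex.cyclesMap (InjectiveResolution.desc f I' I) 0 := by
  rw [← cancel_mono (I'.cocomplex.iCycles 0), Category.assoc, Category.assoc,
    HomologicalComplex.cyclesMap_i, zeroCyclesIso_hom_iCycles, ← Category.assoc,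
    zeroCyclesIso_hom_iCycles]
  exact (InjectiveResolution.desc_commutes_zero f I' I).symm

/-- `N` is the object of zeroth cocycles of its chosen resolution. -/
def resolutionCyclesIso (N : C) : N ≅ (resolutionCycles C 0).obj (resolution N) :=
  zeroCyclesIso (injectiveResolution N) ≪≫
    ((injectiveResolution N).cocomplex.extendCyclesIso ComplexShape.embeddingUpNat
      (j := 0) (j' := 0) rfl).symm

lemma resolutionCyclesIso_naturality {N N' : C} (f : N ⟶ N') :
    f ≫ (resolutionCyclesIso N').hom =
      (resolutionCyclesIso N).hom ≫ (resolutionCycles C 0).map (resolutionMap f) := by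
  have hn := HomologicalComplex.extendCyclesIso_hom_naturality
    (InjectiveResolution.desc f (injectiveResolution N') (injectiveResolution N))
    ComplexShape.embeddingUpNat (j := 0) (j' := 0) rfl
  rw [← Iso.eq_comp_inv, Category.assoc, ← Iso.inv_comp_eq] at hn
  exact (Category.assoc _ _ _).symm.trans ((congrArg (· ≫ _) (zeroCyclesIso_naturality f _ _)).trans
    ((Category.assoc _ _ _).trans ((congrArg (_ ≫ ·) hn.symm).trans (Category.assoc _ _ _).symm)))

end

/-! ### Assembly of the comparison of complete and stable homology. -/

section

variable {k : Type w} [CommRing k] {R : Type u} [Ring R] [Algebra k R]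

theorem nonempty_completeTor_iso_stableTor (hR : sfli R < ⊤) (M : ModuleCat.{u} Rᵐᵒᵖ) (i : ℤ) :
    Nonempty (completeTor k M i ≅ stableTor k M i) := by
  obtain ⟨d, hd⟩ := exists_isZero_tor_of_sfli k hR
  -- From this `n` on, Tor vanishes on injectives in the degrees `n + i` and above. Both the limit
  -- and the connecting homomorphism are controlled at this single `n`.
  obtain ⟨n, hn⟩ : ∃ n : ℕ, (d : ℤ) < n + i := ⟨(d + 1 - i).toNat, by omega⟩
  have hd' : ∀ j > (d : ℤ), VanishesOnInjectives (torFunctor k M j) := fun j hj E hE ↦ hd M E hE j hj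
  obtain ⟨e⟩ := (tor k M).nonempty_completion_iso i n fun j hj ↦ hd' j (by omega)
  obtain ⟨s⟩ := nonempty_iteratedSatellite_cycles_iso n ((tor k M).T (n + i)) (hd' _ hn)
  let t := truncSeqδIso k n M d hd' (n + i) hn
  let c := cyclesToFinIso k n M (by positivity) (n + i)
  let v := Functor.isoWhiskerLeft (isResolution (ModuleCat.{u} R)).ι
    (stableShiftHomologyIso k (projRes R M) n (n + i + 1) (i + 1) (by omega))
  -- The chain reads `SⁿTor_{n+i}(Z^0) ≅ Tor_{n+i}(Z^n) ≅ H_{n+i}(P ⊗ J^{≥n}) ≅ H_{i+1}(P ⊗̃ J)`,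
  -- naturally in the resolution `J`.
  let g := s ≪≫ c ≪≫ t.symm ≪≫ v.symm
  -- The choice of `resolutionMap f` respects composition only up to homotopy, so `g` cannot be
  -- whiskered with a functor `N ↦ resolution N`. Naturality is checked for each `f` on the chosen
  -- lift, which represents the map used by `stableTor`.
  refine ⟨e ≪≫ NatIso.ofComponents (fun N ↦
    ((tor k M).completionTerm i n).mapIso (resolutionCyclesIso N) ≪≫
      g.app (resolution N)) fun {N N'} f ↦ ?_⟩
  refine (Category.assoc _ _ _).symm.trans (((congrArg (· ≫ _) ?_).trans
    ((Category.assoc _ _ _).trans (congrArg (_ ≫ ·)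
      (g.hom.naturality (resolutionMap f))))).trans (Category.assoc _ _ _).symm)
  exact (((tor k M).completionTerm i n).map_comp _ _).symm.trans
    ((congrArg _ (resolutionCyclesIso_naturality f)).trans
      (((tor k M).completionTerm i n).map_comp _ _))

end

end CompleteHomology

end

theorem mainTheorem7 {k : Type w} [CommRing k] {R : Type u} [Ring R] [Algebra k R] :
    (CompleteHomology.sfli R < ⊤ →
      ∀ (M : ModuleCat.{u} Rᵐᵒᵖ) (i : ℤ),
        Nonempty (CompleteHomology.completeTor k M i ≅ CompleteHomology.stableTor k M i)) ∧
    (CompleteHomology.IsVonNeumannRegular R → CompleteHomology.sfli R < ⊤) ∧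
    (CompleteHomology.IsIwanagaGorenstein R → CompleteHomology.sfli R < ⊤) := by
  exact ⟨CompleteHomology.nonempty_completeTor_iso_stableTor,
    CompleteHomology.sfli_lt_top_of_regular k, CompleteHomology.sfli_lt_top_of_gorenstein k⟩
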